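/- Let $k$ be a field, and let $\mathcal{A}=\mathrm{rep}_k(A_2)$ be the category of finite dimensional representations of the quiver $A_2: 1\to 2$, with indecomposable objects $S_1=(k\to 0)$, $S_2=(0\to k)$, $P_1=(k\xrightarrow{1}k)$. Put $\mathcal{D}=D^b(\mathcal{A})$. A stability condition $\sigma=(Z,\mathcal{P})$ on $\mathcal{D}$ is understood in the sense of Bridgeland, with heart $\mathcal{P}(0,1]$; for $m\in\mathbb{Z}$ its shift $\sigma[m]$ is $\big((-1)^mZ,(\mathcal{P}(\phi+m))_{\phi}\big)$, whose heart is $\mathcal{P}(0,1][m]$. For a semistable object $X$, $\phi(X)$ denotes its phase. The additive hull $\mathrm{add}(\dots)$ consists of all direct summands of finite direct sums of the listed objects. When $k$ is finite, let $*$ be the product of the derived Hall algebra of $\mathcal{D}$, $u_{[M]}*u_{[N]}=\sum_{[L]}F^L_{MN}u_{[L]}$, where $$F_{MN}^L=\frac{|\{f\in \mathrm{Hom}(L,N):\mathrm{cone} f\cong M[1]\}|}{|\mathrm{Aut} N|}\cdot\frac{\{L,N\}}{\{N,N\}},\qquad \{L,N\}=\prod_{i>0}|\mathrm{Hom}(L[i],N)|^{(-1)^i},$$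 extended to functions on isomorphism classes when all the sums are finite. Let $1_{\mathcal{D}}=\sum_{[M]}u_{[M]}$, let $\Phi_X=\sum_{n\ge0}u_{[X^{\oplus n}]}$, and let $\mathrm{SS}^\sigma_\phi$ be the characteristic function of $\mathcal{P}(\phi)$. An infinite ordered product is the coefficientwise limit (each coefficient being eventually constant) of the ordered finite subproducts. Then the following hold. (a) For every stability condition $\sigma$ on $\mathcal{D}$, at least two of $S_1,S_2,P_1$ are $\sigma$-semistable. (b) For every $\sigma$ there are exactly one integer $m$ and exactly one row of the following table ($n$, where it occurs, being a parameter of the row) such that the objects among $S_1,S_2,P_1$ that are semistable for $\sigma[m]$ are exactly those listed, the heart of $\sigma[m]$ is the one listed, and the phases of $\sigma[m]$ satisfy the listed inequality. $$\begin{array}{|c|l|l|l|c|}\hline \text{row}&\text{semistable}&\text{heart}&\text{phases}&\text{formula}\\\hline 1&S_1,S_2&\mathrm{add}(S_2,S_1[n+1]),\ n\ge0&\phi(S_2)\le\phi(S_1[n+1])&(1)_n\\ 2&S_1,S_2&\mathrm{add}(S_2,S_1[n]),\ n\ge1&\phi(S_2)>\phi(S_1[n])&(1)_n\\ 3&S_1,S_2&\mathcal{A}&\phi(S_2)>\phi(S_1)&(1)_0\\\hline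 4&P_1,S_1&\mathrm{add}(S_1,P_1[n+2]),\ n\ge0&\phi(S_1)\le\phi(P_1[n+2])&(2)_n\\ 5&P_1,S_1&\mathrm{add}(S_1,P_1[n+1]),\ n\ge1&\phi(S_1)>\phi(P_1[n+1])&(2)_n\\ 6&P_1,S_1&\mathrm{add}(S_1,S_2[1],P_1[1])&\phi(S_1)>\phi(P_1[1])&(2)_0\\\hline 7&S_2,P_1&\mathrm{add}(P_1,S_2[n+2]),\ n\ge0&\phi(P_1)\le\phi(S_2[n+2])&(3)_n\\ 8&S_2,P_1&\mathrm{add}(P_1,S_2[n+1]),\ n\ge1&\phi(P_1)>\phi(S_2[n+1])&(3)_n\\ 9&S_2,P_1&\mathrm{add}(P_1,S_1,S_2[1])&\phi(P_1)>\phi(S_2[1])&(3)_0\\\hline 10&S_2,P_1,S_1&\mathcal{A}&\phi(S_2)\le\phi(S_1)&(4)\\ 11&S_2,P_1,S_1&\mathrm{add}(S_1,S_2[1],P_1[1])&\phi(S_1)\le\phi(P_1[1])&(4)\\ 12&S_2,P_1,S_1&\mathrm{add}(P_1,S_1,S_2[1])&\phi(P_1)\le\phi(S_2[1])&(4)\\\hline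 \end{array}$$ (c) If $\sigma[m]$ is in a given row, then the phases of $\sigma$ satisfy: in rows 1-3, $\phi(S_1)+n<\phi(S_2)\le\phi(S_1)+n+1$; in rows 4-6, $\phi(P_1)+n+1<\phi(S_1)\le\phi(P_1)+n+2$; in rows 7-9, $\phi(S_2)+n+1<\phi(P_1)\le\phi(S_2)+n+2$ (with $n=0$ in rows 3, 6, 9); in rows 10-12, $\phi(S_2)\le\phi(P_1)\le\phi(S_1)\le\phi(S_2)+1$. (d) If $k$ is finite, then for every $\sigma$ the wall-crossing formula $1_{\mathcal{D}}=\prod^{\leftarrow}_{\phi\in\mathbb{R}}\mathrm{SS}^\sigma_\phi$ (phases decreasing from left to right) holds, and according to the row it takes the explicit form \begin{align*} (1)_n\quad&1_{\mathcal{D}}=\cdots*\Phi_{S_2}*\Phi_{S_1[n]}*\Phi_{S_2[-1]}*\Phi_{S_1[n-1]}*\cdots,\\ (2)_n\quad&1_{\mathcal{D}}=\cdots*\Phi_{S_1}*\Phi_{P_1[n+1]}*\Phi_{S_1[-1]}*\Phi_{P_1[n]}*\cdots,\\ (3)_n\quad&1_{\mathcal{D}}=\cdots*\Phi_{P_1}*\Phi_{S_2[n+1]}*\Phi_{P_1[-1]}*\Phi_{S_2[n]}*\cdots,\\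 (4)\quad&1_{\mathcal{D}}=\cdots*\Phi_{S_2[j+1]}*\Phi_{S_1[j]}*\Phi_{P_1[j]}*\Phi_{S_2[j]}*\Phi_{S_1[j-1]}*\cdots. \end{align*} (e) Every row occurs, for every admissible value of its parameter $n$: some stability condition on $\mathcal{D}$ has the semistable objects, heart and phases listed in it. -/

import Mathlib

open CategoryTheory CategoryTheory.Limits CategoryTheory.Pretriangulated

universe w v u

namespace Stab

/-! ### Stability conditions on a triangulated category -/

section Triangulated

variable (D : Type u) [Category.{v} D] [Preadditive D] [HasZeroObject D] [HasShift D ℤ]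
  [∀ n : ℤ, (shiftFunctor D n).Additive] [Pretriangulated D]

/-- The relations `[X] - [Y] + [Z]`, one for each distinguished triangle `X ⟶ Y ⟶ Z ⟶ X⟦1⟧`. -/
def triangleRelations : AddSubgroup (FreeAbelianGroup D) :=
  AddSubgroup.closure {x | ∃ T ∈ distTriang D,
    x = FreeAbelianGroup.of T.obj₁ - FreeAbelianGroup.of T.obj₂ + FreeAbelianGroup.of T.obj₃}

/-- The Grothendieck group of a triangulated category. -/
abbrev K₀ : Type u := FreeAbelianGroup D ⧸ triangleRelations D

variable {D}

/-- The class of an object in the Grothendieck group. -/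
def K₀.cl (X : D) : K₀ D := QuotientAddGroup.mk' (triangleRelations D) (FreeAbelianGroup.of X)

/-- A Harder-Narasimhan filtration of `M` with respect to the family `P`: a tower of triangles
`X (i-1) ⟶ X i ⟶ A i ⟶ X (i-1)⟦1⟧` from `0` to `M`, with nonzero factors `A i ∈ P (φ i)` and
`φ 1 > ⋯ > φ n`. The empty filtration (`n = 0`) occurs exactly for `M = 0`. -/
structure HNFiltration (P : ℝ → ObjectProperty D) (M : D) where
  n : ℕ
  X : Fin (n + 1) → D
  A : Fin n → D
  φ : Fin n → ℝ
  isZero_zero : IsZero (X 0)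
  lastIso : X (Fin.last n) ≅ M
  inc : ∀ i : Fin n, X i.castSucc ⟶ X i.succ
  proj : ∀ i : Fin n, X i.succ ⟶ A i
  conn : ∀ i : Fin n, A i ⟶ (X i.castSucc)⟦(1 : ℤ)⟧
  triangle : ∀ i : Fin n, Triangle.mk (inc i) (proj i) (conn i) ∈ distTriang D
  factor_mem : ∀ i : Fin n, P (φ i) (A i)
  factor_ne_zero : ∀ i : Fin n, ¬ IsZero (A i)
  phase_anti : StrictAnti φ

variable (D) in
/-- A stability condition `(Z, P)` on a triangulated category. Each `P φ` is a full additive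
extension-closed subcategory: it contains the zero objects and is closed under extensions,
hence under finite direct sums and isomorphisms. -/
structure StabilityCondition where
  /-- the central charge -/
  Z : K₀ D →+ ℂ
  /-- the slicing -/
  P : ℝ → ObjectProperty D
  zero_mem : ∀ (φ : ℝ) (X : D), IsZero X → P φ X
  ext_closed : ∀ (φ : ℝ), ∀ T ∈ distTriang D, P φ T.obj₁ → P φ T.obj₃ → P φ T.obj₂
  charge : ∀ (φ : ℝ) (M : D), P φ M → ¬ IsZero M →
    ∃ m : ℝ, 0 < m ∧ Z (K₀.cl M) = m * Complex.exp (Complex.I * Real.pi * φ)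
  shift_iff : ∀ (φ : ℝ) (M : D), P (φ + 1) (M⟦(1 : ℤ)⟧) ↔ P φ M
  hom_eq_zero : ∀ (φ₁ φ₂ : ℝ) (A₁ A₂ : D), P φ₁ A₁ → P φ₂ A₂ → φ₂ < φ₁ →
    ∀ f : A₁ ⟶ A₂, f = 0
  exists_HN : ∀ M : D, ¬ IsZero M → Nonempty (HNFiltration P M)

namespace StabilityCondition

variable (σ : StabilityCondition D)

/-- `M` is semistable. -/
def Semistable (M : D) : Prop := ¬ IsZero M ∧ ∃ φ : ℝ, σ.P φ M

/-- `X` and `Y` lie in slices of phases `φ(X) ≤ φ(Y)`. -/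
def PhaseLE (X Y : D) : Prop := ∃ a b : ℝ, σ.P a X ∧ σ.P b Y ∧ a ≤ b

/-- `X` and `Y` lie in slices of phases `φ(X) < φ(Y)`. -/
def PhaseLT (X Y : D) : Prop := ∃ a b : ℝ, σ.P a X ∧ σ.P b Y ∧ a < b

/-- The heart `P (0, 1]`: all Harder-Narasimhan phases lie in `(0, 1]`. -/
def heart : ObjectProperty D := fun M =>
  ∃ F : HNFiltration σ.P M, ∀ i, F.φ i ∈ Set.Ioc (0 : ℝ) 1

/-- The stability condition `σ` shifted by `m`: its central charge is `(-1)^m Z`, its slices are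
`P (φ + m) = (P φ)[m]`, and its heart is the heart of `σ` shifted by `m`. -/
def shift (m : ℤ) : StabilityCondition D where
  Z := (Int.negOnePow m : ℤ) • σ.Z
  P φ := σ.P (φ + m)
  zero_mem φ X hX := σ.zero_mem _ X hX
  ext_closed φ := σ.ext_closed _
  charge φ M hM h0 := by
    obtain ⟨r, hr, h⟩ := σ.charge _ M hM h0
    refine ⟨r, hr, ?_⟩
    have e1 : Complex.exp (Complex.I * Real.pi * ((φ + m : ℝ) : ℂ)) =
        Complex.exp (Complex.I * Real.pi * φ) * ((-1 : ℂ) ^ m) := by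
      have e0 : Complex.I * Real.pi * ((φ + m : ℝ) : ℂ) =
          Complex.I * Real.pi * φ + m * (Real.pi * Complex.I) := by
        push_cast
        ring
      rw [e0, Complex.exp_add, Complex.exp_int_mul, Complex.exp_pi_mul_I]
    have e2 : (((Int.negOnePow m : ℤˣ) : ℤ) : ℂ) = (-1 : ℂ) ^ m := Int.cast_negOnePow ℂ m
    have e3 : ((-1 : ℂ) ^ m) * ((-1 : ℂ) ^ m) = 1 := by
      rw [← mul_zpow]
      norm_num
    rw [AddMonoidHom.smul_apply, h, e1, zsmul_eq_mul, e2]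
    linear_combination (r * Complex.exp (Complex.I * Real.pi * φ)) * e3
  shift_iff φ M := by
    have := σ.shift_iff (φ + m) M
    rwa [add_right_comm] at this
  hom_eq_zero φ₁ φ₂ A₁ A₂ h₁ h₂ h := σ.hom_eq_zero _ _ A₁ A₂ h₁ h₂ (by linarith)
  exists_HN M hM := by
    obtain ⟨F⟩ := σ.exists_HN M hM
    exact ⟨{ n := F.n, X := F.X, A := F.A, φ := fun i => F.φ i - m
             isZero_zero := F.isZero_zero, lastIso := F.lastIso
             inc := F.inc, proj := F.proj, conn := F.conn, triangle := F.triangle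
             factor_mem := fun i => by simpa using F.factor_mem i
             factor_ne_zero := F.factor_ne_zero
             phase_anti := fun i j hij => by
               have := F.phase_anti hij
               simpa using this }⟩

end StabilityCondition

/-- The additive hull `add S`: direct summands of finite direct sums of objects in `S`. -/
def addHull (S : Set D) : ObjectProperty D := fun M =>
  ∃ (N : D) (n : ℕ) (f : Fin n → D), (∀ i, f i ∈ S) ∧ Nonempty (M ⊞ N ≅ ⨁ f)

/-! ### The derived Hall algebra -/

variable (D) in
/-- Isomorphism classes of objects. -/
abbrev IsoClass : Type u := Quotient (isIsomorphicSetoid D)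

/-- `(L, N)_{M[1]}`: the morphisms `L ⟶ N` whose cone is isomorphic to `M⟦1⟧`. -/
def homWithCone (L N M : D) : Set (L ⟶ N) :=
  {f | ∃ (g : N ⟶ M⟦(1 : ℤ)⟧) (h : M⟦(1 : ℤ)⟧ ⟶ L⟦(1 : ℤ)⟧), Triangle.mk f g h ∈ distTriang D}

/-- `{L, N} = ∏_{i > 0} |Hom(L[i], N)|^{(-1)^i}`. -/
noncomputable def homEuler (L N : D) : ℚ :=
  ∏ᶠ i : ℕ, (Nat.card (L⟦((i + 1 : ℕ) : ℤ)⟧ ⟶ N) : ℚ) ^ ((-1 : ℤ) ^ (i + 1))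

/-- The derived Hall number `F_{MN}^L`. -/
noncomputable def hallNumber (M N L : D) : ℚ :=
  (Nat.card (homWithCone L N M) : ℚ) / (Nat.card (Aut N) : ℚ) * (homEuler L N / homEuler N N)

/-- The terms of the sum defining the coefficient of `L` in the Hall product of two functions on
isomorphism classes. -/
noncomputable def hallTerm (f g : IsoClass D → ℚ) (L : IsoClass D) :
    IsoClass D × IsoClass D → ℚ :=
  fun p => hallNumber p.1.out p.2.out L.out * (f p.1 * g p.2)

/-- The Hall product, `u_[M] * u_[N] = ∑_[L] F_{MN}^L u_[L]`, extended to functions on isomorphism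
classes (formal infinite combinations of the `u_[M]`) whenever `HallDefined` holds. -/
noncomputable def hallMul (f g : IsoClass D → ℚ) : IsoClass D → ℚ :=
  fun L => ∑ᶠ p, hallTerm f g L p

/-- All the sums in the Hall product of `f` and `g` are finite. -/
def HallDefined (f g : IsoClass D → ℚ) : Prop :=
  ∀ L, (Function.support (hallTerm f g L)).Finite

open Classical in
/-- The characteristic function of an isomorphism-closed class of objects. -/
noncomputable def charFn (Q : ObjectProperty D) : IsoClass D → ℚ :=
  fun c => if Q c.out then 1 else 0

/-- The product `f₁ * (f₂ * (⋯ * (fₛ * 1)))`, where `1 = u_[0]`. -/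
noncomputable def hallProd (l : List (IsoClass D → ℚ)) : IsoClass D → ℚ :=
  l.foldr hallMul (charFn fun X : D => IsZero X)

/-- All the Hall products that occur in `hallProd l` are defined. -/
def HallProdDefined : List (IsoClass D → ℚ) → Prop
  | [] => True
  | f :: l => HallDefined f (hallProd l) ∧ HallProdDefined l

/-- `g` is the ordered product of the (possibly infinite) family `f`, the factors being written
from left to right in increasing order of the index: the ordered finite subproducts are defined
and converge to `g`, coefficient by coefficient (for the discrete topology on `ℚ`). -/
def HasOrderedProd {ι : Type*} [LinearOrder ι] (f : ι → IsoClass D → ℚ) (g : IsoClass D → ℚ) :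
    Prop :=
  (∀ s : Finset ι, HallProdDefined ((s.sort (· ≤ ·)).map f)) ∧
  ∀ L : IsoClass D, ∀ᶠ s : Finset ι in Filter.atTop, hallProd ((s.sort (· ≤ ·)).map f) L = g L

/-- `SS_φ`, the characteristic function of the slice `P φ`. -/
noncomputable def StabilityCondition.SS (σ : StabilityCondition D) (φ : ℝ) : IsoClass D → ℚ :=
  charFn (σ.P φ)

/-- `Φ_X = ∑_{n ≥ 0} u_[X^n]`. -/
noncomputable def Phi (X : D) : IsoClass D → ℚ :=
  charFn fun L => ∃ n : ℕ, Nonempty (L ≅ ⨁ fun _ : Fin n => X)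

end Triangulated

/-! ### The quiver `A₂ : 1 ⟶ 2` and its bounded derived category -/

section A2

/-- Finite dimensional representations over `k` of the quiver `1 ⟶ 2`: functors to finite
dimensional vector spaces from the path category of this quiver, which is the poset `Fin 2`. -/
abbrev RepA2 (k : Type u) [Field k] : Type (u + 1) := ComposableArrows (FGModuleCat.{u} k) 1

/-- Names of the three indecomposable representations. -/
inductive Ind
  | S₁
  | S₂
  | P₁
  deriving DecidableEq

/-- The representations `S₁ : k ⟶ 0`, `S₂ : 0 ⟶ k` and `P₁ : k ⟶ k` (the identity). -/
noncomputable def Ind.rep (k : Type u) [Field k] : Ind → RepA2 k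
  | .S₁ => ComposableArrows.mk₁ (0 : FGModuleCat.of k k ⟶ FGModuleCat.of k PUnit)
  | .S₂ => ComposableArrows.mk₁ (0 : FGModuleCat.of k PUnit ⟶ FGModuleCat.of k k)
  | .P₁ => ComposableArrows.mk₁ (𝟙 (FGModuleCat.of k k))

variable (k : Type u) [Field k] [HasDerivedCategory.{w} (RepA2 k)]

/-- The bounded derived category `D^b(rep A₂)`. -/
abbrev DbA2 : Type (u + 1) := DerivedCategory.Bounded (RepA2 k)

/-- The embedding of `rep A₂` in `D^b(rep A₂)` as complexes concentrated in degree `0`. -/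
noncomputable def stalk : RepA2 k ⥤ DbA2 k :=
  ObjectProperty.lift _ (DerivedCategory.singleFunctor (RepA2 k) 0) fun _ =>
    ⟨⟨0, inferInstance⟩, ⟨0, inferInstance⟩⟩

/-- The object `X[j]` of `D^b(rep A₂)`, for `X` one of `S₁`, `S₂`, `P₁`. -/
noncomputable def ob (X : Ind) (j : ℤ) : DbA2 k := ((stalk k).obj (X.rep k))⟦j⟧

/-- `X` is `σ`-semistable, for `X` one of `S₁`, `S₂`, `P₁`. -/
def IsSemistable (σ : StabilityCondition (DbA2 k)) (X : Ind) : Prop := σ.Semistable (ob k X 0)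

/-- The twelve rows of the classification; a natural number is the parameter `n` of the row.
The name lists the semistable objects among `S₁`, `S₂`, `P₁`. -/
inductive Row
  | S₁S₂_le (n : ℕ)
  | S₁S₂_gt (n : ℕ) (hn : 1 ≤ n)
  | S₁S₂_std
  | P₁S₁_le (n : ℕ)
  | P₁S₁_gt (n : ℕ) (hn : 1 ≤ n)
  | P₁S₁_std
  | S₂P₁_le (n : ℕ)
  | S₂P₁_gt (n : ℕ) (hn : 1 ≤ n)
  | S₂P₁_std
  | all_S₂P₁S₁
  | all_S₁S₂P₁
  | all_P₁S₁S₂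

namespace Row

/-- Which of `S₁`, `S₂`, `P₁` are semistable. -/
def semistable : Row → Set Ind
  | S₁S₂_le _ | S₁S₂_gt _ _ | S₁S₂_std => {.S₁, .S₂}
  | P₁S₁_le _ | P₁S₁_gt _ _ | P₁S₁_std => {.P₁, .S₁}
  | S₂P₁_le _ | S₂P₁_gt _ _ | S₂P₁_std => {.S₂, .P₁}
  | all_S₂P₁S₁ | all_S₁S₂P₁ | all_P₁S₁S₂ => {.S₁, .S₂, .P₁}

/-- The heart; `rep A₂` is regarded as the subcategory of the objects isomorphic to complexes
concentrated in degree `0`. -/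
def heart : Row → ObjectProperty (DbA2 k)
  | S₁S₂_le n => addHull {ob k .S₂ 0, ob k .S₁ (n + 1)}
  | S₁S₂_gt n _ => addHull {ob k .S₂ 0, ob k .S₁ n}
  | S₁S₂_std => (stalk k).essImage
  | P₁S₁_le n => addHull {ob k .S₁ 0, ob k .P₁ (n + 2)}
  | P₁S₁_gt n _ => addHull {ob k .S₁ 0, ob k .P₁ (n + 1)}
  | P₁S₁_std => addHull {ob k .S₁ 0, ob k .S₂ 1, ob k .P₁ 1}
  | S₂P₁_le n => addHull {ob k .P₁ 0, ob k .S₂ (n + 2)}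
  | S₂P₁_gt n _ => addHull {ob k .P₁ 0, ob k .S₂ (n + 1)}
  | S₂P₁_std => addHull {ob k .P₁ 0, ob k .S₁ 0, ob k .S₂ 1}
  | all_S₂P₁S₁ => (stalk k).essImage
  | all_S₁S₂P₁ => addHull {ob k .S₁ 0, ob k .S₂ 1, ob k .P₁ 1}
  | all_P₁S₁S₂ => addHull {ob k .P₁ 0, ob k .S₁ 0, ob k .S₂ 1}

variable {k}

/-- The inequality between phases. -/
def phases (σ : StabilityCondition (DbA2 k)) : Row → Prop
  | S₁S₂_le n => σ.PhaseLE (ob k .S₂ 0) (ob k .S₁ (n + 1))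
  | S₁S₂_gt n _ => σ.PhaseLT (ob k .S₁ n) (ob k .S₂ 0)
  | S₁S₂_std => σ.PhaseLT (ob k .S₁ 0) (ob k .S₂ 0)
  | P₁S₁_le n => σ.PhaseLE (ob k .S₁ 0) (ob k .P₁ (n + 2))
  | P₁S₁_gt n _ => σ.PhaseLT (ob k .P₁ (n + 1)) (ob k .S₁ 0)
  | P₁S₁_std => σ.PhaseLT (ob k .P₁ 1) (ob k .S₁ 0)
  | S₂P₁_le n => σ.PhaseLE (ob k .P₁ 0) (ob k .S₂ (n + 2))
  | S₂P₁_gt n _ => σ.PhaseLT (ob k .S₂ (n + 1)) (ob k .P₁ 0)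
  | S₂P₁_std => σ.PhaseLT (ob k .S₂ 1) (ob k .P₁ 0)
  | all_S₂P₁S₁ => σ.PhaseLE (ob k .S₂ 0) (ob k .S₁ 0)
  | all_S₁S₂P₁ => σ.PhaseLE (ob k .S₁ 0) (ob k .P₁ 1)
  | all_P₁S₁S₂ => σ.PhaseLE (ob k .P₁ 0) (ob k .S₂ 1)

/-- `σ` is described by the row: semistable objects, heart, and inequality between phases. -/
def Holds (r : Row) (σ : StabilityCondition (DbA2 k)) : Prop :=
  (∀ X : Ind, IsSemistable k σ X ↔ X ∈ r.semistable) ∧ σ.heart = r.heart k ∧ r.phases σ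

/-- The range of the phases:
`φ(S₁) + n < φ(S₂) ≤ φ(S₁) + n + 1`, `φ(P₁) + n + 1 < φ(S₁) ≤ φ(P₁) + n + 2`,
`φ(S₂) + n + 1 < φ(P₁) ≤ φ(S₂) + n + 2` (with `n = 0` in the third row of each group), and
`φ(S₂) ≤ φ(P₁) ≤ φ(S₁) ≤ φ(S₂) + 1`. -/
def phaseRange (σ : StabilityCondition (DbA2 k)) : Row → Prop
  | S₁S₂_le n | S₁S₂_gt n _ =>
      σ.PhaseLT (ob k .S₁ n) (ob k .S₂ 0) ∧ σ.PhaseLE (ob k .S₂ 0) (ob k .S₁ (n + 1))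
  | S₁S₂_std =>
      σ.PhaseLT (ob k .S₁ 0) (ob k .S₂ 0) ∧ σ.PhaseLE (ob k .S₂ 0) (ob k .S₁ 1)
  | P₁S₁_le n | P₁S₁_gt n _ =>
      σ.PhaseLT (ob k .P₁ (n + 1)) (ob k .S₁ 0) ∧ σ.PhaseLE (ob k .S₁ 0) (ob k .P₁ (n + 2))
  | P₁S₁_std =>
      σ.PhaseLT (ob k .P₁ 1) (ob k .S₁ 0) ∧ σ.PhaseLE (ob k .S₁ 0) (ob k .P₁ 2)
  | S₂P₁_le n | S₂P₁_gt n _ =>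
      σ.PhaseLT (ob k .S₂ (n + 1)) (ob k .P₁ 0) ∧ σ.PhaseLE (ob k .P₁ 0) (ob k .S₂ (n + 2))
  | S₂P₁_std =>
      σ.PhaseLT (ob k .S₂ 1) (ob k .P₁ 0) ∧ σ.PhaseLE (ob k .P₁ 0) (ob k .S₂ 2)
  | all_S₂P₁S₁ | all_S₁S₂P₁ | all_P₁S₁S₂ =>
      σ.PhaseLE (ob k .S₂ 0) (ob k .P₁ 0) ∧ σ.PhaseLE (ob k .P₁ 0) (ob k .S₁ 0) ∧
        σ.PhaseLE (ob k .S₁ 0) (ob k .S₂ 1)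

/-- The repeating block of the wall-crossing product, written from left to right: `(X, j)` stands
for the factor `Φ_{X[j]}`. -/
def block : Row → List (Ind × ℤ)
  | S₁S₂_le n | S₁S₂_gt n _ => [(.S₂, 0), (.S₁, n)]
  | S₁S₂_std => [(.S₂, 0), (.S₁, 0)]
  | P₁S₁_le n | P₁S₁_gt n _ => [(.S₁, 0), (.P₁, n + 1)]
  | P₁S₁_std => [(.S₁, 0), (.P₁, 1)]
  | S₂P₁_le n | S₂P₁_gt n _ => [(.P₁, 0), (.S₂, n + 1)]
  | S₂P₁_std => [(.P₁, 0), (.S₂, 1)]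
  | all_S₂P₁S₁ | all_S₁S₂P₁ | all_P₁S₁S₂ => [(.S₁, 0), (.P₁, 0), (.S₂, 0)]

variable (k) in
/-- The explicit wall-crossing formula `1_D = ⋯ * B[j+1] * B[j] * B[j-1] * ⋯`, where `B[j]` is the
block of factors of the row, shifted by `j`: the shifts `j` decrease from left to right (whence the
order dual), and inside a block the factors are in the order of the list. -/
def WallCrossing (r : Row) : Prop :=
  HasOrderedProd
    (fun t : ℤᵒᵈ ×ₗ Fin r.block.length =>
      Phi (ob k (r.block.get (ofLex t).2).1
        ((r.block.get (ofLex t).2).2 + OrderDual.ofDual (ofLex t).1)))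
    (fun _ : IsoClass (DbA2 k) => (1 : ℚ))

end Row

end A2

end Stab

set_option linter.unusedSectionVars false

namespace Stab

/-! ### Linear algebra of representations -/

namespace RepA2

variable {k : Type u} [Field k]

/-- The structure map of a representation of `1 ⟶ 2`. -/
def str (M : RepA2 k) : M.obj 0 →ₗ[k] M.obj 1 := (M.map' 0 1).hom.hom

/-- The component of a morphism of representations at a vertex. -/
def lin {M N : RepA2 k} (f : M ⟶ N) (i : Fin 2) : M.obj i →ₗ[k] N.obj i := (f.app i).hom.hom

lemma hom_ext {M N : RepA2 k} {f g : M ⟶ N} (h₀ : ∀ x, lin f 0 x = lin g 0 x)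
    (h₁ : ∀ x, lin f 1 x = lin g 1 x) : f = g := by
  refine ComposableArrows.hom_ext₁ ?_ ?_
  · exact FGModuleCat.hom_ext (LinearMap.ext h₀)
  · exact FGModuleCat.hom_ext (LinearMap.ext h₁)

lemma lin_str {M N : RepA2 k} (f : M ⟶ N) (x : M.obj 0) :
    lin f 1 (str M x) = str N (lin f 0 x) := by
  have := f.naturality (homOfLE (show (0 : Fin 2) ≤ 1 by decide))
  exact LinearMap.congr_fun (congrArg (fun t => t.hom.hom) this) x

/-- The morphism of representations with given components. -/
noncomputable def mkHom {M N : RepA2 k} (a : M.obj 0 →ₗ[k] N.obj 0) (b : M.obj 1 →ₗ[k] N.obj 1)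
    (w : ∀ x, b (str M x) = str N (a x)) : M ⟶ N :=
  ComposableArrows.homMk₁ ⟨ModuleCat.ofHom a⟩ ⟨ModuleCat.ofHom b⟩
    (FGModuleCat.hom_ext (LinearMap.ext w))

@[simp] lemma lin_id (M : RepA2 k) (i : Fin 2) (x) : lin (𝟙 M) i x = x := rfl

@[simp] lemma lin_comp {M N L : RepA2 k} (f : M ⟶ N) (g : N ⟶ L) (i : Fin 2) (x) :
    lin (f ≫ g) i x = lin g i (lin f i x) := rfl

@[simp] lemma lin_zero (M N : RepA2 k) (i : Fin 2) (x) : lin (0 : M ⟶ N) i x = 0 := rfl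

lemma lin_surjective {M N : RepA2 k} (f : M ⟶ N) [Epi f] (i : Fin 2) :
    Function.Surjective (lin f i) := by
  have h1 : Epi (f.app i) := inferInstance
  have h2 : Epi ((forget₂ (FGModuleCat k) (ModuleCat k)).map (f.app i)) := inferInstance
  exact (ModuleCat.epi_iff_surjective _).1 h2

end RepA2

/-! ### Finite direct sums -/

section SumOf

variable {C : Type*} [Category* C] [Preadditive C] [HasBinaryBiproducts C]

/-- Objects isomorphic to a finite direct sum of objects satisfying `Q`. -/
inductive SumOf (Q : ObjectProperty C) : C → Prop
  | zero {M : C} (h : IsZero M) : SumOf Q M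
  | add {X K M : C} (hX : Q X) (hK : SumOf Q K) (e : M ≅ X ⊞ K) : SumOf Q M

namespace SumOf

variable {Q R : ObjectProperty C}

lemma of_iso {M N : C} (e : M ≅ N) (h : SumOf Q N) : SumOf Q M := by
  cases h with
  | zero h => exact .zero (h.of_iso e)
  | add hX hK e' => exact .add hX hK (e ≪≫ e')

lemma single [HasZeroObject C] {M : C} (h : Q M) : SumOf Q M :=
  .add h (.zero (isZero_zero C)) ((isoBiprodZero (isZero_zero C)))

lemma biprod {M N : C} (hM : SumOf Q M) (hN : SumOf Q N) : SumOf Q (M ⊞ N) := by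
  induction hM with
  | @zero M h => exact of_iso (isoZeroBiprod h).symm hN
  | @add X K M hX hK e ih =>
    exact .add hX ih (biprod.mapIso e (Iso.refl N) ≪≫ biprod.associator X K N)

lemma mono (h : ∀ X, Q X → R X) {M : C} (hM : SumOf Q M) : SumOf R M := by
  induction hM with
  | zero h => exact .zero h
  | add hX _ e ih => exact .add (h _ hX) ih e

/-- The object `N` stays fixed while the induction replaces `M` by a complement `K`, so every
summand is exhibited as a retract of `N` itself. -/
lemma mono_of_retract {M N : C} (hM : SumOf Q M) (i : M ⟶ N) (r : N ⟶ M) (hir : i ≫ r = 𝟙 M)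
    (h : ∀ (X : C) (i : X ⟶ N) (r : N ⟶ X), i ≫ r = 𝟙 X → Q X → R X) : SumOf R M := by
  induction hM with
  | zero h => exact .zero h
  | @add X K M hX hK e ih =>
    refine .add (h X (biprod.inl ≫ e.inv ≫ i) (r ≫ e.hom ≫ biprod.fst) ?_ hX)
      (ih (biprod.inr ≫ e.inv ≫ i) (r ≫ e.hom ≫ biprod.snd) ?_) e
    · simp [reassoc_of% hir]
    · simp [reassoc_of% hir]

/-- The summands of a direct sum are retracts of it. -/
lemma retracts {M : C} (hM : SumOf Q M)
    (h : ∀ (X : C) (i : X ⟶ M) (r : M ⟶ X), i ≫ r = 𝟙 X → Q X → R X) : SumOf R M :=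
  hM.mono_of_retract (𝟙 M) (𝟙 M) (by simp) h

lemma ind {M : C} (hM : SumOf Q M) (hz : ∀ X, IsZero X → R X) (hQ : ∀ X, Q X → R X)
    (hiso : ∀ X Y, (X ≅ Y) → R Y → R X) (hadd : ∀ X Y, R X → R Y → R (X ⊞ Y)) : R M := by
  induction hM with
  | zero h => exact hz _ h
  | add hX _ e ih => exact hiso _ _ e (hadd _ _ (hQ _ hX) ih)

lemma exists_of_not_isZero {M : C} (hM : SumOf Q M) (h : ¬ IsZero M) :
    ∃ X, Q X ∧ ∃ (i : X ⟶ M) (r : M ⟶ X), i ≫ r = 𝟙 X := by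
  cases hM with
  | zero h' => exact absurd h' h
  | @add X K _ hX _ e =>
    exact ⟨X, hX, biprod.inl ≫ e.inv, e.hom ≫ biprod.fst, by simp⟩

lemma hom_eq_zero (h : ∀ X Y, Q X → R Y → ∀ f : X ⟶ Y, f = 0) {M N : C} (hM : SumOf Q M)
    (hN : SumOf R N) (f : M ⟶ N) : f = 0 := by
  have key : ∀ (X : C), Q X → ∀ f : X ⟶ N, f = 0 := by
    intro X hX
    clear hM f
    induction hN with
    | zero hz => exact fun f => hz.eq_of_tgt _ _
    | @add Y K N hY _ e ih =>
      intro f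
      rw [← cancel_mono e.hom, zero_comp]
      ext
      · simpa using h X Y hX hY (f ≫ e.hom ≫ biprod.fst)
      · simpa using ih (f ≫ e.hom ≫ biprod.snd)
  induction hM with
  | zero hz => exact hz.eq_of_src _ _
  | @add Y K M hY _ e ih =>
    rw [← cancel_epi e.inv, comp_zero]
    ext
    · simpa using key Y hY (biprod.inl ≫ e.inv ≫ f)
    · simpa using ih (biprod.inr ≫ e.inv ≫ f)

lemma map {D : Type*} [Category* D] [Preadditive D]
    [HasBinaryBiproducts D]
    (F : C ⥤ D) [F.Additive] {Q' : ObjectProperty D} (h : ∀ X, Q X → Q' (F.obj X)) {M : C}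
    (hM : SumOf Q M) : SumOf Q' (F.obj M) := by
  induction hM with
  | zero h => exact .zero (F.map_isZero h)
  | @add X K M hX _ e ih =>
    have := preservesBinaryBiproducts_of_preservesBiproducts F
    exact .add (h _ hX) ih (F.mapIso e ≪≫ F.mapBiprod X K)

end SumOf

/-- Adding one summand to a finite biproduct. -/
noncomputable def biproductSuccIso [HasFiniteBiproducts C] {n : ℕ} (f : Fin (n + 1) → C) :
    ⨁ f ≅ f 0 ⊞ ⨁ (fun i : Fin n => f i.succ) where
  hom := biprod.lift (biproduct.π f 0) (biproduct.lift fun i => biproduct.π f i.succ)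
  inv := biprod.desc (biproduct.ι f 0) (biproduct.desc fun i => biproduct.ι f i.succ)
  hom_inv_id := by
    rw [biprod.lift_desc, biproduct.lift_desc, ← biproduct.total, Fin.sum_univ_succ]
  inv_hom_id := by
    ext
    · simp
    · simp [biproduct.ι_π_ne _ (Fin.succ_ne_zero _).symm]
    · simp [biproduct.ι_π_ne _ (Fin.succ_ne_zero _)]
    · rename_i i j
      by_cases h : i = j
      · subst h; simp
      · simp [biproduct.ι_π_ne _ h, biproduct.ι_π_ne _ (fun h' => h (Fin.succ_injective _ h'))]

/-- The inductive form suits proofs; the `Fin`-indexed form is the one used by `addHull` and `Phi`.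
-/
lemma sumOf_iff [HasFiniteBiproducts C] {Q : ObjectProperty C} {M : C} :
    SumOf Q M ↔ ∃ (n : ℕ) (f : Fin n → C), (∀ i, Q (f i)) ∧ Nonempty (M ≅ ⨁ f) := by
  constructor
  · intro h
    induction h with
    | @zero M h =>
      refine ⟨0, Fin.elim0, fun i => i.elim0, ⟨h.iso ?_⟩⟩
      rw [IsZero.iff_id_eq_zero]
      ext i
      exact i.elim0
    | @add X K M hX _ e ih =>
      obtain ⟨n, f, hf, ⟨e'⟩⟩ := ih
      refine ⟨n + 1, Fin.cons X f, fun i => ?_, ⟨e ≪≫ biprod.mapIso (Iso.refl _) e' ≪≫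
        (biproductSuccIso (Fin.cons X f : Fin (n + 1) → C)).symm⟩⟩
      refine Fin.cases ?_ (fun i => ?_) i
      · exact hX
      · exact hf i
  · rintro ⟨n, f, hf, ⟨e⟩⟩
    induction n generalizing M with
    | zero =>
      refine .zero (IsZero.of_iso ?_ e)
      rw [IsZero.iff_id_eq_zero]
      ext i
      exact i.elim0
    | succ n ih =>
      exact .add (hf 0) (ih _ (fun i => hf i.succ) (Iso.refl _)) (e ≪≫ biproductSuccIso f)

/-- The complement of a retract in an abelian category. -/
lemma exists_iso_biprod_of_retract {C : Type*} [Category* C] [Abelian C] {X M : C} (i : X ⟶ M)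
    (r : M ⟶ X) (h : i ≫ r = 𝟙 X) :
    ∃ (e : M ≅ X ⊞ kernel r), biprod.inr ≫ e.inv = kernel.ι r :=
  ⟨{ hom := biprod.lift r (kernel.lift r (𝟙 M - r ≫ i) (by simp [h]))
     inv := biprod.desc i (kernel.ι r)
     hom_inv_id := by simp
     inv_hom_id := by
      ext
      · simp [h]
      · simp [reassoc_of% h]
      · simp
      · simp }, by simp⟩

end SumOf

/-! ### The three indecomposable representations -/

open RepA2

section Rep

variable {k : Type u} [Field k]

namespace Ind

/-- The morphism `P₁ ⟶ M` given by a vector at the source. -/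
noncomputable def fromP₁ {M : RepA2 k} (v : M.obj 0) : P₁.rep k ⟶ M :=
  mkHom (show k →ₗ[k] M.obj 0 from LinearMap.toSpanSingleton k _ v)
    (show k →ₗ[k] M.obj 1 from LinearMap.toSpanSingleton k _ (str M v))
    (fun x : k => ((str M).map_smul x v).symm)

/-- The morphism `S₂ ⟶ M` given by a vector at the target. -/
noncomputable def fromS₂ {M : RepA2 k} (v : M.obj 1) : S₂.rep k ⟶ M :=
  mkHom (show PUnit.{u+1} →ₗ[k] M.obj 0 from 0)
    (show k →ₗ[k] M.obj 1 from LinearMap.toSpanSingleton k _ v)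
    (fun _ => (zero_smul k v).trans (str M).map_zero.symm)

/-- The morphism `S₁ ⟶ M` given by a vector in the kernel of the structure map. -/
noncomputable def fromS₁ {M : RepA2 k} (v : M.obj 0) (hv : str M v = 0) : S₁.rep k ⟶ M :=
  mkHom (show k →ₗ[k] M.obj 0 from LinearMap.toSpanSingleton k _ v)
    (show PUnit.{u+1} →ₗ[k] M.obj 1 from 0)
    (fun x : k => (((str M).map_smul x v).trans ((congrArg (x • ·) hv).trans (smul_zero x))).symm)

/-- The morphism `M ⟶ P₁` given by a linear form at the target. -/
noncomputable def toP₁ {M : RepA2 k} (l : M.obj 1 →ₗ[k] k) : M ⟶ P₁.rep k :=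
  mkHom (show M.obj 0 →ₗ[k] k from l ∘ₗ str M) l (fun _ => rfl)

/-- The morphism `M ⟶ S₁` given by a linear form at the source. -/
noncomputable def toS₁ {M : RepA2 k} (l : M.obj 0 →ₗ[k] k) : M ⟶ S₁.rep k :=
  mkHom l (show M.obj 1 →ₗ[k] PUnit.{u+1} from 0) (fun _ => rfl)

/-- The morphism `M ⟶ S₂` given by a linear form that vanishes on the image. -/
noncomputable def toS₂ {M : RepA2 k} (l : M.obj 1 →ₗ[k] k) (hl : ∀ x, l (str M x) = 0) : M ⟶ S₂.rep k :=
  mkHom (show M.obj 0 →ₗ[k] PUnit.{u+1} from 0) l (fun x => hl x)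

/-- P₁ is generated by the vector 1 at the source: linearity settles the source, and the target
follows because the structure map of P₁ is the identity. -/
lemma ext_P₁ {M : RepA2 k} {f g : P₁.rep k ⟶ M}
    (h : lin f 0 (1 : k) = lin g 0 (1 : k)) : f = g := by
  have h0 : ∀ x : k, lin f 0 x = lin g 0 x := fun x => by
    have e := ((lin f 0).map_smul x (1 : k)).trans
      ((congrArg (x • ·) h).trans ((lin g 0).map_smul x (1 : k)).symm)
    have e' : (x • (1 : k)) = x := by simp
    change lin f 0 (x • (1 : k)) = lin g 0 (x • (1 : k)) at e
    rwa [e'] at e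
  refine RepA2.hom_ext h0 (fun x => ?_)
  have hf := lin_str f x
  have hg := lin_str g x
  exact hf.trans ((congrArg _ (h0 x)).trans hg.symm)

lemma ext_S₂ {M : RepA2 k} {f g : S₂.rep k ⟶ M}
    (h : lin f 1 (1 : k) = lin g 1 (1 : k)) : f = g := by
  refine RepA2.hom_ext (fun x => ?_) (fun x : k => ?_)
  · exact (congrArg (lin f 0) (Subsingleton.elim (α := PUnit.{u+1}) x 0)).trans
      (((lin f 0).map_zero.trans (lin g 0).map_zero.symm).trans
        (congrArg (lin g 0) (Subsingleton.elim (α := PUnit.{u+1}) 0 x)))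
  · have e := ((lin f 1).map_smul x (1 : k)).trans
      ((congrArg (x • ·) h).trans ((lin g 1).map_smul x (1 : k)).symm)
    have e' : (x • (1 : k)) = x := by simp
    change lin f 1 (x • (1 : k)) = lin g 1 (x • (1 : k)) at e
    rwa [e'] at e

lemma ext_S₁ {M : RepA2 k} {f g : S₁.rep k ⟶ M}
    (h : lin f 0 (1 : k) = lin g 0 (1 : k)) : f = g := by
  refine RepA2.hom_ext (fun x : k => ?_) (fun x => ?_)
  · have e := ((lin f 0).map_smul x (1 : k)).trans
      ((congrArg (x • ·) h).trans ((lin g 0).map_smul x (1 : k)).symm)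
    have e' : (x • (1 : k)) = x := by simp
    change lin f 0 (x • (1 : k)) = lin g 0 (x • (1 : k)) at e
    rwa [e'] at e
  · exact (congrArg (lin f 1) (Subsingleton.elim (α := PUnit.{u+1}) x 0)).trans
      (((lin f 1).map_zero.trans (lin g 1).map_zero.symm).trans
        (congrArg (lin g 1) (Subsingleton.elim (α := PUnit.{u+1}) 0 x)))

lemma rep_end_scalar (X : Ind) (f : X.rep k ⟶ X.rep k) : ∃ c : k, f = c • 𝟙 _ := by
  cases X with
  | S₁ => exact ⟨(show k from lin f 0 (1 : k)), ext_S₁ (mul_one (M := k) _).symm⟩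
  | S₂ => exact ⟨(show k from lin f 1 (1 : k)), ext_S₂ (mul_one (M := k) _).symm⟩
  | P₁ => exact ⟨(show k from lin f 0 (1 : k)), ext_P₁ (mul_one (M := k) _).symm⟩

lemma not_isZero_rep (X : Ind) : ¬ IsZero (X.rep k) := by
  intro h
  have h' := (IsZero.iff_id_eq_zero _).1 h
  cases X with
  | S₁ => exact one_ne_zero (α := k) (LinearMap.congr_fun (congrArg (lin · 0) h') (1 : k))
  | S₂ => exact one_ne_zero (α := k) (LinearMap.congr_fun (congrArg (lin · 1) h') (1 : k))
  | P₁ => exact one_ne_zero (α := k) (LinearMap.congr_fun (congrArg (lin · 0) h') (1 : k))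

/-- Morphisms from P₁ to `M` are vectors of `M` at the source, and those from S₂ are vectors at the
target, so lifting along an epimorphism means lifting a single vector. -/
instance : Projective (P₁.rep k) where
  factors {E X} f e _ := by
    obtain ⟨v, hv⟩ := lin_surjective e 0 (lin f 0 (1 : k))
    refine ⟨fromP₁ v, ext_P₁ ?_⟩
    exact (congrArg (lin e 0) (one_smul k v)).trans hv

instance : Projective (S₂.rep k) where
  factors {E X} f e _ := by
    obtain ⟨v, hv⟩ := lin_surjective e 1 (lin f 1 (1 : k))
    refine ⟨fromS₂ v, ext_S₂ ?_⟩
    exact (congrArg (lin e 1) (one_smul k v)).trans hv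

lemma hom_S₂_S₁ (f : S₂.rep k ⟶ S₁.rep k) : f = 0 := ext_S₂ (Subsingleton.elim (α := PUnit.{u+1}) _ _)

lemma hom_P₁_S₂ (f : P₁.rep k ⟶ S₂.rep k) : f = 0 := ext_P₁ (Subsingleton.elim (α := PUnit.{u+1}) _ _)

lemma hom_S₁_S₂ (f : S₁.rep k ⟶ S₂.rep k) : f = 0 := ext_S₁ (Subsingleton.elim (α := PUnit.{u+1}) _ _)

lemma hom_S₁_P₁ (f : S₁.rep k ⟶ P₁.rep k) : f = 0 := by
  refine ext_S₁ ?_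
  have := lin_str f (1 : k)
  refine (this.symm.trans ?_)
  exact (congrArg (lin f 1) (Subsingleton.elim (α := PUnit.{u+1}) _ 0)).trans (lin f 1).map_zero

variable (k) in
/-- The inclusion `S₂ ⟶ P₁`. -/
noncomputable def incl : S₂.rep k ⟶ P₁.rep k := fromS₂ (M := P₁.rep k) (1 : k)

variable (k) in
/-- The projection `P₁ ⟶ S₁`. -/
noncomputable def quot : P₁.rep k ⟶ S₁.rep k := fromP₁ (M := S₁.rep k) (1 : k)

lemma hom_S₂_P₁ (f : S₂.rep k ⟶ P₁.rep k) : ∃ c : k, f = c • incl k :=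
  ⟨(show k from lin f 1 (1 : k)), ext_S₂ ((mul_one (M := k) _).symm.trans
    (congrArg (fun t : k => (show k from lin f 1 (1 : k)) * t) (mul_one (1 : k)).symm))⟩

instance : Mono (incl k) where
  right_cancellation {M} g h e := by
    refine RepA2.hom_ext (fun x => Subsingleton.elim (α := PUnit.{u+1}) _ _) (fun x => ?_)
    have := LinearMap.congr_fun (congrArg (lin · 1) e) x
    exact (mul_one (M := k) _).symm.trans (this.trans (mul_one (M := k) _))

instance : Epi (quot k) where
  left_cancellation {M} g h e := by
    refine ext_S₁ ?_
    have := LinearMap.congr_fun (congrArg (lin · 0) e) (1 : k)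
    have e1 : lin (quot k) 0 (1 : k) = (1 : k) := mul_one (1 : k)
    exact (congrArg (lin g 0) e1).symm.trans (this.trans (congrArg (lin h 0) e1))

variable (k) in
lemma incl_quot : incl k ≫ quot k = 0 := hom_S₂_S₁ _

variable (k) in
/-- The short exact sequence `0 ⟶ S₂ ⟶ P₁ ⟶ S₁ ⟶ 0`. -/
lemma shortExact : (ShortComplex.mk (incl k) (quot k) (incl_quot k)).ShortExact := by
  refine ShortComplex.ShortExact.mk' (ShortComplex.exact_of_f_is_kernel _ ?_)
    (inferInstanceAs (Mono (incl k))) (inferInstanceAs (Epi (quot k)))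
  -- The projection is the identity at the source, so a morphism that it kills vanishes there and
  -- factors through S₂.
  have key : ∀ {M : RepA2 k} (g : M ⟶ P₁.rep k), g ≫ quot k = 0 → ∀ x, lin g 0 x = 0 := by
    intro M g hg x
    exact (mul_one (M := k) _).symm.trans (LinearMap.congr_fun (congrArg (lin · 0) hg) x)
  refine KernelFork.IsLimit.ofι' (incl k) (incl_quot k) (fun {M} g hg => ⟨toS₂ (lin g 1)
    (fun x => ?_), ?_⟩)
  · exact (lin_str g x).trans ((congrArg (str (P₁.rep k)) (key g hg x)).trans
      (str (P₁.rep k)).map_zero)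
  · refine RepA2.hom_ext (fun x => ?_) (fun x => ?_)
    · exact (lin (incl k) 0).map_zero.trans (key g hg x).symm
    · exact mul_one (M := k) _

/-- A nonzero representation has one of the three indecomposables as a retract. -/
lemma exists_retract {M : RepA2 k} (hM : ¬ IsZero M) :
    ∃ (X : Ind) (i : X.rep k ⟶ M) (r : M ⟶ X.rep k), i ≫ r = 𝟙 _ := by
  have dual : ∀ {V : Type u} [AddCommGroup V] [Module k V] {v : V}, v ≠ 0 →
      ∃ l : V →ₗ[k] k, l v = 1 := by
    intro V _ _ v hv
    exact Module.Projective.exists_dual_eq_one k hv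
  by_cases h0 : ∃ v : M.obj 0, v ≠ 0
  · obtain ⟨v, hv⟩ := h0
    -- A vector killed by the structure map spans a copy of S₁; otherwise it generates a copy of P₁.
    -- A linear form with value 1 on the vector, respectively on its image, splits the copy off.
    by_cases h : str M v = 0
    · obtain ⟨l, hl⟩ := dual hv
      exact ⟨.S₁, fromS₁ v h, toS₁ l, ext_S₁ ((congrArg l (one_smul k v)).trans hl)⟩
    · obtain ⟨l, hl⟩ := dual h
      exact ⟨.P₁, fromP₁ v, toP₁ l, ext_P₁ ((congrArg (fun t => l (str M t))
        (one_smul k v)).trans hl)⟩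
  · push Not at h0
    by_cases h1 : ∃ v : M.obj 1, v ≠ 0
    · obtain ⟨v, hv⟩ := h1
      obtain ⟨l, hl⟩ := dual hv
      refine ⟨.S₂, fromS₂ v, toS₂ l (fun x => ?_), ext_S₂ ((congrArg l (one_smul k v)).trans hl)⟩
      rw [h0 x, map_zero, map_zero]
    · push Not at h1
      refine absurd ((IsZero.iff_id_eq_zero M).2 (RepA2.hom_ext ?_ ?_)) hM
      · intro x
        simp [h0 x]
      · intro x
        simp [h1 x]

lemma exists_lin_ne_zero {X : Ind} {M : RepA2 k} (i : X.rep k ⟶ M) (r : M ⟶ X.rep k)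
    (h : i ≫ r = 𝟙 _) : ∃ (j : Fin 2) (x : M.obj j), lin r j x ≠ 0 := by
  by_contra! hr
  refine not_isZero_rep X ((IsZero.iff_id_eq_zero _).2 (h.symm.trans ?_))
  exact RepA2.hom_ext (fun x => hr 0 _) (fun x => hr 1 _)

/-- Every representation is a direct sum of copies of `S₁`, `S₂` and `P₁`. -/
lemma sumOf_rep (M : RepA2 k) : SumOf (fun N => ∃ X : Ind, N = X.rep k) M := by
  induction hn : Module.finrank k (M.obj 0) + Module.finrank k (M.obj 1)
    using Nat.strong_induction_on generalizing M with
  | _ n ih =>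
    by_cases hM : IsZero M
    · exact .zero hM
    obtain ⟨X, i, r, h⟩ := exists_retract hM
    obtain ⟨e, he⟩ := exists_iso_biprod_of_retract i r h
    have hinj : ∀ j, Function.Injective (lin (kernel.ι r) j) := by
      intro j
      refine Function.LeftInverse.injective (g := lin (e.hom ≫ biprod.snd) j) (fun x => ?_)
      rw [← lin_comp, ← he]
      simp
    have hle : ∀ j, Module.finrank k ((kernel r).obj j) ≤ Module.finrank k (M.obj j) := fun j =>
      LinearMap.finrank_le_finrank_of_injective (hinj j)
    obtain ⟨j, x, hx⟩ := exists_lin_ne_zero i r h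
    -- The vector `x` has nonzero image under `r`, so it is not in the kernel and the dimension
    -- drops strictly at the vertex `j`; this makes the induction terminate.
    have hlt : Module.finrank k ((kernel r).obj j) < Module.finrank k (M.obj j) := by
      refine lt_of_le_of_ne (hle j) (fun heq => hx ?_)
      obtain ⟨y, rfl⟩ := (LinearMap.injective_iff_surjective_of_finrank_eq_finrank heq).1 (hinj j) x
      rw [← lin_comp, kernel.condition, lin_zero]
    refine .add ⟨X, rfl⟩ (ih _ ?_ (kernel r) rfl) e
    rw [← hn]
    match j, hlt with
    | 0, hlt => exact add_lt_add_of_lt_of_le hlt (hle 1)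
    | 1, hlt => exact add_lt_add_of_le_of_lt (hle 0) hlt

end Ind

end Rep

/-! ### Helices -/

/-- A description of a triangulated category of type `A₂` by a sequence of objects `E i`
with `E (i + 3) ≅ (E i)⟦1⟧`, such that any three consecutive ones form a distinguished triangle
and such that every object is a direct sum of objects of the sequence. -/
structure IsA2Helix (k : Type*) [Field k] {D : Type u} [Category.{v} D] [Preadditive D]
    [HasZeroObject D] [HasShift D ℤ] [∀ n : ℤ, (shiftFunctor D n).Additive] [Pretriangulated D]
    [Linear k D] (E : ℤ → D) : Prop where
  shift : ∀ i, Nonempty ((E i)⟦(1 : ℤ)⟧ ≅ E (i + 3))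
  triangle : ∀ i, ∃ (f : E i ⟶ E (i + 1)) (g : E (i + 1) ⟶ E (i + 2))
    (h : E (i + 2) ⟶ (E i)⟦(1 : ℤ)⟧), Triangle.mk f g h ∈ distTriang D
  hom_eq_zero : ∀ i j, j ≠ i → j ≠ i + 1 → ∀ f : E i ⟶ E j, f = 0
  end_scalar : ∀ i (f : E i ⟶ E i), ∃ c : k, f = c • 𝟙 _
  not_isZero : ∀ i, ¬ IsZero (E i)
  sumOf : ∀ M, SumOf (fun X => ∃ i, X = E i) M

/-! ### Morphisms between shifted stalk complexes -/

section ShiftHom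

lemma distinguished_of_iso {D : Type u} [Category.{v} D] [Preadditive D]
    [HasZeroObject D] [HasShift D ℤ] [∀ n : ℤ, (shiftFunctor D n).Additive] [Pretriangulated D]
    {X Y Z X' Y' Z' : D} {f : X ⟶ Y} {g : Y ⟶ Z} {h : Z ⟶ X⟦(1 : ℤ)⟧}
    {f' : X' ⟶ Y'} {g' : Y' ⟶ Z'} {h' : Z' ⟶ X'⟦(1 : ℤ)⟧} (T : Triangle.mk f g h ∈ distTriang D)
    (a : X ≅ X') (b : Y ≅ Y') (c : Z ≅ Z') (h₁ : f ≫ b.hom = a.hom ≫ f')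
    (h₂ : g ≫ c.hom = b.hom ≫ g') (h₃ : h ≫ a.hom⟦(1 : ℤ)⟧' = c.hom ≫ h') :
    Triangle.mk f' g' h' ∈ distTriang D :=
  isomorphic_distinguished _ T _
    (Triangle.isoMk (Triangle.mk f g h) (Triangle.mk f' g' h') a b c h₁ h₂ h₃).symm

lemma rotate_distinguished {D : Type u} [Category.{v} D] [Preadditive D]
    [HasZeroObject D] [HasShift D ℤ] [∀ n : ℤ, (shiftFunctor D n).Additive] [Pretriangulated D]
    {X Y Z : D} {f : X ⟶ Y} {g : Y ⟶ Z} {h : Z ⟶ X⟦(1 : ℤ)⟧} (T : Triangle.mk f g h ∈ distTriang D) :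
    Triangle.mk g h (-f⟦(1 : ℤ)⟧') ∈ distTriang D :=
  rot_of_distTriang _ T

variable {D : Type u} [Category.{v} D] [Preadditive D] [HasShift D ℤ]

lemma hom_shift_zero_eq_zero {X Y : D} (h : ∀ g : X ⟶ Y, g = 0) (f : X ⟶ Y⟦(0 : ℤ)⟧) : f = 0 := by
  rw [← cancel_mono ((shiftFunctorZero D ℤ).app Y).hom, h (f ≫ _), zero_comp]

variable [∀ n : ℤ, (shiftFunctor D n).Additive]

lemma hom_shift_eq_zero {X Y : D} (a b c : ℤ) (hc : c + a = b) (h : ∀ g : X ⟶ Y⟦c⟧, g = 0)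
    (f : X⟦a⟧ ⟶ Y⟦b⟧) : f = 0 := by
  obtain ⟨g, hg⟩ := (shiftFunctor D a).map_surjective
    (f ≫ ((shiftFunctorAdd' D c a b hc).app Y).hom)
  rw [h g, Functor.map_zero] at hg
  rw [← cancel_mono ((shiftFunctorAdd' D c a b hc).app Y).hom, ← hg, zero_comp]

end ShiftHom

section Stalk

variable (k : Type u) [Field k] [HasDerivedCategory.{w} (RepA2 k)]

open DerivedCategory DerivedCategory.TStructure

/-- The inclusion of the bounded derived category in the derived category. -/
noncomputable abbrev incD : DbA2 k ⥤ DerivedCategory (RepA2 k) := DerivedCategory.Bounded.ι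

/-- The stalk complexes in the derived category. -/
noncomputable def stalkCompIncD : stalk k ⋙ incD k ≅ singleFunctor (RepA2 k) 0 :=
  ObjectProperty.liftCompιIso _ _ _

instance : (stalk k).Full := Functor.Full.of_comp_faithful_iso (stalkCompIncD k)
instance : (stalk k).Faithful := Functor.Faithful.of_comp_iso (stalkCompIncD k)

lemma incD_map_stalk_map {X Y : RepA2 k} (f : X ⟶ Y) :
    (incD k).map ((stalk k).map f) = (singleFunctor (RepA2 k) 0).map f := rfl

instance : (stalk k).Additive where
  map_add {X Y f g} := by
    apply (incD k).map_injective
    rw [(incD k).map_add, incD_map_stalk_map, incD_map_stalk_map, incD_map_stalk_map]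
    exact (singleFunctor (RepA2 k) 0).map_add

instance : (stalk k).Linear k where
  map_smul {X Y} f c := by
    apply (incD k).map_injective
    rw [(incD k).map_smul, incD_map_stalk_map, incD_map_stalk_map]
    exact (singleFunctor (RepA2 k) 0).map_smul c f

instance (n : ℤ) : (shiftFunctor (DbA2 k) n).Linear k where
  map_smul {X Y} f c := by
    apply (incD k).map_injective
    rw [← cancel_mono (((incD k).commShiftIso n).hom.app Y), (incD k).map_smul, Linear.smul_comp]
    have := ((incD k).commShiftIso n).hom.naturality (c • f)
    have h2 := ((incD k).commShiftIso n).hom.naturality f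
    rw [Functor.comp_map] at this h2
    rw [this, h2, Functor.comp_map, Functor.comp_map, (incD k).map_smul,
      (shiftFunctor (DerivedCategory (RepA2 k)) n).map_smul, Linear.comp_smul]

variable {k}

/-- The source lies in degrees ≤ 0 and the target in degrees ≥ -n > 0 of the standard t-structure.
-/
lemma stalk_hom_eq_zero_of_neg (X Y : RepA2 k) (n : ℤ) (hn : n < 0)
    (f : (stalk k).obj X ⟶ ((stalk k).obj Y)⟦n⟧) : f = 0 := by
  apply (incD k).map_injective
  rw [← cancel_mono (((incD k).commShiftIso n).hom.app _), Functor.map_zero, zero_comp]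
  have : t.IsLE ((incD k).obj ((stalk k).obj X)) 0 :=
    inferInstanceAs (((singleFunctor (RepA2 k) 0).obj X).IsLE 0)
  have : t.IsGE ((incD k).obj ((stalk k).obj Y)) 0 :=
    inferInstanceAs (((singleFunctor (RepA2 k) 0).obj Y).IsGE 0)
  have : t.IsGE (((incD k).obj ((stalk k).obj Y))⟦n⟧) (-n) := t.isGE_shift _ 0 n (-n)
  exact t.zero_of_isLE_of_isGE _ 0 (-n) (by omega) inferInstance this

lemma stalk_hom_eq_zero_of_pos (X Y : RepA2 k) [Projective X] (n : ℤ) (hn : 0 < n)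
    (f : (stalk k).obj X ⟶ ((stalk k).obj Y)⟦n⟧) : f = 0 := by
  apply (incD k).map_injective
  let e : (stalk k ⋙ incD k) ⋙ shiftFunctor _ n ≅ singleFunctor (RepA2 k) (-n) :=
    (singleFunctors (RepA2 k)).shiftIso n (-n) 0 (by omega)
  rw [← cancel_mono (((incD k).commShiftIso n).hom.app _), Functor.map_zero, zero_comp,
    ← cancel_mono (e.app Y).hom, zero_comp]
  exact from_singleFunctor_obj_eq_zero_of_projective
    (L := (CochainComplex.singleFunctor (RepA2 k) (-n)).obj Y) (n := -n) _ (by omega)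

lemma stalk_hom_eq_zero_of_hom (X Y : RepA2 k) (h : ∀ g : X ⟶ Y, g = 0)
    (f : (stalk k).obj X ⟶ ((stalk k).obj Y)⟦(0 : ℤ)⟧) : f = 0 := by
  refine hom_shift_zero_eq_zero (fun g => ?_) f
  obtain ⟨g, rfl⟩ := (stalk k).map_surjective g
  rw [h g, Functor.map_zero]

/-- The embedding is full and reflects distinguished triangles, so only the connecting morphism has
to be transported through the shift isomorphism. -/
lemma exists_triangle_of_incD {X Y Z : DbA2 k} (f : X ⟶ Y) (g : Y ⟶ Z)
    (δ : (incD k).obj Z ⟶ ((incD k).obj X)⟦(1 : ℤ)⟧)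
    (T : Triangle.mk ((incD k).map f) ((incD k).map g) δ ∈ distTriang _) :
    ∃ h : Z ⟶ X⟦(1 : ℤ)⟧, Triangle.mk f g h ∈ distTriang _ := by
  refine ⟨(incD k).preimage (δ ≫ ((incD k).commShiftIso (1 : ℤ)).inv.app X), ?_⟩
  change (incD k).mapTriangle.obj _ ∈ distTriang _
  refine isomorphic_distinguished _ T _ (Triangle.isoMk _ _ (Iso.refl _) (Iso.refl _)
    (Iso.refl _) ?_ ?_ ?_)
  · exact (Category.comp_id _).trans (Category.id_comp _).symm
  · exact (Category.comp_id _).trans (Category.id_comp _).symm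
  · have h1 : (incD k).map ((incD k).preimage (δ ≫ ((incD k).commShiftIso (1 : ℤ)).inv.app X)) ≫
        ((incD k).commShiftIso (1 : ℤ)).hom.app X = δ := by
      rw [(incD k).map_preimage, Category.assoc, Iso.inv_hom_id_app]
      exact Category.comp_id _
    refine Eq.trans (congrArg _ (CategoryTheory.Functor.map_id _ _)) ((Category.comp_id _).trans ?_)
    exact h1.trans (Category.id_comp _).symm

variable (k) in
/-- The distinguished triangle `S₂ ⟶ P₁ ⟶ S₁ ⟶ S₂⟦1⟧`. -/
lemma exists_stalk_triangle : ∃ h : (stalk k).obj (Ind.S₁.rep k) ⟶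
    ((stalk k).obj (Ind.S₂.rep k))⟦(1 : ℤ)⟧,
    Triangle.mk ((stalk k).map (Ind.incl k)) ((stalk k).map (Ind.quot k)) h ∈ distTriang _ :=
  exists_triangle_of_incD _ _ _ (Ind.shortExact k).singleTriangle_distinguished

/-- The position of an indecomposable representation in the helix. -/
def Ind.idx : Ind → ℤ
  | .S₂ => 0
  | .P₁ => 1
  | .S₁ => 2

lemma stalk_hom_shift_eq_zero_of_projective (X Y : Ind) [Projective (X.rep k)] (hX : X ≠ .S₁)
    (n : ℤ) (h0 : Y.idx + 3 * n ≠ X.idx) (h1 : Y.idx + 3 * n ≠ X.idx + 1)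
    (f : (stalk k).obj (X.rep k) ⟶ ((stalk k).obj (Y.rep k))⟦n⟧) : f = 0 := by
  rcases lt_trichotomy n 0 with hn | rfl | hn
  · exact stalk_hom_eq_zero_of_neg _ _ n hn f
  · refine stalk_hom_eq_zero_of_hom _ _ ?_ f
    cases X <;> cases Y <;> simp [Ind.idx] at h0 h1 hX
    · exact Ind.hom_S₂_S₁
    · exact Ind.hom_P₁_S₂
  · exact stalk_hom_eq_zero_of_pos _ _ n hn f

/-- S₁ is not projective, so positive degrees are read off from the triangle S₂ → P₁ → S₁. As P₁ has
no morphisms of positive degree, `f` factors as the connecting map followed by some S₂[1] → Y[n].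
The hypotheses leave one possibly nonzero case, Y = P₁ and n = 1, where this map is a multiple of
the shifted inclusion and is killed by the connecting map. -/
lemma stalk_hom_shift_eq_zero_of_S₁ (Y : Ind) (n : ℤ) (h0 : Y.idx + 3 * n ≠ 2)
    (h1 : Y.idx + 3 * n ≠ 3)
    (f : (stalk k).obj (Ind.S₁.rep k) ⟶ ((stalk k).obj (Y.rep k))⟦n⟧) : f = 0 := by
  rcases lt_trichotomy n 0 with hn | rfl | hn
  · exact stalk_hom_eq_zero_of_neg _ _ n hn f
  · refine stalk_hom_eq_zero_of_hom _ _ ?_ f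
    cases Y <;> simp [Ind.idx] at h0 h1
    · exact Ind.hom_S₁_S₂
    · exact Ind.hom_S₁_P₁
  · obtain ⟨h, T⟩ := exists_stalk_triangle k
    obtain ⟨g, hg⟩ : ∃ g : ((stalk k).obj (Ind.S₂.rep k))⟦(1 : ℤ)⟧ ⟶
        ((stalk k).obj (Y.rep k))⟦n⟧, f = h ≫ g :=
      Triangle.yoneda_exact₃ _ T f (stalk_hom_eq_zero_of_pos _ _ n hn _)
    rw [hg]
    by_cases hY : Y.idx + 3 * (n - 1) = 1
    · have hn1 : n = 1 := by cases Y <;> simp only [Ind.idx] at hY <;> omega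
      subst hn1
      have hY' : Y = .P₁ := by cases Y <;> simp [Ind.idx] at hY; rfl
      subst hY'
      obtain ⟨g, rfl⟩ := (shiftFunctor (DbA2 k) (1 : ℤ)).map_surjective g
      obtain ⟨g, rfl⟩ := (stalk k).map_surjective g
      obtain ⟨c, rfl⟩ := Ind.hom_S₂_P₁ g
      have h31 : h ≫ ((stalk k).map (Ind.incl k))⟦(1 : ℤ)⟧' = 0 := comp_distTriang_mor_zero₃₁ _ T
      rw [(stalk k).map_smul, (shiftFunctor (DbA2 k) (1 : ℤ)).map_smul, Linear.comp_smul, h31,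
        smul_zero]
    · rw [hom_shift_eq_zero 1 n (n - 1) (by omega)
        (stalk_hom_shift_eq_zero_of_projective .S₂ Y (by decide) (n - 1)
          (by cases Y <;> simp only [Ind.idx] at h0 h1 ⊢ <;> omega)
          (by simp only [Ind.idx] at hY ⊢; omega)) g, comp_zero]

lemma stalk_hom_shift_eq_zero (X Y : Ind) (n : ℤ) (h0 : Y.idx + 3 * n ≠ X.idx)
    (h1 : Y.idx + 3 * n ≠ X.idx + 1)
    (f : (stalk k).obj (X.rep k) ⟶ ((stalk k).obj (Y.rep k))⟦n⟧) : f = 0 := by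
  cases X with
  | S₁ => exact stalk_hom_shift_eq_zero_of_S₁ Y n h0 h1 f
  | S₂ => exact stalk_hom_shift_eq_zero_of_projective .S₂ Y (by decide) n h0 h1 f
  | P₁ => exact stalk_hom_shift_eq_zero_of_projective .P₁ Y (by decide) n h0 h1 f

lemma ob_hom_eq_zero (X Y : Ind) (a b : ℤ) (h0 : Y.idx + 3 * b ≠ X.idx + 3 * a)
    (h1 : Y.idx + 3 * b ≠ X.idx + 3 * a + 1) (f : ob k X a ⟶ ob k Y b) : f = 0 :=
  hom_shift_eq_zero a b (b - a) (by omega)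
    (stalk_hom_shift_eq_zero X Y (b - a) (by omega) (by omega)) f

lemma ob_end_scalar (X : Ind) (j : ℤ) (f : ob k X j ⟶ ob k X j) : ∃ c : k, f = c • 𝟙 _ := by
  obtain ⟨g, rfl⟩ := (shiftFunctor (DbA2 k) j).map_surjective f
  obtain ⟨g, rfl⟩ := (stalk k).map_surjective g
  obtain ⟨c, rfl⟩ := X.rep_end_scalar g
  refine ⟨c, ?_⟩
  rw [(stalk k).map_smul, (shiftFunctor (DbA2 k) j).map_smul, (stalk k).map_id,
    CategoryTheory.Functor.map_id]
  rfl

lemma not_isZero_ob (X : Ind) (j : ℤ) : ¬ IsZero (ob k X j) := by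
  intro h
  refine X.not_isZero_rep (k := k) ((IsZero.iff_id_eq_zero _).2 ((stalk k).map_injective
    ((shiftFunctor (DbA2 k) j).map_injective ?_)))
  exact h.eq_of_src _ _

/-- Shifts of the objects `X[j]`. -/
noncomputable def obShiftIso (X : Ind) (a b c : ℤ) (h : a + b = c) : (ob k X a)⟦b⟧ ≅ ob k X c :=
  ((shiftFunctorAdd' (DbA2 k) a b c h).app _).symm

lemma ob_triangle (j : ℤ) : ∃ (f : ob k .S₂ j ⟶ ob k .P₁ j) (g : ob k .P₁ j ⟶ ob k .S₁ j)
    (h : ob k .S₁ j ⟶ (ob k .S₂ j)⟦(1 : ℤ)⟧), Triangle.mk f g h ∈ distTriang _ := by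
  obtain ⟨h, T⟩ := exists_stalk_triangle k
  exact ⟨_, _, _, Triangle.shift_distinguished _ T j⟩

lemma sumOf_stalk (M : RepA2 k) (j : ℤ) :
    SumOf (fun X => ∃ i, X = ob k i j) (((stalk k).obj M)⟦j⟧) :=
  SumOf.map (stalk k ⋙ shiftFunctor (DbA2 k) j) (by rintro _ ⟨i, rfl⟩; exact ⟨i, rfl⟩) (Ind.sumOf_rep M)

/-- This is the truncation triangle at degree `a`: since `L` starts in degree `a`, the lower part is
a single shifted representation. The bound `max a b` avoids assuming `a ≤ b`. -/
lemma exists_truncation (L : DbA2 k) (a b : ℤ) [t.IsGE L.obj a] [t.IsLE L.obj b] :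
    ∃ (M : RepA2 k) (N : DbA2 k) (f : ((stalk k).obj M)⟦(-a : ℤ)⟧ ⟶ L) (g : L ⟶ N)
      (h : N ⟶ (((stalk k).obj M)⟦(-a : ℤ)⟧)⟦(1 : ℤ)⟧), Triangle.mk f g h ∈ distTriang _ ∧
      t.IsGE N.obj (a + 1) ∧ t.IsLE N.obj (max a b) := by
  obtain ⟨X, Y, hX, hY, f, g, h, T⟩ := t.exists_triangle L.obj a (a + 1) rfl
  have hX' : t.IsLE X a := ⟨hX⟩
  have hY' : t.IsGE Y (a + 1) := ⟨hY⟩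
  have hXge : t.IsGE X a := by
    refine t.isGE₂ _ (inv_rot_of_distTriang _ T) a ?_ ‹_›
    have : t.IsGE (Y⟦(-1 : ℤ)⟧) (a + 2) := t.isGE_shift Y (a + 1) (-1) (a + 2)
    exact t.isGE_of_ge (Y⟦(-1 : ℤ)⟧) a (a + 2)
  have hYle : t.IsLE Y (max a b) := by
    refine t.isLE₂ _ (rot_of_distTriang _ T) _ (t.isLE_of_le L.obj b _ (le_max_right a b)) ?_
    have : t.IsLE (X⟦(1 : ℤ)⟧) (a - 1) := t.isLE_shift X a 1 (a - 1)
    exact t.isLE_of_le (X⟦(1 : ℤ)⟧) (a - 1) _ (by omega)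
  obtain ⟨M, ⟨e⟩⟩ := exists_iso_singleFunctor_obj_of_isGE_of_isLE X a
  let e' : (incD k).obj (((stalk k).obj M)⟦(-a : ℤ)⟧) ≅ X :=
    ((incD k).commShiftIso (-a : ℤ)).app _ ≪≫
      ((singleFunctors (RepA2 k)).shiftIso (-a) a 0 (by omega)).app M ≪≫ e.symm
  let N : DbA2 k := ⟨Y, ⟨a + 1, hY'⟩, ⟨_, hYle⟩⟩
  obtain ⟨f', hf'⟩ := (incD k).map_surjective (e'.hom ≫ f)
  obtain ⟨g', hg'⟩ := (incD k).map_surjective (X := L) (Y := N) g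
  let δ : (incD k).obj N ⟶ ((incD k).obj (((stalk k).obj M)⟦(-a : ℤ)⟧))⟦(1 : ℤ)⟧ :=
    h ≫ e'.inv⟦(1 : ℤ)⟧'
  have c1 : f ≫ (Iso.refl L.obj).hom = e'.symm.hom ≫ (incD k).map f' := by
    rw [hf']
    exact (Category.comp_id f).trans (e'.inv_hom_id_assoc f).symm
  have c2 : g ≫ (Iso.refl Y).hom = (Iso.refl L.obj).hom ≫ (incD k).map g' := by
    rw [hg']
    exact (Category.comp_id g).trans (Category.id_comp g).symm
  obtain ⟨h', T'⟩ := exists_triangle_of_incD f' g' δ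
    (distinguished_of_iso T e'.symm (Iso.refl _) (Iso.refl _) c1 c2 (Category.id_comp _).symm)
  exact ⟨M, N, f', g', h', T', hY', hYle⟩

/-- Induction on the amplitude: the lowest cohomology splits off because the category is hereditary.
The bound `j ≤ -a` is carried along to place the two ends of the connecting map too far apart in the
helix. -/
lemma sumOf_ob_of_isGE (n : ℕ) : ∀ (a : ℤ) (L : DbA2 k), t.IsGE L.obj a → t.IsLE L.obj (a + n - 1) →
    SumOf (fun X => ∃ i j, j ≤ -a ∧ X = ob k i j) L := by
  induction n with
  | zero =>
    intro a L h1 h2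
    refine .zero ((IsZero.iff_id_eq_zero _).2 ((incD k).map_injective ?_))
    exact (t.isZero L.obj (a + (0 : ℕ) - 1) a (by simp)).eq_of_src _ _
  | succ n ih =>
    intro a L h1 h2
    obtain ⟨M, N, f, g, h, T, hN1, hN2⟩ := exists_truncation L a (a + (n + 1 : ℕ) - 1)
    have hN := ih (a + 1) N hN1 (t.isLE_of_le N.obj _ _ (show max a (a + (n + 1 : ℕ) - 1) ≤ _ by
      push_cast; omega))
    -- The summands of `N` have shift at most `-a - 1` and those of the target have shift `-a + 1`,
    -- so their helix indices differ by at least 4.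
    have hh : h = 0 := by
      refine SumOf.hom_eq_zero ?_ hN (SumOf.map (shiftFunctor (DbA2 k) (1 : ℤ))
        (Q' := fun Y => ∃ X, Y = (ob k X (-a))⟦(1 : ℤ)⟧) ?_ (sumOf_stalk M (-a))) h
      · rintro _ _ ⟨X, j, hj, rfl⟩ ⟨Y, rfl⟩ f
        rw [← cancel_mono (obShiftIso Y (-a) 1 (-a + 1) rfl).hom, zero_comp]
        refine ob_hom_eq_zero _ _ _ _ ?_ ?_ _
        · cases X <;> cases Y <;> simp only [Ind.idx] <;> omega
        · cases X <;> cases Y <;> simp only [Ind.idx] <;> omega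
      · rintro _ ⟨X, rfl⟩
        exact ⟨X, rfl⟩
    obtain ⟨e, -⟩ := exists_iso_binaryBiproduct_of_distTriang _ T hh
    refine SumOf.of_iso e (SumOf.biprod ?_ ?_)
    · refine SumOf.mono ?_ (sumOf_stalk M (-a))
      rintro _ ⟨X, rfl⟩
      exact ⟨X, -a, le_rfl, rfl⟩
    · refine SumOf.mono ?_ hN
      rintro _ ⟨X, j, hj, rfl⟩
      exact ⟨X, j, by omega, rfl⟩

/-- Every object of the bounded derived category is a direct sum of shifts of `S₁`, `S₂`, `P₁`. -/
lemma sumOf_ob (L : DbA2 k) : SumOf (fun X => ∃ i j, X = ob k i j) L := by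
  obtain ⟨⟨a, ha⟩, ⟨b, hb⟩⟩ := L.property
  refine SumOf.mono ?_ (sumOf_ob_of_isGE (b - a + 1).toNat a L ha
    (t.isLE_of_le _ b _ (by omega)))
  rintro _ ⟨X, j, -, rfl⟩
  exact ⟨X, j, rfl⟩

/-! ### The helix of the bounded derived category -/

/-- The representation at a given position of the helix modulo `3`. -/
def Ind.ofIdx (r : ℤ) : Ind := if r = 0 then .S₂ else if r = 1 then .P₁ else .S₁

variable (k) in
/-- The helix `…, S₂, P₁, S₁, S₂[1], P₁[1], S₁[1], …`. -/
noncomputable def helix (i : ℤ) : DbA2 k := ob k (Ind.ofIdx (i % 3)) (i / 3)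

lemma helix_eq (X : Ind) (i j : ℤ) (h : i = X.idx + 3 * j) : helix k i = ob k X j := by
  have h1 : i / 3 = j := by cases X <;> simp only [Ind.idx] at h <;> omega
  have h2 : i % 3 = X.idx := by cases X <;> simp only [Ind.idx] at h ⊢ <;> omega
  have h3 : Ind.ofIdx X.idx = X := by cases X <;> rfl
  rw [helix, h1, h2, h3]

lemma exists_idx (i : ℤ) : ∃ (X : Ind) (j : ℤ), i = X.idx + 3 * j := by
  have : i % 3 = 0 ∨ i % 3 = 1 ∨ i % 3 = 2 := by omega
  rcases this with h | h | h
  · exact ⟨.S₂, i / 3, by simp only [Ind.idx]; omega⟩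
  · exact ⟨.P₁, i / 3, by simp only [Ind.idx]; omega⟩
  · exact ⟨.S₁, i / 3, by simp only [Ind.idx]; omega⟩

lemma exists_triangle_rotate {X Y Z X' : DbA2 k} (e : X⟦(1 : ℤ)⟧ ≅ X')
    (T : ∃ (f : X ⟶ Y) (g : Y ⟶ Z) (h : Z ⟶ X⟦(1 : ℤ)⟧), Triangle.mk f g h ∈ distTriang _) :
    ∃ (f : Y ⟶ Z) (g : Z ⟶ X') (h : X' ⟶ Y⟦(1 : ℤ)⟧), Triangle.mk f g h ∈ distTriang _ := by
  obtain ⟨f, g, h, T⟩ := T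
  exact ⟨g, h ≫ e.hom, e.inv ≫ (-f⟦(1 : ℤ)⟧'), distinguished_of_iso (rotate_distinguished T)
    (Iso.refl _) (Iso.refl _) e (by simp) (by simp) (by simp)⟩

variable (k) in
-- Only the triangles S₂[j] → P₁[j] → S₁[j] need an argument; the triangles starting at P₁[j] and
-- S₁[j] are their rotations.
theorem isA2Helix_helix : IsA2Helix k (helix k) where
  shift i := by
    obtain ⟨X, j, rfl⟩ := exists_idx i
    rw [helix_eq X _ j rfl, helix_eq X _ (j + 1) (by ring)]
    exact ⟨obShiftIso X _ _ _ rfl⟩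
  triangle i := by
    obtain ⟨X, j, rfl⟩ := exists_idx i
    cases X with
    | S₂ =>
      rw [helix_eq .S₂ _ j rfl, helix_eq .P₁ _ j (by simp only [Ind.idx]; ring),
        helix_eq .S₁ _ j (by simp only [Ind.idx]; ring)]
      exact ob_triangle j
    | P₁ =>
      rw [helix_eq .P₁ _ j rfl, helix_eq .S₁ _ j (by simp only [Ind.idx]; ring),
        helix_eq .S₂ _ (j + 1) (by simp only [Ind.idx]; ring)]
      exact exists_triangle_rotate (obShiftIso _ _ _ _ rfl) (ob_triangle j)
    | S₁ =>
      rw [helix_eq .S₁ _ j rfl, helix_eq .S₂ _ (j + 1) (by simp only [Ind.idx]; ring),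
        helix_eq .P₁ _ (j + 1) (by simp only [Ind.idx]; ring)]
      exact exists_triangle_rotate (obShiftIso _ _ _ _ rfl)
        (exists_triangle_rotate (obShiftIso _ _ _ _ rfl) (ob_triangle j))
  hom_eq_zero i j h0 h1 f := by
    obtain ⟨X, a, rfl⟩ := exists_idx i
    obtain ⟨Y, b, rfl⟩ := exists_idx j
    revert f
    rw [helix_eq X _ a rfl, helix_eq Y _ b rfl]
    exact ob_hom_eq_zero X Y a b h0 h1
  end_scalar i := by
    obtain ⟨X, a, rfl⟩ := exists_idx i
    rw [helix_eq X _ a rfl]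
    exact ob_end_scalar X a
  not_isZero i := not_isZero_ob _ _
  sumOf M := by
    refine SumOf.mono ?_ (sumOf_ob M)
    rintro _ ⟨X, j, rfl⟩
    exact ⟨X.idx + 3 * j, (helix_eq X _ j rfl).symm⟩

end Stalk

/-! ### Harder-Narasimhan filtrations -/

section Triangulated

variable {D : Type u} [Category.{v} D] [Preadditive D] [HasZeroObject D] [HasShift D ℤ]
  [∀ n : ℤ, (shiftFunctor D n).Additive] [Pretriangulated D]

lemma hom_shift_one_eq_zero {X T : D} (h : ∀ g : X ⟶ T⟦(-1 : ℤ)⟧, g = 0) (f : X⟦(1 : ℤ)⟧ ⟶ T) :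
    f = 0 := by
  rw [← cancel_mono ((shiftFunctorZero D ℤ).app T).inv, zero_comp]
  exact hom_shift_eq_zero 1 0 (-1) (by norm_num) h _

namespace HNFiltration

variable {P : ℝ → ObjectProperty D} {M : D} (F : HNFiltration P M)

lemma hom_to_X_eq_zero (T : D) (h : ∀ i, ∀ f : T ⟶ F.A i, f = 0) (j : Fin (F.n + 1))
    (f : T ⟶ F.X j) : f = 0 := by
  induction j using Fin.induction with
  | zero => exact F.isZero_zero.eq_of_tgt _ _
  | succ j ih =>
    obtain ⟨g, hg⟩ : ∃ g : T ⟶ F.X j.castSucc, f = g ≫ F.inc j :=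
      Triangle.coyoneda_exact₂ _ (F.triangle j) f (h j _)
    rw [hg, ih g, zero_comp]

lemma hom_from_X_eq_zero (T : D) (h : ∀ i, ∀ f : F.A i ⟶ T, f = 0) (j : Fin (F.n + 1))
    (f : F.X j ⟶ T) : f = 0 := by
  induction j using Fin.induction with
  | zero => exact F.isZero_zero.eq_of_src _ _
  | succ j ih =>
    obtain ⟨g, hg⟩ : ∃ g : F.A j ⟶ T, f = F.proj j ≫ g :=
      Triangle.yoneda_exact₂ _ (F.triangle j) f (ih _)
    rw [hg, h j g, comp_zero]

lemma hom_to_eq_zero (T : D) (h : ∀ i, ∀ f : T ⟶ F.A i, f = 0) (f : T ⟶ M) : f = 0 := by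
  rw [← cancel_mono F.lastIso.inv, F.hom_to_X_eq_zero T h _ (f ≫ F.lastIso.inv), zero_comp]

lemma hom_from_eq_zero (T : D) (h : ∀ i, ∀ f : F.A i ⟶ T, f = 0) (f : M ⟶ T) : f = 0 := by
  rw [← cancel_epi F.lastIso.hom, F.hom_from_X_eq_zero T h _ (F.lastIso.hom ≫ f), comp_zero]

lemma mem_of_ext (Q : ObjectProperty D) (hz : ∀ X, IsZero X → Q X)
    (hext : ∀ T ∈ distTriang D, Q T.obj₁ → Q T.obj₃ → Q T.obj₂)
    (hiso : ∀ X Y, (X ≅ Y) → Q X → Q Y) (h : ∀ i, Q (F.A i)) : Q M := by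
  refine hiso _ _ F.lastIso ?_
  generalize Fin.last F.n = j
  induction j using Fin.induction with
  | zero => exact hz _ F.isZero_zero
  | succ j ih => exact hext _ (F.triangle j) ih (h j)

/-- The first factor is the first nonzero stage and maps along the tower. A map from `T` that dies
at a step of the tower comes from `T ⟶ (A j)[-1]`, which is excluded, so composition with the tower
is injective on such maps. -/
lemma exists_first_X (i₀ : Fin F.n) (h₀ : i₀.val = 0) (j : Fin (F.n + 1)) (hj : 0 < j) :
    ∃ a : F.A i₀ ⟶ F.X j, ∀ (T : D) (f : T ⟶ F.A i₀),
      (∀ i, ∀ g : T ⟶ (F.A i)⟦(-1 : ℤ)⟧, g = 0) → f ≫ a = 0 → f = 0 := by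
  induction j using Fin.induction with
  | zero => exact absurd hj (lt_irrefl _)
  | succ j ih =>
    by_cases hj0 : j.val = 0
    · obtain rfl : i₀ = j := Fin.ext (h₀.trans hj0.symm)
      have hz : IsZero (F.X i₀.castSucc) := by
        have : i₀.castSucc = 0 := Fin.ext h₀
        rw [this]
        exact F.isZero_zero
      have hiso : IsIso (F.proj i₀) := (Triangle.isZero₁_iff_isIso₂ _ (F.triangle i₀)).1 hz
      refine ⟨inv (F.proj i₀), fun T f _ hf => ?_⟩
      rw [← cancel_mono (inv (F.proj i₀)), hf, zero_comp]
    · obtain ⟨a, ha⟩ := ih (Fin.pos_iff_ne_zero.2 fun h => hj0 (congrArg Fin.val h))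
      refine ⟨a ≫ F.inc j, fun T f hT hf => ha T f hT ?_⟩
      obtain ⟨g, hg⟩ := Triangle.coyoneda_exact₂ _ (inv_rot_of_distTriang _ (F.triangle j)) (f ≫ a)
        ((Category.assoc _ _ _).trans hf)
      exact hg.trans ((congrArg (· ≫ _) (hT j g)).trans zero_comp)

lemma exists_first (i₀ : Fin F.n) (h₀ : i₀.val = 0) :
    ∃ a : F.A i₀ ⟶ M, ∀ (T : D) (f : T ⟶ F.A i₀),
      (∀ i, ∀ g : T ⟶ (F.A i)⟦(-1 : ℤ)⟧, g = 0) → f ≫ a = 0 → f = 0 := by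
  obtain ⟨a, ha⟩ := F.exists_first_X i₀ h₀ (Fin.last F.n) (Fin.mk_lt_mk.2 i₀.pos)
  refine ⟨a ≫ F.lastIso.hom, fun T f hT hf => ha T f hT ?_⟩
  rwa [← cancel_mono F.lastIso.hom, zero_comp, Category.assoc]

/-- Dually, a map out of the last factor that dies on `M` factors through the shift of the previous
stage, whose factors have no maps to `T[-1]`. -/
lemma exists_last (l : Fin F.n) (hl : l.val + 1 = F.n) :
    ∃ a : M ⟶ F.A l, ∀ (T : D) (f : F.A l ⟶ T),
      (∀ i, ∀ g : F.A i ⟶ T⟦(-1 : ℤ)⟧, g = 0) → a ≫ f = 0 → f = 0 := by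
  have e : F.X l.succ ≅ M := eqToIso (congrArg F.X (Fin.ext hl : l.succ = Fin.last F.n)) ≪≫ F.lastIso
  refine ⟨e.inv ≫ F.proj l, fun T f hT hf => ?_⟩
  rw [Category.assoc, ← cancel_epi e.hom, e.hom_inv_id_assoc, comp_zero] at hf
  obtain ⟨g, hg⟩ : ∃ g : (F.X l.castSucc)⟦(1 : ℤ)⟧ ⟶ T, f = F.conn l ≫ g :=
    Triangle.yoneda_exact₃ _ (F.triangle l) f hf
  rw [hg, hom_shift_one_eq_zero (F.hom_from_X_eq_zero _ hT _) g, comp_zero]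

lemma isZero_of_n_eq_zero (h : F.n = 0) : IsZero M := by
  refine IsZero.of_iso ?_ F.lastIso.symm
  have : Fin.last F.n = 0 := Fin.ext h
  rw [this]
  exact F.isZero_zero

/-- The empty filtration of a zero object. -/
def ofIsZero (P : ℝ → ObjectProperty D) {M : D} (h : IsZero M) : HNFiltration P M where
  n := 0
  X _ := M
  A i := i.elim0
  φ i := i.elim0
  isZero_zero := h
  lastIso := Iso.refl _
  inc i := i.elim0
  proj i := i.elim0
  conn i := i.elim0
  triangle i := i.elim0
  factor_mem i := i.elim0
  factor_ne_zero i := i.elim0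
  phase_anti i := i.elim0

end HNFiltration

/-! ### Slices and hearts as orthogonals -/

/-- There are no nonzero morphisms from the slices with index in `I` to `M`, and from `M` to
the slices with index in `J`. -/
def Orth (P : ℝ → ObjectProperty D) (I J : Set ℝ) : ObjectProperty D := fun M =>
  (∀ ψ ∈ I, ∀ A, P ψ A → ∀ f : A ⟶ M, f = 0) ∧ (∀ ψ ∈ J, ∀ B, P ψ B → ∀ f : M ⟶ B, f = 0)

namespace Orth

variable {P : ℝ → ObjectProperty D} {I J : Set ℝ}

lemma zero {M : D} (h : IsZero M) : Orth P I J M :=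
  ⟨fun _ _ _ _ _ => h.eq_of_tgt _ _, fun _ _ _ _ _ => h.eq_of_src _ _⟩

lemma of_retract {X M : D} (i : X ⟶ M) (r : M ⟶ X) (hir : i ≫ r = 𝟙 X) (h : Orth P I J M) :
    Orth P I J X := by
  refine ⟨fun ψ hψ A hA f => ?_, fun ψ hψ B hB f => ?_⟩
  · rw [← Category.comp_id f, ← hir, ← Category.assoc, h.1 ψ hψ A hA (f ≫ i), zero_comp]
  · rw [← Category.id_comp f, ← hir, Category.assoc, h.2 ψ hψ B hB (r ≫ f), comp_zero]

lemma of_iso {X Y : D} (e : X ≅ Y) (h : Orth P I J Y) : Orth P I J X :=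
  h.of_retract e.hom e.inv e.hom_inv_id

lemma ext {T : Triangle D} (hT : T ∈ distTriang D) (h₁ : Orth P I J T.obj₁)
    (h₃ : Orth P I J T.obj₃) : Orth P I J T.obj₂ := by
  refine ⟨fun ψ hψ A hA f => ?_, fun ψ hψ B hB f => ?_⟩
  · obtain ⟨g, rfl⟩ := Triangle.coyoneda_exact₂ _ hT f (h₃.1 ψ hψ A hA _)
    rw [h₁.1 ψ hψ A hA g, zero_comp]
  · obtain ⟨g, rfl⟩ := Triangle.yoneda_exact₂ _ hT f (h₁.2 ψ hψ B hB _)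
    rw [h₃.2 ψ hψ B hB g, comp_zero]

lemma biprod {X Y : D} (hX : Orth P I J X) (hY : Orth P I J Y) : Orth P I J (X ⊞ Y) :=
  ext (binaryBiproductTriangle_distinguished X Y) hX hY

lemma sumOf {Q : ObjectProperty D} (hQ : ∀ X, Q X → Orth P I J X) {M : D} (hM : SumOf Q M) :
    Orth P I J M :=
  hM.ind (fun _ => zero) hQ (fun _ _ => of_iso) (fun _ _ => biprod)

end Orth

namespace StabilityCondition

variable (σ : StabilityCondition D)

lemma P_of_iso {φ : ℝ} {X Y : D} (e : X ≅ Y) (h : σ.P φ X) : σ.P φ Y := by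
  obtain ⟨O, hO⟩ := HasZeroObject.zero (C := D)
  have : Triangle.mk e.hom (0 : Y ⟶ O) 0 ∈ distTriang D :=
    (Triangle.distinguished_iff_of_isZero₃ _ hO).2 (inferInstanceAs (IsIso e.hom))
  exact σ.ext_closed φ _ this h (σ.zero_mem φ _ hO)

lemma P_shift (n : ℤ) (φ : ℝ) (M : D) : σ.P (φ + n) (M⟦n⟧) ↔ σ.P φ M := by
  induction n using Int.induction_on generalizing φ with
  | zero =>
    rw [Int.cast_zero, add_zero]
    exact ⟨σ.P_of_iso ((shiftFunctorZero D ℤ).app M), σ.P_of_iso ((shiftFunctorZero D ℤ).app M).symm⟩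
  | succ n ih =>
    let e : M⟦((n : ℤ) + 1 : ℤ)⟧ ≅ (M⟦(n : ℤ)⟧)⟦(1 : ℤ)⟧ := (shiftFunctorAdd D (n : ℤ) 1).app M
    rw [← ih φ, ← σ.shift_iff (φ + ((n : ℤ) : ℝ))]
    have h : φ + ((n : ℤ) : ℝ) + 1 = φ + (((n : ℤ) + 1 : ℤ) : ℝ) := by push_cast; ring
    rw [h]
    exact ⟨σ.P_of_iso e, σ.P_of_iso e.symm⟩
  | pred n ih =>
    let e : M⟦(-(n : ℤ) : ℤ)⟧ ≅ (M⟦(-(n : ℤ) - 1 : ℤ)⟧)⟦(1 : ℤ)⟧ :=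
      (shiftFunctorAdd' D (-(n : ℤ) - 1) 1 (-(n : ℤ)) (by ring)).app M
    rw [← ih φ, ← σ.shift_iff (φ + ((-(n : ℤ) - 1 : ℤ) : ℝ))]
    have h : φ + ((-(n : ℤ) - 1 : ℤ) : ℝ) + 1 = φ + ((-(n : ℤ) : ℤ) : ℝ) := by push_cast; ring
    rw [h]
    exact ⟨σ.P_of_iso e.symm, σ.P_of_iso e⟩

lemma hom_shift_neg_eq_zero {φ ψ : ℝ} {A B : D} (hA : σ.P φ A) (hB : σ.P ψ B) (n : ℤ)
    (h : ψ + n < φ) (f : A ⟶ B⟦n⟧) : f = 0 :=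
  σ.hom_eq_zero φ (ψ + n) A _ hA ((σ.P_shift n ψ B).2 hB) h f

variable {σ} in
/-- A nonzero object lies in at most one slice. -/
lemma phase_unique {φ ψ : ℝ} {M : D} (hM : ¬ IsZero M) (h₁ : σ.P φ M) (h₂ : σ.P ψ M) : φ = ψ := by
  by_contra hne
  refine hM ((IsZero.iff_id_eq_zero M).2 ?_)
  rcases lt_or_gt_of_ne hne with h | h
  · exact σ.hom_eq_zero _ _ _ _ h₂ h₁ h _
  · exact σ.hom_eq_zero _ _ _ _ h₁ h₂ h _

variable {σ} in
-- A retract of the first factor has no map to any `(A j)[-1]`, whose phase is at most `φ i₀ - 1`.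
-- Hence no nonzero retract of the first factor is killed on its way to `M`.
lemma exists_first {M : D} (F : HNFiltration σ.P M) (i₀ : Fin F.n) (h₀ : i₀.val = 0) :
    ∃ a : F.A i₀ ⟶ M, ∀ (X : D) (i : X ⟶ F.A i₀) (r : F.A i₀ ⟶ X), i ≫ r = 𝟙 X →
      i ≫ a = 0 → IsZero X := by
  obtain ⟨a, ha⟩ := F.exists_first i₀ h₀
  refine ⟨a, fun X i r hir hia => (IsZero.iff_id_eq_zero X).2 ?_⟩
  rw [← hir, ha X i (fun j g => ?_) hia, zero_comp]
  have hj : F.φ j ≤ F.φ i₀ := F.phase_anti.antitone (by rw [Fin.le_def, h₀]; exact Nat.zero_le _)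
  have := σ.hom_shift_neg_eq_zero (F.factor_mem i₀) (F.factor_mem j) (-1)
    (by push_cast; linarith) (r ≫ g)
  rw [← Category.id_comp g, ← hir, Category.assoc, this, comp_zero]

variable {σ} in
lemma exists_last {M : D} (F : HNFiltration σ.P M) (l : Fin F.n) (hl : l.val + 1 = F.n) :
    ∃ a : M ⟶ F.A l, ∀ (X : D) (i : X ⟶ F.A l) (r : F.A l ⟶ X), i ≫ r = 𝟙 X →
      a ≫ r = 0 → IsZero X := by
  obtain ⟨a, ha⟩ := F.exists_last l hl
  refine ⟨a, fun X i r hir har => (IsZero.iff_id_eq_zero X).2 ?_⟩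
  rw [← hir, ha X r (fun j g => ?_) har, comp_zero]
  have hj : F.φ l ≤ F.φ j := F.phase_anti.antitone (by rw [Fin.le_def]; omega)
  have := σ.hom_shift_neg_eq_zero (F.factor_mem j) (F.factor_mem l) (-1)
    (by push_cast; linarith) (g ≫ i⟦(-1 : ℤ)⟧')
  rw [← Category.comp_id g, ← (shiftFunctor D (-1 : ℤ)).map_id, ← hir, Functor.map_comp,
    ← Category.assoc, this, zero_comp]

variable {σ} in
lemma phase_le {M : D} (F : HNFiltration σ.P M) {b : ℝ}
    (h : ∀ ψ ∈ Set.Ioi b, ∀ A, σ.P ψ A → ∀ f : A ⟶ M, f = 0) (i : Fin F.n) : F.φ i ≤ b := by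
  by_contra! hb
  obtain ⟨a, ha⟩ := exists_first F ⟨0, i.pos⟩ rfl
  refine F.factor_ne_zero _ (ha _ (𝟙 _) (𝟙 _) (Category.comp_id _) ?_)
  refine h (F.φ ⟨0, i.pos⟩) (lt_of_lt_of_le hb (F.phase_anti.antitone ?_)) _ (F.factor_mem _) _
  exact Nat.zero_le _

variable {σ} in
-- If a phase were in `J`, the last phase would be too, and the projection to the last factor is
-- nonzero. A general lower set covers both `Iio φ`, used for slices, and `Iic 0`, used for the
-- heart.
lemma lt_phase {M : D} (F : HNFiltration σ.P M) {J : Set ℝ} (hJ : IsLowerSet J)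
    (h : ∀ ψ ∈ J, ∀ B, σ.P ψ B → ∀ f : M ⟶ B, f = 0) (i : Fin F.n) : F.φ i ∉ J := by
  intro hb
  have hn := i.pos
  obtain ⟨a, ha⟩ := exists_last F ⟨F.n - 1, by omega⟩ (Nat.sub_add_cancel hn)
  refine F.factor_ne_zero _ (ha _ (𝟙 _) (𝟙 _) (Category.comp_id _) ?_)
  refine h _ (hJ (F.phase_anti.antitone ?_) hb) _ (F.factor_mem _) _
  rw [Fin.le_def]
  exact Nat.le_sub_one_of_lt i.2

/-- Orthogonality to larger and smaller phases forces every Harder-Narasimhan factor to have phase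
`φ`. In this form closure under retracts is immediate, although it is not an axiom of a slicing. -/
lemma P_iff (φ : ℝ) (M : D) : σ.P φ M ↔ Orth σ.P (Set.Ioi φ) (Set.Iio φ) M := by
  constructor
  · exact fun h => ⟨fun ψ hψ A hA => σ.hom_eq_zero ψ φ A M hA h hψ,
      fun ψ hψ B hB => σ.hom_eq_zero φ ψ M B h hB hψ⟩
  · intro h
    by_cases hM : IsZero M
    · exact σ.zero_mem φ M hM
    obtain ⟨F⟩ := σ.exists_HN M hM
    refine F.mem_of_ext (σ.P φ) (σ.zero_mem φ) (σ.ext_closed φ) (fun X Y => σ.P_of_iso)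
      (fun i => ?_)
    have h1 := phase_le F h.1 i
    have h2 := lt_phase F (isLowerSet_Iio φ) h.2 i
    have h3 : F.φ i = φ := le_antisymm h1 (not_lt.1 h2)
    exact h3 ▸ F.factor_mem i

lemma heart_iff (M : D) : σ.heart M ↔ Orth σ.P (Set.Ioi 1) (Set.Iic 0) M := by
  constructor
  · rintro ⟨F, hF⟩
    exact ⟨fun ψ hψ A hA => F.hom_to_eq_zero A
        (fun i => σ.hom_eq_zero _ _ _ _ hA (F.factor_mem i) (lt_of_le_of_lt (hF i).2 hψ)),
      fun ψ hψ B hB => F.hom_from_eq_zero B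
        (fun i => σ.hom_eq_zero _ _ _ _ (F.factor_mem i) hB (lt_of_le_of_lt hψ (hF i).1))⟩
  · intro h
    by_cases hM : IsZero M
    · exact ⟨HNFiltration.ofIsZero _ hM, fun i => i.elim0⟩
    obtain ⟨F⟩ := σ.exists_HN M hM
    exact ⟨F, fun i => ⟨not_le.1 (lt_phase F (isLowerSet_Iic 0) h.2 i), phase_le F h.1 i⟩⟩

lemma P_of_retract {φ : ℝ} {X M : D} (i : X ⟶ M) (r : M ⟶ X) (hir : i ≫ r = 𝟙 X)
    (h : σ.P φ M) : σ.P φ X :=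
  (σ.P_iff φ X).2 (((σ.P_iff φ M).1 h).of_retract i r hir)

end StabilityCondition

end Triangulated


/-! ### Extensions of classes without nonpositive morphisms -/

section Extensions

variable {D : Type u} [Category.{v} D] [Preadditive D] [HasZeroObject D] [HasShift D ℤ]
  [∀ n : ℤ, (shiftFunctor D n).Additive] [Pretriangulated D]

/-- There are no nonzero morphisms from `X` to `Y` of nonpositive degree. -/
def HomNonpos (X Y : D) : Prop := ∀ n : ℤ, n ≤ 0 → ∀ f : X ⟶ Y⟦n⟧, f = 0

namespace HomNonpos

variable {X Y : D}

lemma eq_zero (h : HomNonpos X Y) (f : X ⟶ Y) : f = 0 := by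
  rw [← cancel_mono ((shiftFunctorZero D ℤ).app Y).inv, zero_comp]
  exact h 0 le_rfl _

lemma shift_one_eq_zero (h : HomNonpos X Y) {n : ℤ} (hn : n ≤ 1) (f : X⟦(1 : ℤ)⟧ ⟶ Y⟦n⟧) : f = 0 :=
  hom_shift_eq_zero 1 n (n - 1) (by ring) (h _ (by omega)) f

lemma shift_one_eq_zero' (h : HomNonpos X Y) (f : X⟦(1 : ℤ)⟧ ⟶ Y) : f = 0 :=
  hom_shift_one_eq_zero (h (-1) (by norm_num)) f

lemma ext_right {T : Triangle D} (hT : T ∈ distTriang D) (h₁ : HomNonpos X T.obj₁)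
    (h₃ : HomNonpos X T.obj₃) : HomNonpos X T.obj₂ := by
  intro n hn f
  obtain ⟨g, hg⟩ := Triangle.coyoneda_exact₂ _ (Triangle.shift_distinguished T hT n) f
    (h₃ n hn _)
  exact hg.trans ((congrArg (· ≫ _) (h₁ n hn g)).trans zero_comp)

end HomNonpos

/-- The extensions `M ⟶ L ⟶ N ⟶ M⟦1⟧` of objects `N` of `Q₂` by objects `M` of `Q₁`. -/
def Extn (Q₁ Q₂ : ObjectProperty D) : ObjectProperty D := fun L =>
  ∃ (M N : D) (a : M ⟶ L) (f : L ⟶ N) (g : N ⟶ M⟦(1 : ℤ)⟧), Q₁ M ∧ Q₂ N ∧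
    Triangle.mk a f g ∈ distTriang D

/-- The two descriptions differ by a rotation of the triangle; the sign in the rotated third map is
absorbed in the choice of `a`. -/
lemma homWithCone_iff {L N M : D} (f : L ⟶ N) :
    f ∈ homWithCone L N M ↔ ∃ (a : M ⟶ L) (g : N ⟶ M⟦(1 : ℤ)⟧), Triangle.mk a f g ∈ distTriang D := by
  constructor
  · rintro ⟨g, h, T⟩
    obtain ⟨a, ha⟩ := (shiftFunctor D (1 : ℤ)).map_surjective (-h)
    refine ⟨a, g, (rotate_distinguished_triangle _).2 ?_⟩
    have : (Triangle.mk a f g).rotate = Triangle.mk f g h := by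
      rw [show h = -a⟦(1 : ℤ)⟧' by rw [ha, neg_neg]]
      rfl
    rwa [this]
  · rintro ⟨a, g, T⟩
    exact ⟨g, _, rotate_distinguished T⟩

section

variable {L M N : D} {a : M ⟶ L} {f : L ⟶ N} {g : N ⟶ M⟦(1 : ℤ)⟧}

lemma factor_of_triangle (T : Triangle.mk a f g ∈ distTriang D) {N' : D} (h : ∀ x : M ⟶ N', x = 0)
    (f' : L ⟶ N') : ∃ α : N ⟶ N', f' = f ≫ α :=
  Triangle.yoneda_exact₂ _ T f' (h _)

lemma cancel_of_triangle (T : Triangle.mk a f g ∈ distTriang D) {N' : D}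
    (h : ∀ x : M⟦(1 : ℤ)⟧ ⟶ N', x = 0) {α β : N ⟶ N'} (e : f ≫ α = f ≫ β) : α = β := by
  obtain ⟨x, hx⟩ : ∃ x : M⟦(1 : ℤ)⟧ ⟶ N', α - β = g ≫ x :=
    Triangle.yoneda_exact₃ _ T (α - β)
      (by rw [← sub_eq_zero] at e; exact (Preadditive.comp_sub (f := f) (g := α) (g' := β)).trans e)
  rw [h x, comp_zero] at hx
  exact sub_eq_zero.1 hx

/-- The usual uniqueness argument for truncation triangles: vanishing in degree 0 gives comparison
maps in both directions, and vanishing in degree -1 makes the factorisations unique, so the maps are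
mutually inverse. -/
lemma exists_iso_of_triangles (T : Triangle.mk a f g ∈ distTriang D) {M' N' : D} {a' : M' ⟶ L}
    {f' : L ⟶ N'} {g' : N' ⟶ M'⟦(1 : ℤ)⟧} (T' : Triangle.mk a' f' g' ∈ distTriang D)
    (h : HomNonpos M N) (h' : HomNonpos M' N') (h₁ : HomNonpos M N') (h₂ : HomNonpos M' N) :
    ∃ α : N ≅ N', f' = f ≫ α.hom := by
  obtain ⟨α, hα⟩ := factor_of_triangle T h₁.eq_zero f'
  obtain ⟨β, hβ⟩ := factor_of_triangle T' h₂.eq_zero f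
  refine ⟨⟨α, β, ?_, ?_⟩, hα⟩
  · refine cancel_of_triangle T h.shift_one_eq_zero' ?_
    rw [← Category.assoc, ← hα, ← hβ, Category.comp_id]
  · refine cancel_of_triangle T' h'.shift_one_eq_zero' ?_
    rw [← Category.assoc, ← hβ, ← hα, Category.comp_id]

lemma nonempty_iso_of_triangles (T : Triangle.mk a f g ∈ distTriang D) {M' N' : D} {a' : M' ⟶ L}
    {f' : L ⟶ N'} {g' : N' ⟶ M'⟦(1 : ℤ)⟧} (T' : Triangle.mk a' f' g' ∈ distTriang D)
    (h : HomNonpos M N) (h' : HomNonpos M' N') (h₁ : HomNonpos M N') (h₂ : HomNonpos M' N) :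
    Nonempty (M ≅ M') ∧ Nonempty (N ≅ N') := by
  obtain ⟨α, hα⟩ := exists_iso_of_triangles T T' h h' h₁ h₂
  refine ⟨?_, ⟨α⟩⟩
  let e := isoTriangleOfIso₁₂ _ _ (rotate_distinguished T) (rotate_distinguished T')
    (Iso.refl L) α (by exact hα.symm.trans (Category.id_comp _).symm)
  exact ⟨(shiftFunctor D (1 : ℤ)).preimageIso (Triangle.π₃.mapIso e)⟩

end

/-! ### The Hall product of characteristic functions -/

lemma card_shift_hom (L N : D) (n : ℤ) : Nat.card (L⟦n⟧ ⟶ N) = Nat.card (L ⟶ N⟦-n⟧) :=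
  Nat.card_congr ((shiftEquiv D n).toAdjunction.homEquiv L N)

lemma homEuler_ne_zero (hfin : ∀ X Y : D, Finite (X ⟶ Y)) (L N : D) : homEuler L N ≠ 0 := by
  refine finprod_induction (· ≠ 0) one_ne_zero (fun _ _ => mul_ne_zero) (fun i => ?_)
  refine zpow_ne_zero _ (Nat.cast_ne_zero.2 ?_)
  have := hfin (L⟦((i + 1 : ℕ) : ℤ)⟧) N
  exact (Nat.card_pos (α := L⟦((i + 1 : ℕ) : ℤ)⟧ ⟶ N)).ne'

section

variable {L M N : D} {a : M ⟶ L} {f : L ⟶ N} {g : N ⟶ M⟦(1 : ℤ)⟧}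

lemma homEuler_eq_of_triangle (T : Triangle.mk a f g ∈ distTriang D) (h : HomNonpos M N) :
    homEuler L N = homEuler N N := by
  refine finprod_congr fun i => ?_
  rw [card_shift_hom, card_shift_hom]
  congr 2
  -- Composition with `f` identifies `Hom(N, N[-i-1])` with `Hom(L, N[-i-1])`, since `M` and `M[1]`
  -- have no nonzero maps to `N[-i-1]`.
  refine Nat.card_congr (Equiv.ofBijective (fun x => f ≫ x) ⟨fun x y hxy => ?_, fun y => ?_⟩).symm
  · exact cancel_of_triangle T (h.shift_one_eq_zero (by omega)) hxy
  · obtain ⟨x, hx⟩ := factor_of_triangle T (h _ (by omega)) y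
    exact ⟨x, hx.symm⟩

/-- The group `Aut N` acts simply transitively on the morphisms `L ⟶ N` with cone `M[1]`: freely by
cancellation, transitively by uniqueness of the triangle. -/
lemma card_homWithCone_of_triangle (T : Triangle.mk a f g ∈ distTriang D) (h : HomNonpos M N) :
    Nat.card (homWithCone L N M) = Nat.card (Aut N) := by
  have hmem : ∀ α : Aut N, f ≫ α.hom ∈ homWithCone L N M := fun α =>
    (homWithCone_iff _).2 ⟨a, α.inv ≫ g, distinguished_of_iso T (Iso.refl _) (Iso.refl _) α
      (by simp) (by simp)
      ((congrArg (g ≫ ·) (CategoryTheory.Functor.map_id _ _)).trans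
        ((Category.comp_id g).trans (α.hom_inv_id_assoc g).symm))⟩
  refine Nat.card_congr (Equiv.ofBijective (fun α => ⟨f ≫ α.hom, hmem α⟩)
    ⟨fun α β hαβ => ?_, fun ⟨f', hf'⟩ => ?_⟩).symm
  · exact Iso.ext (cancel_of_triangle T h.shift_one_eq_zero' (congrArg Subtype.val hαβ))
  · obtain ⟨a', g', T'⟩ := (homWithCone_iff _).1 hf'
    obtain ⟨α, hα⟩ := exists_iso_of_triangles T T' h h h h
    exact ⟨α, Subtype.ext hα.symm⟩

lemma hallNumber_eq_one (hfin : ∀ X Y : D, Finite (X ⟶ Y)) (T : Triangle.mk a f g ∈ distTriang D)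
    (h : HomNonpos M N) : hallNumber M N L = 1 := by
  have := hfin N N
  have : Finite (Aut N) := Finite.of_injective (fun α : Aut N => α.hom) fun _ _ h => Iso.ext h
  rw [hallNumber, card_homWithCone_of_triangle T h, homEuler_eq_of_triangle T h,
    div_self (homEuler_ne_zero hfin _ _), div_self, one_mul]
  exact Nat.cast_ne_zero.2 Nat.card_pos.ne'

end

lemma exists_triangle_of_hallNumber_ne_zero {L M N : D} (h : hallNumber M N L ≠ 0) :
    ∃ (a : M ⟶ L) (f : L ⟶ N) (g : N ⟶ M⟦(1 : ℤ)⟧), Triangle.mk a f g ∈ distTriang D := by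
  by_contra! hc
  have : IsEmpty (homWithCone L N M) := ⟨fun ⟨f, hf⟩ => by
    obtain ⟨a, g, T⟩ := (homWithCone_iff f).1 hf
    exact hc a f g T⟩
  exact h (by rw [hallNumber, Nat.card_of_isEmpty]; simp)

lemma mk_eq_mk_iff {X Y : D} :
    (Quotient.mk (isIsomorphicSetoid D) X = Quotient.mk (isIsomorphicSetoid D) Y) ↔
      Nonempty (X ≅ Y) :=
  Quotient.eq

lemma nonempty_out_iso (X : D) : Nonempty ((Quotient.mk (isIsomorphicSetoid D) X).out ≅ X) :=
  mk_eq_mk_iff.1 (Quotient.out_eq _)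

/-- `Q` is closed under isomorphisms. -/
def IsoClosed (Q : ObjectProperty D) : Prop := ∀ X Y, (X ≅ Y) → Q X → Q Y

lemma charFn_eq_one {Q : ObjectProperty D} {c : IsoClass D} (h : Q c.out) : charFn Q c = 1 :=
  if_pos h

lemma of_charFn_ne_zero {Q : ObjectProperty D} {c : IsoClass D} (h : charFn Q c ≠ 0) :
    Q c.out := by
  by_contra hc
  exact h (if_neg hc)

section

variable {Q₁ Q₂ : ObjectProperty D}

lemma Extn.isoClosed (Q₁ Q₂ : ObjectProperty D) : IsoClosed (Extn Q₁ Q₂) := by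
  rintro X Y e ⟨M, N, a, f, g, hM, hN, T⟩
  exact ⟨M, N, a ≫ e.hom, e.inv ≫ f, g, hM, hN, distinguished_of_iso T (Iso.refl _) e (Iso.refl _)
    (by simp) (by simp) (by simp)⟩

lemma exists_triangle_of_hallTerm_ne_zero {L : IsoClass D} {p : IsoClass D × IsoClass D}
    (h : hallTerm (charFn Q₁) (charFn Q₂) L p ≠ 0) : Q₁ p.1.out ∧ Q₂ p.2.out ∧
      ∃ (a : p.1.out ⟶ L.out) (f : L.out ⟶ p.2.out) (g : p.2.out ⟶ p.1.out⟦(1 : ℤ)⟧),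
        Triangle.mk a f g ∈ distTriang D :=
  ⟨of_charFn_ne_zero (left_ne_zero_of_mul (right_ne_zero_of_mul h)),
    of_charFn_ne_zero (right_ne_zero_of_mul (right_ne_zero_of_mul h)),
    exists_triangle_of_hallNumber_ne_zero (left_ne_zero_of_mul h)⟩

lemma eq_of_hallTerm_ne_zero (hQ : ∀ A B, Q₁ A → Q₂ B → HomNonpos A B) {L : IsoClass D}
    {p q : IsoClass D × IsoClass D} (hp : hallTerm (charFn Q₁) (charFn Q₂) L p ≠ 0)
    (hq : hallTerm (charFn Q₁) (charFn Q₂) L q ≠ 0) : p = q := by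
  obtain ⟨h1, h2, a, f, g, T⟩ := exists_triangle_of_hallTerm_ne_zero hp
  obtain ⟨h1', h2', a', f', g', T'⟩ := exists_triangle_of_hallTerm_ne_zero hq
  have key := nonempty_iso_of_triangles T T' (hQ _ _ h1 h2) (hQ _ _ h1' h2') (hQ _ _ h1 h2')
    (hQ _ _ h1' h2)
  refine Prod.ext ?_ ?_
  · rw [← Quotient.out_eq p.1, ← Quotient.out_eq q.1]
    exact mk_eq_mk_iff.2 key.1
  · rw [← Quotient.out_eq p.2, ← Quotient.out_eq q.2]
    exact mk_eq_mk_iff.2 key.2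

lemma hallDefined_charFn (hQ : ∀ A B, Q₁ A → Q₂ B → HomNonpos A B) :
    HallDefined (charFn Q₁) (charFn Q₂) := fun _ =>
  Set.Subsingleton.finite fun _ hp _ hq => eq_of_hallTerm_ne_zero hQ hp hq

/-- For each `L` at most one pair of classes contributes to the coefficient, and it contributes 1; a
contribution exists exactly when `L` is an extension of the required kind. -/
lemma hallMul_charFn (hfin : ∀ X Y : D, Finite (X ⟶ Y)) (hi₁ : IsoClosed Q₁) (hi₂ : IsoClosed Q₂)
    (hQ : ∀ A B, Q₁ A → Q₂ B → HomNonpos A B) :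
    hallMul (charFn Q₁) (charFn Q₂) = charFn (Extn Q₁ Q₂) := by
  funext L
  by_cases h : Extn Q₁ Q₂ L.out
  · obtain ⟨M, N, a, f, g, hM, hN, T⟩ := h
    rw [charFn_eq_one ⟨M, N, a, f, g, hM, hN, T⟩]
    obtain ⟨e⟩ := nonempty_out_iso M
    obtain ⟨e'⟩ := nonempty_out_iso N
    let p : IsoClass D × IsoClass D := (Quotient.mk _ M, Quotient.mk _ N)
    have hM' : Q₁ p.1.out := hi₁ _ _ e.symm hM
    have hN' : Q₂ p.2.out := hi₂ _ _ e'.symm hN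
    have T' : Triangle.mk (e.hom ≫ a) (f ≫ e'.inv) (e'.hom ≫ g ≫ e.inv⟦(1 : ℤ)⟧') ∈ distTriang D :=
      distinguished_of_iso T e.symm (Iso.refl _) e'.symm (by simp) (by simp) (by simp)
    have hp : hallTerm (charFn Q₁) (charFn Q₂) L p = 1 := by
      rw [hallTerm, hallNumber_eq_one hfin T' (hQ _ _ hM' hN'), charFn_eq_one hM',
        charFn_eq_one hN', one_mul, one_mul]
    rw [hallMul, finsum_eq_single _ p, hp]
    intro q hq
    by_contra hc
    exact hq (eq_of_hallTerm_ne_zero hQ hc (hp.trans_ne one_ne_zero))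
  · have : charFn (Extn Q₁ Q₂) L = 0 := if_neg h
    rw [this, hallMul]
    refine finsum_eq_zero_of_forall_eq_zero fun p => ?_
    by_contra hc
    obtain ⟨h1, h2, a, f, g, T⟩ := exists_triangle_of_hallTerm_ne_zero hc
    exact h ⟨_, _, a, f, g, h1, h2, T⟩

end

/-! ### Iterated extensions -/

/-- The iterated extensions `Q₁ * (Q₂ * (⋯ * 0))`. -/
def IterExtn : List (ObjectProperty D) → ObjectProperty D
  | [] => fun X => IsZero X
  | Q :: l => Extn Q (IterExtn l)

namespace IterExtn

lemma isoClosed : ∀ l : List (ObjectProperty D), IsoClosed (IterExtn l)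
  | [] => fun _ _ e h => h.of_iso e.symm
  | _ :: _ => Extn.isoClosed _ _

lemma homNonpos {A : D} : ∀ {l : List (ObjectProperty D)},
    (∀ Q ∈ l, ∀ B, Q B → HomNonpos A B) → ∀ B, IterExtn l B → HomNonpos A B
  | [], _, _, hB => fun n _ _ => IsZero.eq_of_tgt ((shiftFunctor D n).map_isZero hB) _ _
  | Q :: _, h, _, ⟨M, N, _, _, _, hM, hN, T⟩ =>
    HomNonpos.ext_right T (h Q List.mem_cons_self M hM)
      (homNonpos (fun Q' hQ' => h Q' (List.mem_cons_of_mem _ hQ')) N hN)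

lemma triangle_id_left (X : D) {O : D} (hO : IsZero O) :
    Triangle.mk (𝟙 X) (0 : X ⟶ O) 0 ∈ distTriang D :=
  (Triangle.distinguished_iff_of_isZero₃ _ hO).2 (inferInstanceAs (IsIso (𝟙 X)))

lemma triangle_id_right (X : D) {O : D} (hO : IsZero O) :
    Triangle.mk (0 : O ⟶ X) (𝟙 X) 0 ∈ distTriang D :=
  (Triangle.distinguished_iff_of_isZero₁ _ hO).2 (inferInstanceAs (IsIso (𝟙 X)))

/-- Additional classes contribute the zero object. This is why coefficients of finite subproducts
stay constant once they equal 1. -/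
lemma mono {l₁ l₂ : List (ObjectProperty D)} (hl : l₁.Sublist l₂)
    (h : ∀ Q ∈ l₂, ∀ X, IsZero X → Q X) {X : D} (hX : IterExtn l₁ X) : IterExtn l₂ X := by
  induction hl generalizing X with
  | slnil => exact hX
  | cons Q _ ih =>
    obtain ⟨O, hO⟩ := HasZeroObject.zero (C := D)
    exact ⟨O, X, _, _, _, h Q List.mem_cons_self O hO,
      ih (fun Q' hQ' => h Q' (List.mem_cons_of_mem _ hQ')) hX, triangle_id_right X hO⟩
  | cons_cons Q _ ih =>
    obtain ⟨M, N, a, f, g, hM, hN, T⟩ := hX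
    exact ⟨M, N, a, f, g, hM, ih (fun Q' hQ' => h Q' (List.mem_cons_of_mem _ hQ')) hN, T⟩

/-- A product of two objects is isomorphic to their biproduct. -/
noncomputable def piBoolIso (X : Bool → D) [HasProduct X] : ∏ᶜ X ≅ X false ⊞ X true where
  hom := biprod.lift (Pi.π X false) (Pi.π X true)
  inv := Pi.lift fun b => match b with
    | false => biprod.fst
    | true => biprod.snd
  hom_inv_id := by
    ext b
    cases b <;> simp
  inv_hom_id := by ext <;> simp

lemma biprod_triangle {X Y Z X' Y' Z' : D} {f : X ⟶ Y} {g : Y ⟶ Z} {h : Z ⟶ X⟦(1 : ℤ)⟧}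
    {f' : X' ⟶ Y'} {g' : Y' ⟶ Z'} {h' : Z' ⟶ X'⟦(1 : ℤ)⟧} (T : Triangle.mk f g h ∈ distTriang D)
    (T' : Triangle.mk f' g' h' ∈ distTriang D) :
    ∃ (a : X ⊞ X' ⟶ Y ⊞ Y') (b : Y ⊞ Y' ⟶ Z ⊞ Z') (c : Z ⊞ Z' ⟶ (X ⊞ X')⟦(1 : ℤ)⟧),
      Triangle.mk a b c ∈ distTriang D := by
  let F : Bool → Triangle D := fun b => cond b (Triangle.mk f' g' h') (Triangle.mk f g h)
  have hF := productTriangle_distinguished F (fun b => by cases b; exacts [T, T'])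
  let e₁ := piBoolIso fun b => (F b).obj₁
  let e₂ := piBoolIso fun b => (F b).obj₂
  let e₃ := piBoolIso fun b => (F b).obj₃
  exact ⟨e₁.inv ≫ (productTriangle F).mor₁ ≫ e₂.hom, e₂.inv ≫ (productTriangle F).mor₂ ≫ e₃.hom,
    e₃.inv ≫ (productTriangle F).mor₃ ≫ e₁.hom⟦(1 : ℤ)⟧',
    distinguished_of_iso (f := (productTriangle F).mor₁) (g := (productTriangle F).mor₂)
      (h := (productTriangle F).mor₃) hF e₁ e₂ e₃
      (e₁.hom_inv_id_assoc _).symm (e₂.hom_inv_id_assoc _).symm (e₃.hom_inv_id_assoc _).symm⟩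

lemma biprod : ∀ {l : List (ObjectProperty D)},
    (∀ Q ∈ l, ∀ X Y, Q X → Q Y → Q (X ⊞ Y)) → ∀ {X Y : D}, IterExtn l X → IterExtn l Y →
      IterExtn l (X ⊞ Y)
  | [], _, _, _, hX, hY => biprod_isZero_iff _ _ |>.2 ⟨hX, hY⟩
  | Q :: l, h, _, _, ⟨M, N, a, f, g, hM, hN, T⟩, ⟨M', N', a', f', g', hM', hN', T'⟩ => by
    obtain ⟨_, _, _, T''⟩ := biprod_triangle T T'
    exact ⟨_, _, _, _, _, h Q List.mem_cons_self _ _ hM hM',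
      biprod (fun Q' hQ' => h Q' (List.mem_cons_of_mem _ hQ')) hN hN', T''⟩

end IterExtn

lemma hallProd_map_charFn (hfin : ∀ X Y : D, Finite (X ⟶ Y)) :
    ∀ l : List (ObjectProperty D), (∀ Q ∈ l, IsoClosed Q) →
      l.Pairwise (fun Q₁ Q₂ => ∀ A B, Q₁ A → Q₂ B → HomNonpos A B) →
      HallProdDefined (l.map charFn) ∧ hallProd (l.map charFn) = charFn (IterExtn l)
  | [], _, _ => ⟨trivial, rfl⟩
  | Q :: l, hi, hp => by
    obtain ⟨h1, h2⟩ := hallProd_map_charFn hfin l (fun Q' hQ' => hi Q' (List.mem_cons_of_mem _ hQ'))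
      (List.pairwise_cons.1 hp).2
    have hQ : ∀ A B, Q A → IterExtn l B → HomNonpos A B := fun A B hA hB =>
      IterExtn.homNonpos (fun Q' hQ' B' hB' => (List.pairwise_cons.1 hp).1 Q' hQ' A B' hA hB') B hB
    have h3 : hallProd ((Q :: l).map charFn) = hallMul (charFn Q) (hallProd (l.map charFn)) := rfl
    refine ⟨⟨?_, h1⟩, ?_⟩
    · rw [h2]
      exact hallDefined_charFn hQ
    · rw [h3, h2, hallMul_charFn hfin (hi Q List.mem_cons_self) (IterExtn.isoClosed l) hQ]
      rfl

/-- An ordered family of classes of objects without nonpositive morphisms, such that every object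
is an iterated extension of objects of these classes, has ordered product `1`. -/
lemma hasOrderedProd_charFn (hfin : ∀ X Y : D, Finite (X ⟶ Y)) {ι : Type*} [LinearOrder ι]
    (Q : ι → ObjectProperty D) (hi : ∀ a, IsoClosed (Q a)) (hz : ∀ a X, IsZero X → Q a X)
    (hQ : ∀ a b, a < b → ∀ A B, Q a A → Q b B → HomNonpos A B)
    (hex : ∀ L, ∃ s : Finset ι, IterExtn ((s.sort (· ≤ ·)).map Q) L) :
    HasOrderedProd (fun a => charFn (Q a)) fun _ => 1 := by
  have key : ∀ s : Finset ι, _ := fun s =>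
    hallProd_map_charFn hfin ((s.sort (· ≤ ·)).map Q)
      (fun Q' hQ' => by obtain ⟨a, -, rfl⟩ := List.mem_map.1 hQ'; exact hi a)
      (List.pairwise_map.2 (s.sortedLT_sort.pairwise.imp fun h => hQ _ _ h))
  have hmap : ∀ s : Finset ι, (s.sort (· ≤ ·)).map (fun a => charFn (Q a)) =
      ((s.sort (· ≤ ·)).map Q).map charFn := fun s => by rw [List.map_map]; rfl
  refine ⟨fun s => hmap s ▸ (key s).1, fun L => ?_⟩
  obtain ⟨s₀, hs₀⟩ := hex L.out
  filter_upwards [Filter.eventually_ge_atTop s₀] with s hs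
  rw [hmap, (key s).2]
  refine charFn_eq_one (IterExtn.mono (List.Sublist.map Q ?_) (fun Q' hQ' => ?_) hs₀)
  · refine List.sublist_of_subperm_of_sortedLE ?_ s₀.sortedLT_sort.sortedLE s.sortedLT_sort.sortedLE
    exact (s₀.sort_nodup _).subperm fun a ha => (Finset.mem_sort _).2 (hs ((Finset.mem_sort _).1 ha))
  · obtain ⟨a, -, rfl⟩ := List.mem_map.1 hQ'
    exact hz a

/-- Iterated extensions over a fixed index set are closed under direct sums, and index sets may be
enlarged to a common union; only the summands of `L` need a decomposition. -/
lemma exists_iterExtn {ι : Type*} [LinearOrder ι] {Q : ι → ObjectProperty D}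
    (hz : ∀ a X, IsZero X → Q a X) (hadd : ∀ a X Y, Q a X → Q a Y → Q a (X ⊞ Y))
    {R : ObjectProperty D} (hR : ∀ X, R X → ∃ s : Finset ι, IterExtn ((s.sort (· ≤ ·)).map Q) X)
    {L : D} (hL : SumOf R L) : ∃ s : Finset ι, IterExtn ((s.sort (· ≤ ·)).map Q) L := by
  classical
  have hmono : ∀ {s t : Finset ι}, s ⊆ t → ∀ {X}, IterExtn ((s.sort (· ≤ ·)).map Q) X →
      IterExtn ((t.sort (· ≤ ·)).map Q) X := fun {s t} hst {X} hX => by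
    refine IterExtn.mono (List.Sublist.map Q ?_) (fun Q' hQ' => ?_) hX
    · refine List.sublist_of_subperm_of_sortedLE ?_ s.sortedLT_sort.sortedLE t.sortedLT_sort.sortedLE
      exact (s.sort_nodup _).subperm fun a ha =>
        (Finset.mem_sort _).2 (hst ((Finset.mem_sort _).1 ha))
    · obtain ⟨a, -, rfl⟩ := List.mem_map.1 hQ'
      exact hz a
  refine hL.ind ?_ hR ?_ ?_
  · refine fun X hX => ⟨∅, ?_⟩
    rw [Finset.sort_empty]
    exact hX
  · exact fun X Y e ⟨s, hs⟩ => ⟨s, IterExtn.isoClosed _ _ _ e.symm hs⟩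
  · refine fun X Y ⟨s, hs⟩ ⟨t, ht⟩ => ⟨s ∪ t, ?_⟩
    refine IterExtn.biprod (fun Q' hQ' => ?_) (hmono Finset.subset_union_left hs)
      (hmono Finset.subset_union_right ht)
    obtain ⟨a, -, rfl⟩ := List.mem_map.1 hQ'
    exact hadd a

lemma iterExtn_single {ι : Type*} [LinearOrder ι] {Q : ι → ObjectProperty D} {a : ι} {X : D}
    (h : Q a X) : ∃ s : Finset ι, IterExtn ((s.sort (· ≤ ·)).map Q) X := by
  obtain ⟨O, hO⟩ := HasZeroObject.zero (C := D)
  refine ⟨{a}, ?_⟩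
  rw [Finset.sort_singleton]
  exact ⟨X, O, _, _, _, h, hO, IterExtn.triangle_id_left X hO⟩

lemma iterExtn_pair {ι : Type*} [LinearOrder ι] {Q : ι → ObjectProperty D} {a b : ι} (hab : a < b)
    {X Y Z : D} (hX : Q a X) (hZ : Q b Z) {f : X ⟶ Y} {g : Y ⟶ Z} {h : Z ⟶ X⟦(1 : ℤ)⟧}
    (T : Triangle.mk f g h ∈ distTriang D) :
    ∃ s : Finset ι, IterExtn ((s.sort (· ≤ ·)).map Q) Y := by
  classical
  obtain ⟨O, hO⟩ := HasZeroObject.zero (C := D)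
  refine ⟨insert a {b}, ?_⟩
  rw [Finset.sort_insert (· ≤ ·) (by simpa using hab.le) (by simpa using hab.ne),
    Finset.sort_singleton]
  exact ⟨X, Z, f, g, h, hX, ⟨Z, O, _, _, _, hZ, hO, IterExtn.triangle_id_left Z hO⟩, T⟩

end Extensions

/-! ### The wall-crossing formula for a helix -/

namespace IsA2Helix

variable {k : Type*} [Field k] {D : Type u} [Category.{v} D] [Preadditive D]
  [HasZeroObject D] [HasShift D ℤ] [∀ n : ℤ, (shiftFunctor D n).Additive] [Pretriangulated D]
  [Linear k D] {E : ℤ → D} (hE : IsA2Helix k E)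

lemma sumOf_finite {Q R : ObjectProperty D} (h : ∀ X Y, Q X → R Y → Finite (X ⟶ Y)) {M N : D}
    (hM : SumOf Q M) (hN : SumOf R N) : Finite (M ⟶ N) := by
  have h1 : ∀ X, Q X → Finite (X ⟶ N) := fun X hX =>
    hN.ind (R := fun N => Finite (X ⟶ N))
      (fun Z hZ => @Finite.of_subsingleton _ ⟨fun _ _ => hZ.eq_of_tgt _ _⟩)
      (fun Y => h X Y hX) (fun Y Z e _ => Finite.of_injective (fun f : X ⟶ Y => f ≫ e.hom)
        fun _ _ => (cancel_mono e.hom).1)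
      (fun Y Z _ _ => Finite.of_injective
        (fun f : X ⟶ Y ⊞ Z => (f ≫ biprod.fst, f ≫ biprod.snd))
        fun f g hfg => biprod.hom_ext _ _ (congrArg Prod.fst hfg) (congrArg Prod.snd hfg))
  exact hM.ind (R := fun M => Finite (M ⟶ N))
    (fun Z hZ => @Finite.of_subsingleton _ ⟨fun _ _ => hZ.eq_of_src _ _⟩) h1
    (fun Y Z e _ => Finite.of_injective (fun f : Y ⟶ N => e.inv ≫ f)
      fun _ _ => (cancel_epi e.inv).1)
    (fun Y Z _ _ => Finite.of_injective
      (fun f : Y ⊞ Z ⟶ N => (biprod.inl ≫ f, biprod.inr ≫ f))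
      fun f g hfg => biprod.hom_ext' _ _ (congrArg Prod.fst hfg) (congrArg Prod.snd hfg))

include hE

/-- `Hom(E i, E (i + 2)) = 0`, so every such map factors through `f` by an endomorphism of `E i`,
which is a scalar. -/
lemma exists_comp_eq {i : ℤ} {f : E i ⟶ E (i + 1)} {g : E (i + 1) ⟶ E (i + 2)}
    {h : E (i + 2) ⟶ (E i)⟦(1 : ℤ)⟧} (T : Triangle.mk f g h ∈ distTriang D)
    (x : E i ⟶ E (i + 1)) : ∃ c : k, x = c • f := by
  obtain ⟨y, hy⟩ : ∃ y : E i ⟶ E i, x = y ≫ f :=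
    Triangle.coyoneda_exact₂ _ T x (hE.hom_eq_zero _ _ (by omega) (by omega) _)
  obtain ⟨c, rfl⟩ := hE.end_scalar i y
  exact ⟨c, by rw [hy, Linear.smul_comp, Category.id_comp]⟩

lemma finite_hom [Finite k] (X Y : D) : Finite (X ⟶ Y) := by
  refine sumOf_finite ?_ (hE.sumOf X) (hE.sumOf Y)
  rintro _ _ ⟨i, rfl⟩ ⟨j, rfl⟩
  by_cases hi : j = i
  · subst hi
    exact Finite.of_surjective (fun c : k => c • 𝟙 (E j)) fun f =>
      (hE.end_scalar j f).imp fun _ h => h.symm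
  by_cases hi' : j = i + 1
  · subst hi'
    obtain ⟨f, g, h, T⟩ := hE.triangle i
    exact Finite.of_surjective (fun c : k => c • f) fun x =>
      (hE.exists_comp_eq T x).imp fun _ h => h.symm
  · exact @Finite.of_subsingleton _ ⟨fun f g =>
      (hE.hom_eq_zero i j hi hi' f).trans (hE.hom_eq_zero i j hi hi' g).symm⟩

/-- It is enough to decompose the helix terms. A term in none of the classes is the middle of the
triangle on its neighbours, which must then occur in the correct order. -/
lemma hasOrderedProd [Finite k] {ι : Type*} [LinearOrder ι] (Q : ι → ObjectProperty D)
    (hi : ∀ a, IsoClosed (Q a)) (hz : ∀ a X, IsZero X → Q a X)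
    (hadd : ∀ a X Y, Q a X → Q a Y → Q a (X ⊞ Y))
    (hQ : ∀ a b, a < b → ∀ A B, Q a A → Q b B → HomNonpos A B)
    (hex : ∀ i, (∃ a, Q a (E i)) ∨ ∃ a b, a < b ∧ Q a (E (i - 1)) ∧ Q b (E (i + 1))) :
    HasOrderedProd (fun a => charFn (Q a)) fun _ => 1 := by
  refine hasOrderedProd_charFn hE.finite_hom Q hi hz hQ fun L =>
    exists_iterExtn hz hadd ?_ (hE.sumOf L)
  rintro _ ⟨i, rfl⟩
  rcases hex i with ⟨a, ha⟩ | ⟨a, b, hab, ha, hb⟩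
  · exact iterExtn_single ha
  · obtain ⟨j, rfl⟩ : ∃ j, i = j + 1 := ⟨i - 1, by ring⟩
    obtain ⟨f, g, h, T⟩ := hE.triangle j
    rw [add_sub_cancel_right] at ha
    rw [add_assoc] at hb
    exact iterExtn_pair hab ha hb T

end IsA2Helix


/-! ### The combinatorics of phases -/

/-- The constraints on the set `ss` of indices of semistable objects of a helix and on their
phases. -/
structure PhaseData (ss : Set ℤ) (ph : ℤ → ℝ) : Prop where
  mem_shift : ∀ i, i + 3 ∈ ss ↔ i ∈ ss
  ph_shift : ∀ i, ph (i + 3) = ph i + 1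
  le : ∀ i, i ∈ ss → i + 1 ∈ ss → ph i ≤ ph (i + 1)
  mem_pred : ∀ i, i ∉ ss → i - 1 ∈ ss
  mem_succ : ∀ i, i ∉ ss → i + 1 ∈ ss
  gt : ∀ i, i ∉ ss → ph (i + 1) < ph (i - 1)

/-- The shapes of hearts: the heart is generated by `E b` and `(E (b + 2))⟦n + 1⟧`, by `E b` and
`(E (b + 2))⟦n⟧`, or by `E b`, `E (b + 1)`, `E (b + 2)`. -/
inductive HeartType
  | le (n : ℕ)
  | gt (n : ℕ)
  | all

/-- The phases are as prescribed by a heart type with base `b`. -/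
def HeartType.Holds (ss : Set ℤ) (ph : ℤ → ℝ) (b : ℤ) : HeartType → Prop
  | le n => b + 1 ∉ ss ∧ 0 < ph b ∧ ph b ≤ ph (b + 2) + n + 1 ∧ ph (b + 2) + n + 1 ≤ 1
  | gt n => b + 1 ∉ ss ∧ 0 < ph (b + 2) + n ∧ ph (b + 2) + n < ph b ∧ ph b ≤ 1
  | all => (∀ i, i ∈ ss) ∧ 0 < ph b ∧ ph (b + 2) ≤ 1

/-- The indices of the indecomposable objects of the heart. -/
def HeartType.gens (b : ℤ) : HeartType → Set ℤ
  | le n => {b, b + 2 + 3 * (n + 1)}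
  | gt 0 => {b, b + 1, b + 2}
  | gt (n + 1) => {b, b + 2 + 3 * (n + 1)}
  | all => {b, b + 1, b + 2}

namespace PhaseData

variable {ss : Set ℤ} {ph : ℤ → ℝ} (d : PhaseData ss ph)
include d

lemma mem_add_mul (i m : ℤ) : i + 3 * m ∈ ss ↔ i ∈ ss := by
  induction m using Int.induction_on with
  | zero => rw [mul_zero, add_zero]
  | succ m ih => rw [← ih, show i + 3 * ((m : ℤ) + 1) = i + 3 * m + 3 by ring, d.mem_shift]
  | pred m ih =>
    rw [← ih, show i + 3 * (-(m : ℤ)) = i + 3 * (-(m : ℤ) - 1) + 3 by ring, d.mem_shift]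

lemma ph_add_mul (i m : ℤ) : ph (i + 3 * m) = ph i + m := by
  induction m using Int.induction_on with
  | zero => rw [mul_zero, add_zero, Int.cast_zero, add_zero]
  | succ m ih =>
    rw [show i + 3 * ((m : ℤ) + 1) = i + 3 * m + 3 by ring, d.ph_shift, ih]
    push_cast
    ring
  | pred m ih =>
    have := d.ph_shift (i + 3 * (-(m : ℤ) - 1))
    rw [show i + 3 * (-(m : ℤ) - 1) + 3 = i + 3 * (-(m : ℤ)) by ring, ih] at this
    push_cast at this ⊢
    linarith

lemma shift (m : ℤ) : PhaseData ss (fun i => ph i - m) where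
  mem_shift := d.mem_shift
  ph_shift i := by rw [d.ph_shift]; ring
  le i h h' := sub_le_sub_right (d.le i h h') _
  mem_pred := d.mem_pred
  mem_succ := d.mem_succ
  gt i h := sub_lt_sub_right (d.gt i h) _

lemma holds_shift_iff (m b : ℤ) (t : HeartType) :
    t.Holds ss (fun i => ph i - m) b ↔ t.Holds ss ph (b - 3 * m) := by
  have h1 : b - 3 * m + 1 ∈ ss ↔ b + 1 ∈ ss := by
    rw [← d.mem_add_mul _ m]
    ring_nf
  have h0 : ph (b - 3 * m) = ph b - m := by
    have := d.ph_add_mul (b - 3 * m) m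
    rw [sub_add_cancel] at this
    linarith
  have h2 : ph (b - 3 * m + 2) = ph (b + 2) - m := by
    have := d.ph_add_mul (b - 3 * m + 2) m
    rw [show b - 3 * m + 2 + 3 * m = b + 2 by ring] at this
    linarith
  cases t <;> simp only [HeartType.Holds, h0, h1, h2]

lemma exists_holds : ∃ b t, HeartType.Holds ss ph b t := by
  by_cases hall : ∀ i, i ∈ ss
  · have hmono : Monotone ph := monotone_int_of_le_succ fun i => d.le i (hall _) (hall _)
    -- When everything is semistable, phases increase along the helix and `b` is the first index of
    -- positive phase. Then `ph (b - 1) ≤ 0` gives `ph (b + 2) ≤ 1`. The two bounding indices are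
    -- shifts of 0 with phase ≤ 0 and > 0.
    obtain ⟨b, hb, hmin⟩ := Int.exists_least_of_bdd (P := fun i => 0 < ph i)
      ⟨3 * (-⌈ph 0⌉), fun z hz => by
        by_contra! hc
        have h1 : ph z ≤ ph (0 + 3 * (-⌈ph 0⌉)) := hmono (by omega)
        rw [d.ph_add_mul] at h1
        push_cast at h1
        linarith [Int.le_ceil (ph 0)]⟩
      ⟨0 + 3 * (1 - ⌊ph 0⌋), by
        rw [d.ph_add_mul]
        push_cast
        linarith [Int.floor_le (ph 0)]⟩
    refine ⟨b, .all, hall, hb, ?_⟩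
    have h1 : ¬ 0 < ph (b - 1) := fun h => by
      have := hmin _ h
      omega
    have h2 := d.ph_shift (b - 1)
    rw [show b - 1 + 3 = b + 2 by ring] at h2
    linarith
  · push Not at hall
    obtain ⟨i, hi⟩ := hall
    obtain ⟨b, hb, h0, h1⟩ : ∃ b, b + 1 ∉ ss ∧ 0 < ph b ∧ ph b ≤ 1 := by
      -- The shift by `1 - ⌈ph (i - 1)⌉` is the one that moves the phase of the predecessor of the
      -- missing index into (0, 1].
      refine ⟨i - 1 + 3 * (1 - ⌈ph (i - 1)⌉), ?_, ?_, ?_⟩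
      · rw [show i - 1 + 3 * (1 - ⌈ph (i - 1)⌉) + 1 = i + 3 * (1 - ⌈ph (i - 1)⌉) by ring,
          d.mem_add_mul]
        exact hi
      · rw [d.ph_add_mul]
        push_cast
        linarith [Int.ceil_lt_add_one (ph (i - 1))]
      · rw [d.ph_add_mul]
        push_cast
        linarith [Int.le_ceil (ph (i - 1))]
    have hgt := d.gt (b + 1) hb
    rw [add_sub_cancel_right, add_assoc, one_add_one_eq_two] at hgt
    -- The integer `n = 1 - ⌈ph (b + 2)⌉` moves the other semistable phase into (0, 1]; it is
    -- nonnegative because `ph (b + 2) < ph b ≤ 1`. Comparison with `ph b` selects the type, and for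
    -- `n = 0` only `gt` is possible.
    have hc : ⌈ph (b + 2)⌉ ≤ 1 := Int.ceil_le.2 (by push_cast; linarith)
    obtain ⟨n, hn⟩ := Int.eq_ofNat_of_zero_le (sub_nonneg.2 hc)
    have hn' : (n : ℝ) = 1 - (⌈ph (b + 2)⌉ : ℝ) := by
      have : ((n : ℤ) : ℝ) = ((1 - ⌈ph (b + 2)⌉ : ℤ) : ℝ) := by rw [hn]
      push_cast at this
      exact this
    have h2 := Int.ceil_lt_add_one (ph (b + 2))
    have h3 := Int.le_ceil (ph (b + 2))
    by_cases hlt : ph (b + 2) + n < ph b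
    · exact ⟨b, .gt n, hb, by linarith, hlt, h1⟩
    · cases n with
      | zero => exact absurd hgt (by simpa using hlt)
      | succ n =>
        push_cast at hlt hn'
        exact ⟨b, .le n, hb, h0, by linarith, by linarith⟩

lemma ph_pos {b : ℤ} {t : HeartType} (h : t.Holds ss ph b) : 0 < ph b := by
  cases t with
  | le n => exact h.2.1
  | gt n => exact h.2.1.trans h.2.2.1
  | all => exact h.2.1

lemma ph_le_one {b : ℤ} {t : HeartType} (h : t.Holds ss ph b) : ph b ≤ 1 := by
  cases t with
  | le n => exact h.2.2.1.trans h.2.2.2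
  | gt n => exact h.2.2.2
  | all =>
    have h1 := d.le b (h.1 _) (h.1 _)
    have h2 := d.le (b + 1) (h.1 _) (h.1 _)
    rw [add_assoc, one_add_one_eq_two] at h2
    linarith [h.2.2]

lemma mem_of_holds {b : ℤ} {t : HeartType} (h : t.Holds ss ph b) :
    b ∈ ss ∧ b + 2 ∈ ss := by
  have key : b + 1 ∉ ss → b ∈ ss ∧ b + 2 ∈ ss := fun hb => by
    have h1 := d.mem_pred _ hb
    have h2 := d.mem_succ _ hb
    rw [add_sub_cancel_right] at h1
    rw [add_assoc] at h2
    exact ⟨h1, h2⟩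
  cases t with
  | le n => exact key h.1
  | gt n => exact key h.1
  | all => exact ⟨h.1 _, h.1 _⟩

/-- Both neighbours of a missing index are present, so the missing indices lie in a single class
modulo 3. -/
lemma sub_eq_mul_of_not_mem {i j : ℤ} (hi : i ∉ ss) (hj : j ∉ ss) : ∃ m, j = i + 3 * m := by
  have h : (j - i) % 3 = 0 ∨ (j - i) % 3 = 1 ∨ (j - i) % 3 = 2 := by omega
  rcases h with h | h | h
  · exact ⟨(j - i) / 3, by omega⟩
  · refine absurd ?_ hj
    rw [show j = i + 1 + 3 * ((j - i) / 3) by omega, d.mem_add_mul]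
    exact d.mem_succ i hi
  · refine absurd ?_ hj
    rw [show j = i - 1 + 3 * ((j - i) / 3 + 1) by omega, d.mem_add_mul]
    exact d.mem_pred i hi

lemma base_unique_of_not_mem {b b' : ℤ} {t t' : HeartType} (h : t.Holds ss ph b)
    (h' : t'.Holds ss ph b') (hb : b + 1 ∉ ss) (hb' : b' + 1 ∉ ss) : b = b' := by
  obtain ⟨m, hm⟩ := d.sub_eq_mul_of_not_mem hb hb'
  obtain rfl : b' = b + 3 * m := by omega
  have h1 := d.ph_pos h'
  have h2 := d.ph_le_one h'
  rw [d.ph_add_mul] at h1 h2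
  have h3 : (-1 : ℝ) < m := by linarith [d.ph_le_one h]
  have h4 : (m : ℝ) < 1 := by linarith [d.ph_pos h]
  have h3' : -1 < m := by exact_mod_cast h3
  have h4' : m < 1 := by exact_mod_cast h4
  omega

lemma all_lt {b b' : ℤ} (h : HeartType.all.Holds ss ph b) (h' : HeartType.all.Holds ss ph b') :
    b ≤ b' := by
  by_contra! hlt
  have hmono : Monotone ph := monotone_int_of_le_succ fun i => d.le i (h.1 _) (h.1 _)
  have h1 := d.ph_shift b'
  have h2 : ph (b' + 3) ≤ ph (b + 2) := hmono (by omega)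
  linarith [h'.2.1, h.2.2]

lemma holds_unique {b b' : ℤ} {t t' : HeartType} (h : t.Holds ss ph b)
    (h' : t'.Holds ss ph b') : b = b' ∧ t = t' := by
  -- Only one integer translate of a real number lies in (0, 1]. In the mixed cases this identifies
  -- the parameters of `le` and `gt` up to one, after which the two phase inequalities contradict
  -- each other.
  have hnat : ∀ {x : ℝ} {n m : ℕ}, 0 < x + n → x + n ≤ 1 → 0 < x + m → x + m ≤ 1 → n = m := by
    intro x n m h1 h2 h3 h4
    have h5 : (n : ℝ) < m + 1 := by linarith
    have h6 : (m : ℝ) < n + 1 := by linarith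
    have h5' : n < m + 1 := by exact_mod_cast h5
    have h6' : m < n + 1 := by exact_mod_cast h6
    omega
  cases t with
  | le n =>
    cases t' with
    | le n' =>
      obtain rfl := d.base_unique_of_not_mem h h' h.1 h'.1
      obtain ⟨_, h1, h2, h3⟩ := h
      obtain ⟨_, h1', h2', h3'⟩ := h'
      have := hnat (x := ph (b + 2) + 1) (n := n) (m := n') (by linarith) (by linarith)
        (by linarith) (by linarith)
      exact ⟨rfl, this ▸ rfl⟩
    | gt n' =>
      obtain rfl := d.base_unique_of_not_mem h h' h.1 h'.1
      obtain ⟨_, h1, h2, h3⟩ := h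
      obtain ⟨_, h1', h2', h3'⟩ := h'
      have := hnat (x := ph (b + 2)) (n := n + 1) (m := n') (by push_cast; linarith)
        (by push_cast; linarith) (by linarith) (by linarith)
      subst this
      push_cast at h2'
      linarith
    | all => exact absurd (h'.1 _) h.1
  | gt n =>
    cases t' with
    | le n' =>
      obtain rfl := d.base_unique_of_not_mem h h' h.1 h'.1
      obtain ⟨_, h1, h2, h3⟩ := h
      obtain ⟨_, h1', h2', h3'⟩ := h'
      have := hnat (x := ph (b + 2)) (n := n) (m := n' + 1) (by linarith) (by linarith)
        (by push_cast; linarith) (by push_cast; linarith)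
      subst this
      push_cast at h2
      linarith
    | gt n' =>
      obtain rfl := d.base_unique_of_not_mem h h' h.1 h'.1
      obtain ⟨_, h1, h2, h3⟩ := h
      obtain ⟨_, h1', h2', h3'⟩ := h'
      have := hnat (x := ph (b + 2)) (n := n) (m := n') (by linarith) (by linarith)
        (by linarith) (by linarith)
      exact ⟨rfl, this ▸ rfl⟩
    | all => exact absurd (h'.1 _) h.1
  | all =>
    cases t' with
    | le n' => exact absurd (h.1 _) h'.1
    | gt n' => exact absurd (h.1 _) h'.1
    | all => exact ⟨le_antisymm (d.all_lt h h') (d.all_lt h' h), rfl⟩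

end PhaseData

/-! ### Semistable objects of a helix -/

namespace IsA2Helix

variable {k : Type*} [Field k] {D : Type u} [Category.{v} D] [Preadditive D]
  [HasZeroObject D] [HasShift D ℤ] [∀ n : ℤ, (shiftFunctor D n).Additive] [Pretriangulated D]
  [Linear k D] {E : ℤ → D} (hE : IsA2Helix k E)

include hE

/-- If `f` vanished, the identity of `E (i + 1)` would factor through a map `E (i + 2) ⟶ E (i + 1)`,
which is zero. -/
lemma map_ne_zero {i : ℤ} {f : E i ⟶ E (i + 1)} {g : E (i + 1) ⟶ E (i + 2)}
    {h : E (i + 2) ⟶ (E i)⟦(1 : ℤ)⟧} (T : Triangle.mk f g h ∈ distTriang D) : f ≠ 0 := by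
  rintro rfl
  obtain ⟨y, hy⟩ : ∃ y : E (i + 2) ⟶ E (i + 1), 𝟙 _ = g ≫ y :=
    Triangle.yoneda_exact₂ _ T (𝟙 (E (i + 1))) zero_comp
  refine hE.not_isZero (i + 1) ((IsZero.iff_id_eq_zero _).2 ?_)
  rw [hy, hE.hom_eq_zero (i + 2) (i + 1) (by omega) (by omega) y, comp_zero]

lemma exists_hom_ne_zero (i : ℤ) : ∃ f : E i ⟶ E (i + 1), f ≠ 0 := by
  obtain ⟨f, g, h, T⟩ := hE.triangle i
  exact ⟨f, hE.map_ne_zero T⟩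

/-- The only indecomposables with a nonzero map to `E i` are `E (i - 1)` and `E i`, and the only
ones receiving a nonzero map from it are `E i` and `E (i + 1)`. This determines the summands of the
extreme Harder-Narasimhan factors of a term that is not semistable. -/
lemma exists_phaseData (σ : StabilityCondition D) : ∃ (ss : Set ℤ) (ph : ℤ → ℝ), PhaseData ss ph ∧
    ∀ i φ, σ.P φ (E i) ↔ i ∈ ss ∧ ph i = φ := by
  classical
  have hsh : ∀ i φ, σ.P (φ + 1) (E (i + 3)) ↔ σ.P φ (E i) := fun i φ => by
    obtain ⟨e⟩ := hE.shift i
    rw [← σ.shift_iff φ]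
    exact ⟨σ.P_of_iso e.symm, σ.P_of_iso e⟩
  have hss : ∀ i, (∃ φ, σ.P φ (E (i + 3))) ↔ ∃ φ, σ.P φ (E i) := fun i =>
    ⟨fun ⟨φ, h⟩ => ⟨φ - 1, (hsh i _).1 (by rwa [sub_add_cancel])⟩,
      fun ⟨φ, h⟩ => ⟨φ + 1, (hsh i _).2 h⟩⟩
  -- The default `i / 3` at the remaining indices makes `ph (i + 3) = ph i + 1` hold without
  -- exception.
  let ph : ℤ → ℝ := fun i => if h : ∃ φ, σ.P φ (E i) then h.choose else (i : ℝ) / 3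
  have hph : ∀ i φ, σ.P φ (E i) → ph i = φ := fun i φ h => by
    have h' : ∃ φ, σ.P φ (E i) := ⟨φ, h⟩
    have : ph i = h'.choose := dif_pos h'
    rw [this]
    exact StabilityCondition.phase_unique (hE.not_isZero i) h'.choose_spec h
  have hmem : ∀ i, (∃ φ, σ.P φ (E i)) → σ.P (ph i) (E i) := fun i ⟨φ, h⟩ => by
    rwa [hph i φ h]
  have hns : ∀ i, (¬ ∃ φ, σ.P φ (E i)) → ∃ a b, b < a ∧ σ.P a (E (i - 1)) ∧ σ.P b (E (i + 1)) := by
    intro i hi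
    obtain ⟨F⟩ := σ.exists_HN (E i) (hE.not_isZero i)
    have hn : 0 < F.n := Nat.pos_of_ne_zero fun h => hE.not_isZero i (F.isZero_of_n_eq_zero h)
    let p : Fin F.n := ⟨0, hn⟩
    let q : Fin F.n := ⟨F.n - 1, by omega⟩
    obtain ⟨a, ha⟩ := StabilityCondition.exists_first F p rfl
    obtain ⟨b, hb⟩ := StabilityCondition.exists_last F q (Nat.sub_add_cancel hn)
    obtain ⟨_, ⟨j, rfl⟩, s, r, hsr⟩ := (hE.sumOf (F.A p)).exists_of_not_isZero (F.factor_ne_zero p)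
    obtain ⟨_, ⟨j', rfl⟩, s', r', hsr'⟩ :=
      (hE.sumOf (F.A q)).exists_of_not_isZero (F.factor_ne_zero q)
    have hj : σ.P (F.φ p) (E j) := σ.P_of_retract s r hsr (F.factor_mem p)
    have hj' : σ.P (F.φ q) (E j') := σ.P_of_retract s' r' hsr' (F.factor_mem q)
    have e : j = i - 1 := by
      by_contra hne
      refine hE.not_isZero j (ha _ s r hsr (hE.hom_eq_zero _ _ ?_ (by omega) _))
      rintro rfl
      exact hi ⟨_, hj⟩
    have e' : j' = i + 1 := by
      by_contra hne
      refine hE.not_isZero j' (hb _ s' r' hsr' (hE.hom_eq_zero _ _ ?_ (by omega) _))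
      rintro rfl
      exact hi ⟨_, hj'⟩
    subst e e'
    refine ⟨_, _, ?_, hj, hj'⟩
    -- If the extreme phases did not decrease, all factors would have the same phase and `E i`
    -- itself would lie in that slice.
    by_contra! hle
    refine hi ⟨F.φ p, F.mem_of_ext (σ.P (F.φ p)) (σ.zero_mem _) (σ.ext_closed _)
      (fun X Y => σ.P_of_iso) fun x => ?_⟩
    have h1 : F.φ x ≤ F.φ p := F.phase_anti.antitone (Nat.zero_le x.val)
    have h2 : F.φ q ≤ F.φ x := F.phase_anti.antitone (Nat.le_sub_one_of_lt x.2)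
    rw [le_antisymm (hle.trans h2) h1]
    exact F.factor_mem x
  refine ⟨{i | ∃ φ, σ.P φ (E i)}, ph, ⟨hss, ?_, ?_, ?_, ?_, ?_⟩, ?_⟩
  · intro i
    by_cases h : ∃ φ, σ.P φ (E i)
    · exact hph _ _ ((hsh _ _).2 (hmem i h))
    · have h1 : ph i = (i : ℝ) / 3 := dif_neg h
      have h2 : ph (i + 3) = ((i + 3 : ℤ) : ℝ) / 3 := dif_neg fun h' => h ((hss i).1 h')
      rw [h1, h2]
      push_cast
      ring
  · intro i h h'
    by_contra! hlt
    obtain ⟨f, hf⟩ := hE.exists_hom_ne_zero i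
    exact hf (σ.hom_eq_zero _ _ _ _ (hmem i h) (hmem _ h') hlt f)
  · intro i hi
    obtain ⟨a, b, -, h, -⟩ := hns i hi
    exact ⟨a, h⟩
  · intro i hi
    obtain ⟨a, b, -, -, h⟩ := hns i hi
    exact ⟨b, h⟩
  · intro i hi
    obtain ⟨a, b, hab, h, h'⟩ := hns i hi
    rwa [hph _ _ h, hph _ _ h']
  · exact fun i φ => ⟨fun h => ⟨⟨φ, h⟩, hph i φ h⟩, fun ⟨h, e⟩ => e ▸ hmem i h⟩

lemma heart_eq_sumOf (σ : StabilityCondition D) :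
    σ.heart = SumOf fun X => ∃ i, σ.heart (E i) ∧ X = E i := by
  funext M
  refine propext ⟨fun h => (hE.sumOf M).retracts ?_, fun h => ?_⟩
  · rintro _ s r hsr ⟨i, rfl⟩
    rw [σ.heart_iff] at h
    exact ⟨i, (σ.heart_iff _).2 (h.of_retract s r hsr), rfl⟩
  · rw [σ.heart_iff]
    refine Orth.sumOf (fun X => ?_) h
    rintro ⟨i, hi, rfl⟩
    rwa [← σ.heart_iff]

variable {σ : StabilityCondition D} {ss : Set ℤ} {ph : ℤ → ℝ} (d : PhaseData ss ph)
  (hσ : ∀ i φ, σ.P φ (E i) ↔ i ∈ ss ∧ ph i = φ)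
include d hσ

lemma heart_of_mem {i : ℤ} (hi : i ∈ ss) : σ.heart (E i) ↔ 0 < ph i ∧ ph i ≤ 1 := by
  have h := (hσ i _).2 ⟨hi, rfl⟩
  rw [σ.heart_iff]
  constructor
  · intro hO
    constructor
    · by_contra! hc
      exact hE.not_isZero i ((IsZero.iff_id_eq_zero _).2 (hO.2 _ hc _ h _))
    · by_contra! hc
      exact hE.not_isZero i ((IsZero.iff_id_eq_zero _).2 (hO.1 _ hc _ h _))
  · exact fun ⟨h0, h1⟩ =>
      ⟨fun ψ hψ A hA => σ.hom_eq_zero _ _ _ _ hA h (lt_of_le_of_lt h1 hψ),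
        fun ψ hψ B hB => σ.hom_eq_zero _ _ _ _ h hB (lt_of_le_of_lt hψ h0)⟩

/-- The nonzero maps `E (i - 1) ⟶ E i ⟶ E (i + 1)` force the two bounds. Conversely the bounds put
both neighbours in the heart, and `E i` is an extension of them. -/
lemma heart_of_not_mem {i : ℤ} (hi : i ∉ ss) :
    σ.heart (E i) ↔ 0 < ph (i + 1) ∧ ph (i - 1) ≤ 1 := by
  have h1 := (hσ _ _).2 ⟨d.mem_pred i hi, rfl⟩
  have h2 := (hσ _ _).2 ⟨d.mem_succ i hi, rfl⟩
  have h3 := d.gt i hi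
  constructor
  · rw [σ.heart_iff]
    intro hO
    constructor
    · by_contra! hc
      obtain ⟨f, hf⟩ := hE.exists_hom_ne_zero i
      exact hf (hO.2 _ hc _ h2 f)
    · by_contra! hc
      obtain ⟨j, rfl⟩ : ∃ j, i = j + 1 := ⟨i - 1, by ring⟩
      obtain ⟨f, hf⟩ := hE.exists_hom_ne_zero j
      rw [add_sub_cancel_right] at h1 hc
      exact hf (hO.1 _ hc _ h1 f)
  · rintro ⟨h0, h0'⟩
    have h4 := (hE.heart_of_mem d hσ (d.mem_pred i hi)).2 ⟨h0.trans h3, h0'⟩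
    have h5 := (hE.heart_of_mem d hσ (d.mem_succ i hi)).2 ⟨h0, h3.le.trans h0'⟩
    rw [σ.heart_iff] at h4 h5 ⊢
    obtain ⟨j, rfl⟩ : ∃ j, i = j + 1 := ⟨i - 1, by ring⟩
    obtain ⟨f, g, h, T⟩ := hE.triangle j
    rw [add_sub_cancel_right] at h4
    rw [add_assoc] at h5
    exact Orth.ext T h4 h5

/-- For a semistable residue of `i - b` exactly one shift has phase in (0, 1]. For the missing
residue the term `b + 1 + 3 * m` needs both neighbours in the heart: type `le n` would require `n <
m ≤ 0`, and type `gt n` requires `n ≤ m ≤ 0`. Thus a third generator appears only for `gt 0`. -/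
lemma heart_iff_mem_gens {b : ℤ} {t : HeartType} (h : t.Holds ss ph b) (i : ℤ) :
    σ.heart (E i) ↔ i ∈ t.gens b := by
  have key : ∀ {x : ℝ} {n m : ℤ}, 0 < x + n → x + n ≤ 1 → ((0 < x + m ∧ x + m ≤ 1) ↔ m = n) := by
    intro x n m h1 h2
    refine ⟨fun ⟨h3, h4⟩ => ?_, fun e => e ▸ ⟨h1, h2⟩⟩
    have h5 : (n : ℝ) < m + 1 := by linarith
    have h6 : (m : ℝ) < n + 1 := by linarith
    have h5' : n < m + 1 := by exact_mod_cast h5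
    have h6' : m < n + 1 := by exact_mod_cast h6
    omega
  have hb0 := d.ph_pos h
  have hb1 := d.ph_le_one h
  obtain ⟨r, m, hr, rfl⟩ : ∃ r m, (r = 0 ∨ r = 1 ∨ r = 2) ∧ i = b + r + 3 * m :=
    ⟨(i - b) % 3, (i - b) / 3, by omega, by omega⟩
  have hheart : b + r ∈ ss → (σ.heart (E (b + r + 3 * m)) ↔ 0 < ph (b + r) + m ∧ ph (b + r) + m ≤ 1) :=
    fun hm => by rw [hE.heart_of_mem d hσ ((d.mem_add_mul _ _).2 hm), d.ph_add_mul]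
  by_cases hall : b + 1 ∈ ss
  · have hall' : ∀ i, i ∈ ss := by
      cases t with
      | le n => exact absurd hall h.1
      | gt n => exact absurd hall h.1
      | all => exact h.1
    cases t with
    | le n => exact absurd hall h.1
    | gt n => exact absurd hall h.1
    | all =>
      have h1 := d.le b (hall' _) (hall' _)
      have h2 := d.le (b + 1) (hall' _) (hall' _)
      rw [add_assoc, one_add_one_eq_two] at h2
      have h3 := h.2.2
      rw [hheart (hall' _), key (n := 0)]
      · simp only [HeartType.gens, Set.mem_insert_iff, Set.mem_singleton_iff]
        omega
      · rw [Int.cast_zero, add_zero]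
        rcases hr with rfl | rfl | rfl
        · rwa [add_zero]
        · linarith
        · linarith
      · rw [Int.cast_zero, add_zero]
        rcases hr with rfl | rfl | rfl
        · rwa [add_zero]
        · linarith
        · linarith
  · have hmem0 : b ∈ ss := by
      have := d.mem_pred _ hall
      rwa [add_sub_cancel_right] at this
    have hmem2 : b + 2 ∈ ss := by
      have := d.mem_succ _ hall
      rwa [add_assoc] at this
    rcases hr with rfl | rfl | rfl
    · rw [hheart (by rwa [add_zero]), key (n := 0) (by simpa using hb0) (by simpa using hb1)]
      rcases t with n | (_ | n) | _ <;>
        simp only [HeartType.gens, Set.mem_insert_iff, Set.mem_singleton_iff] <;> omega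
    · have h1 : b + 1 + 3 * m ∉ ss := by rwa [d.mem_add_mul]
      rw [hE.heart_of_not_mem d hσ h1, show b + 1 + 3 * m + 1 = b + 2 + 3 * m by ring,
        show b + 1 + 3 * m - 1 = b + 3 * m by ring, d.ph_add_mul, d.ph_add_mul]
      have hm : ph b + m ≤ 1 → m ≤ 0 := fun h' => by
        have : (m : ℝ) < 1 := by linarith
        have : m < 1 := by exact_mod_cast this
        omega
      cases t with
      | le n =>
        obtain ⟨_, _, h3, h4⟩ := h
        simp only [HeartType.gens, Set.mem_insert_iff, Set.mem_singleton_iff]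
        refine ⟨fun ⟨h5, h6⟩ => ?_, fun h' => by omega⟩
        have h7 : (n : ℝ) < m := by linarith
        have h7' : (n : ℤ) < m := by exact_mod_cast h7
        have := hm h6
        omega
      | gt n =>
        obtain ⟨_, h3, h4, _⟩ := h
        have hn : 0 < ph (b + 2) + m → (n : ℤ) ≤ m := fun h5 => by
          have h7 : (n : ℝ) < m + 1 := by linarith
          have h7' : (n : ℤ) < m + 1 := by exact_mod_cast h7
          omega
        cases n with
        | zero =>
          simp only [HeartType.gens, Set.mem_insert_iff, Set.mem_singleton_iff]
          refine ⟨fun ⟨h5, h6⟩ => ?_, fun h' => ?_⟩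
          · have := hm h6
            have := hn h5
            omega
          · obtain rfl : m = 0 := by omega
            push_cast at h3 ⊢
            exact ⟨h3, by linarith⟩
        | succ n =>
          simp only [HeartType.gens, Set.mem_insert_iff, Set.mem_singleton_iff]
          refine ⟨fun ⟨h5, h6⟩ => ?_, fun h' => by omega⟩
          have := hm h6
          have := hn h5
          omega
      | all => exact absurd (h.1 _) hall
    · rw [hheart hmem2]
      cases t with
      | le n =>
        obtain ⟨_, _, h3, h4⟩ := h
        rw [key (n := n + 1) (by push_cast; linarith) (by push_cast; linarith)]
        simp only [HeartType.gens, Set.mem_insert_iff, Set.mem_singleton_iff]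
        omega
      | gt n =>
        obtain ⟨_, h3, h4, h5⟩ := h
        rw [key (n := n) (by push_cast; linarith) (by push_cast; linarith)]
        rcases n with _ | n <;>
          simp only [HeartType.gens, Set.mem_insert_iff, Set.mem_singleton_iff] <;> omega
      | all => exact absurd (h.1 _) hall

end IsA2Helix

/-! ### Wall-crossing products of powers of objects of a helix -/

section Triangulated

variable {D : Type u} [Category.{v} D] [Preadditive D] [HasZeroObject D] [HasShift D ℤ]
  [∀ n : ℤ, (shiftFunctor D n).Additive] [Pretriangulated D]

lemma phi_eq (X : D) : Phi X = charFn (SumOf fun Y => Y = X) := by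
  refine congrArg charFn (funext fun L => propext ⟨?_, ?_⟩)
  · rintro ⟨n, h⟩
    exact sumOf_iff.2 ⟨n, _, fun _ => rfl, h⟩
  · intro h
    obtain ⟨n, f, hf, e⟩ := sumOf_iff.1 h
    obtain rfl : f = fun _ => X := funext hf
    exact ⟨n, e⟩

namespace StabilityCondition

variable {σ : StabilityCondition D} {E : ℤ → D} {ss : Set ℤ} {ph : ℤ → ℝ}

lemma phaseLE_iff (hσ : ∀ i φ, σ.P φ (E i) ↔ i ∈ ss ∧ ph i = φ) (i j : ℤ) : σ.PhaseLE (E i) (E j) ↔ i ∈ ss ∧ j ∈ ss ∧ ph i ≤ ph j := by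
  constructor
  · rintro ⟨a, b, ha, hb, hab⟩
    obtain ⟨hi, rfl⟩ := (hσ _ _).1 ha
    obtain ⟨hj, rfl⟩ := (hσ _ _).1 hb
    exact ⟨hi, hj, hab⟩
  · exact fun ⟨hi, hj, h⟩ => ⟨_, _, (hσ _ _).2 ⟨hi, rfl⟩, (hσ _ _).2 ⟨hj, rfl⟩, h⟩

lemma phaseLT_iff (hσ : ∀ i φ, σ.P φ (E i) ↔ i ∈ ss ∧ ph i = φ) (i j : ℤ) : σ.PhaseLT (E i) (E j) ↔ i ∈ ss ∧ j ∈ ss ∧ ph i < ph j := by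
  constructor
  · rintro ⟨a, b, ha, hb, hab⟩
    obtain ⟨hi, rfl⟩ := (hσ _ _).1 ha
    obtain ⟨hj, rfl⟩ := (hσ _ _).1 hb
    exact ⟨hi, hj, hab⟩
  · exact fun ⟨hi, hj, h⟩ => ⟨_, _, (hσ _ _).2 ⟨hi, rfl⟩, (hσ _ _).2 ⟨hj, rfl⟩, h⟩

end StabilityCondition

end Triangulated

namespace IsA2Helix

variable {k : Type*} [Field k] {D : Type u} [Category.{v} D] [Preadditive D]
  [HasZeroObject D] [HasShift D ℤ] [∀ n : ℤ, (shiftFunctor D n).Additive] [Pretriangulated D]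
  [Linear k D] {E : ℤ → D} (hE : IsA2Helix k E)

include hE

lemma nonempty_shift_iso (i m : ℤ) : Nonempty ((E i)⟦m⟧ ≅ E (i + 3 * m)) := by
  induction m using Int.induction_on with
  | zero =>
    rw [mul_zero, add_zero]
    exact ⟨(shiftFunctorZero D ℤ).app _⟩
  | succ m ih =>
    obtain ⟨e⟩ := ih
    obtain ⟨e'⟩ := hE.shift (i + 3 * m)
    rw [show i + 3 * ((m : ℤ) + 1) = i + 3 * m + 3 by ring]
    exact ⟨(shiftFunctorAdd D (m : ℤ) 1).app _ ≪≫ (shiftFunctor D (1 : ℤ)).mapIso e ≪≫ e'⟩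
  | pred m ih =>
    obtain ⟨e⟩ := ih
    obtain ⟨e'⟩ := hE.shift (i + 3 * (-(m : ℤ) - 1))
    rw [show i + 3 * (-(m : ℤ) - 1) + 3 = i + 3 * (-(m : ℤ)) by ring] at e'
    exact ⟨(shiftFunctor D (1 : ℤ)).preimageIso
      (((shiftFunctorAdd' D (-(m : ℤ) - 1) 1 (-(m : ℤ)) (by ring)).app _).symm ≪≫ e ≪≫ e'.symm)⟩

lemma homNonpos_of {i j : ℤ} (h : ∀ m : ℤ, m ≤ 0 → j + 3 * m ≠ i ∧ j + 3 * m ≠ i + 1) :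
    HomNonpos (E i) (E j) := by
  intro m hm f
  obtain ⟨e⟩ := hE.nonempty_shift_iso j m
  rw [← cancel_mono e.hom, zero_comp]
  exact hE.hom_eq_zero _ _ (h m hm).1 (h m hm).2 _

/-- All conditions are now numerical, because Hom spaces between helix terms depend only on the
indices; no stability condition enters. -/
lemma hasOrderedProd_phi [Finite k] {ι : Type*} [LinearOrder ι] (idx : ι → ℤ)
    (hidx : ∀ a b, a < b → ∀ m : ℤ, m ≤ 0 → idx b + 3 * m ≠ idx a ∧ idx b + 3 * m ≠ idx a + 1)
    (hex : ∀ i, (∃ a, idx a = i) ∨ ∃ a b, a < b ∧ idx a = i - 1 ∧ idx b = i + 1) :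
    HasOrderedProd (fun a => Phi (E (idx a))) fun _ => 1 := by
  simp only [phi_eq]
  refine hE.hasOrderedProd (fun a => SumOf fun Y => Y = E (idx a)) (fun a X Y e h => h.of_iso e.symm)
    (fun a X h => .zero h) (fun a X Y h h' => h.biprod h') (fun a b hab A B hA hB m hm => ?_)
    (fun i => ?_)
  · refine SumOf.hom_eq_zero (R := fun Y => Y = (E (idx b))⟦m⟧) ?_ hA
      (hB.map (shiftFunctor D m) fun X hX => by rw [hX])
    rintro _ _ rfl rfl
    exact hE.homNonpos_of (hidx a b hab) m hm
  · rcases hex i with ⟨a, rfl⟩ | ⟨a, b, hab, ha, hb⟩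
    · exact .inl ⟨a, .single rfl⟩
    · exact .inr ⟨a, b, hab, .single (by rw [ha]), .single (by rw [hb])⟩

variable {σ : StabilityCondition D} {ss : Set ℤ} {ph : ℤ → ℝ} (d : PhaseData ss ph)
  (hσ : ∀ i φ, σ.P φ (E i) ↔ i ∈ ss ∧ ph i = φ)
include d hσ

lemma hasOrderedProd_SS [Finite k] :
    HasOrderedProd (fun φ : ℝᵒᵈ => σ.SS (OrderDual.ofDual φ)) fun _ => 1 := by
  refine hE.hasOrderedProd (fun φ : ℝᵒᵈ => σ.P (OrderDual.ofDual φ))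
    (fun a X Y e => σ.P_of_iso e) (fun a => σ.zero_mem _)
    (fun a X Y hX hY => σ.ext_closed _ _ (binaryBiproductTriangle_distinguished X Y) hX hY)
    (fun a b hab A B hA hB n hn => σ.hom_shift_neg_eq_zero hA hB n ?_) (fun i => ?_)
  · have h1 : OrderDual.ofDual b < OrderDual.ofDual a := hab
    have h2 : (n : ℝ) ≤ 0 := by exact_mod_cast hn
    linarith
  · by_cases hi : i ∈ ss
    · exact .inl ⟨OrderDual.toDual (ph i), (hσ _ _).2 ⟨hi, rfl⟩⟩
    · exact .inr ⟨OrderDual.toDual (ph (i - 1)), OrderDual.toDual (ph (i + 1)), d.gt i hi,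
        (hσ _ _).2 ⟨d.mem_pred i hi, rfl⟩, (hσ _ _).2 ⟨d.mem_succ i hi, rfl⟩⟩

end IsA2Helix

/-! ### The rows of the classification -/

section A2

variable {k : Type u} [Field k] [HasDerivedCategory.{w} (RepA2 k)]

namespace Row

/-- The index in the helix of the first generator of the heart. -/
def base : Row → ℤ
  | S₁S₂_le _ | S₁S₂_gt _ _ | S₁S₂_std | all_S₂P₁S₁ => 0
  | P₁S₁_le _ | P₁S₁_gt _ _ | P₁S₁_std | all_S₁S₂P₁ => 2
  | S₂P₁_le _ | S₂P₁_gt _ _ | S₂P₁_std | all_P₁S₁S₂ => 1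

/-- The shape of the heart. -/
def htype : Row → HeartType
  | S₁S₂_le n | P₁S₁_le n | S₂P₁_le n => .le n
  | S₁S₂_gt n _ | P₁S₁_gt n _ | S₂P₁_gt n _ => .gt n
  | S₁S₂_std | P₁S₁_std | S₂P₁_std => .gt 0
  | all_S₂P₁S₁ | all_S₁S₂P₁ | all_P₁S₁S₂ => .all

/-- The rows are the pairs of a base modulo 3 and a heart type. The type `gt 0` gives the third row
of each group, which is why the parameter in the second row starts at 1. -/
lemma exists_row (b : ℤ) (t : HeartType) : ∃ (r : Row) (m : ℤ), r.htype = t ∧ b = r.base + 3 * m := by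
  obtain ⟨c, m, hc, rfl⟩ : ∃ c m, (c = 0 ∨ c = 1 ∨ c = 2) ∧ b = c + 3 * m :=
    ⟨b % 3, b / 3, by omega, by omega⟩
  rcases hc with rfl | rfl | rfl
  · rcases t with n | (_ | n) | _
    · exact ⟨S₁S₂_le n, m, rfl, rfl⟩
    · exact ⟨S₁S₂_std, m, rfl, rfl⟩
    · exact ⟨S₁S₂_gt (n + 1) (by omega), m, rfl, rfl⟩
    · exact ⟨all_S₂P₁S₁, m, rfl, rfl⟩
  · rcases t with n | (_ | n) | _
    · exact ⟨S₂P₁_le n, m, rfl, rfl⟩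
    · exact ⟨S₂P₁_std, m, rfl, rfl⟩
    · exact ⟨S₂P₁_gt (n + 1) (by omega), m, rfl, rfl⟩
    · exact ⟨all_P₁S₁S₂, m, rfl, rfl⟩
  · rcases t with n | (_ | n) | _
    · exact ⟨P₁S₁_le n, m, rfl, rfl⟩
    · exact ⟨P₁S₁_std, m, rfl, rfl⟩
    · exact ⟨P₁S₁_gt (n + 1) (by omega), m, rfl, rfl⟩
    · exact ⟨all_S₁S₂P₁, m, rfl, rfl⟩

lemma eq_of_base_of_htype {r r' : Row} (h : r.base % 3 = r'.base % 3) (h' : r.htype = r'.htype) :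
    r = r' := by
  cases r <;> cases r' <;> simp_all [base, htype] <;> omega

lemma mem_semistable_iff (r : Row) (X : Ind) :
    X ∈ r.semistable ↔ r.htype = .all ∨ (X.idx - (r.base + 1)) % 3 ≠ 0 := by
  cases r <;> cases X <;> simp [semistable, base, htype, Ind.idx]

lemma phases_iff (σ : StabilityCondition (DbA2 k)) (r : Row) : r.phases σ ↔ match r.htype with
    | .le n => σ.PhaseLE (helix k r.base) (helix k (r.base + 2 + 3 * (n + 1)))
    | .gt n => σ.PhaseLT (helix k (r.base + 2 + 3 * n)) (helix k r.base)
    | .all => σ.PhaseLE (helix k r.base) (helix k (r.base + 2)) := by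
  have hS₁ : ∀ i j, i = 2 + 3 * j → helix k i = ob k .S₁ j := helix_eq .S₁
  have hS₂ : ∀ i j, i = 0 + 3 * j → helix k i = ob k .S₂ j := helix_eq .S₂
  have hP₁ : ∀ i j, i = 1 + 3 * j → helix k i = ob k .P₁ j := helix_eq .P₁
  cases r with
  | S₁S₂_le n => simp only [phases, base, htype]; rw [hS₂ _ 0 (by ring), hS₁ _ (n + 1) (by ring)]
  | S₁S₂_gt n _ => simp only [phases, base, htype]; rw [hS₁ _ n (by ring), hS₂ _ 0 (by ring)]
  | S₁S₂_std => simp only [phases, base, htype]; rw [hS₁ _ 0 (by simp), hS₂ _ 0 (by ring)]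
  | P₁S₁_le n => simp only [phases, base, htype]; rw [hS₁ _ 0 (by ring), hP₁ _ (n + 2) (by ring)]
  | P₁S₁_gt n _ => simp only [phases, base, htype]; rw [hP₁ _ (n + 1) (by ring), hS₁ _ 0 (by ring)]
  | P₁S₁_std => simp only [phases, base, htype]; rw [hP₁ _ 1 (by simp), hS₁ _ 0 (by ring)]
  | S₂P₁_le n => simp only [phases, base, htype]; rw [hP₁ _ 0 (by ring), hS₂ _ (n + 2) (by ring)]
  | S₂P₁_gt n _ => simp only [phases, base, htype]; rw [hS₂ _ (n + 1) (by ring), hP₁ _ 0 (by ring)]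
  | S₂P₁_std => simp only [phases, base, htype]; rw [hS₂ _ 1 (by simp), hP₁ _ 0 (by ring)]
  | all_S₂P₁S₁ => simp only [phases, base, htype]; rw [hS₂ _ 0 (by ring), hS₁ _ 0 (by ring)]
  | all_S₁S₂P₁ => simp only [phases, base, htype]; rw [hS₁ _ 0 (by ring), hP₁ _ 1 (by ring)]
  | all_P₁S₁S₂ => simp only [phases, base, htype]; rw [hP₁ _ 0 (by ring), hS₂ _ 1 (by ring)]

lemma phaseRange_iff (σ : StabilityCondition (DbA2 k)) (r : Row) :
    r.phaseRange σ ↔ match r.htype with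
    | .le n => σ.PhaseLT (helix k (r.base + 2 + 3 * n)) (helix k r.base) ∧
        σ.PhaseLE (helix k r.base) (helix k (r.base + 2 + 3 * (n + 1)))
    | .gt n => σ.PhaseLT (helix k (r.base + 2 + 3 * n)) (helix k r.base) ∧
        σ.PhaseLE (helix k r.base) (helix k (r.base + 2 + 3 * (n + 1)))
    | .all => σ.PhaseLE (helix k 0) (helix k 1) ∧ σ.PhaseLE (helix k 1) (helix k 2) ∧
        σ.PhaseLE (helix k 2) (helix k 3) := by
  have hS₁ : ∀ i j, i = 2 + 3 * j → helix k i = ob k .S₁ j := helix_eq .S₁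
  have hS₂ : ∀ i j, i = 0 + 3 * j → helix k i = ob k .S₂ j := helix_eq .S₂
  have hP₁ : ∀ i j, i = 1 + 3 * j → helix k i = ob k .P₁ j := helix_eq .P₁
  have h3 : helix k 3 = ob k .S₂ 1 := hS₂ _ 1 (by ring)
  have h2 : helix k 2 = ob k .S₁ 0 := hS₁ _ 0 (by ring)
  have h1 : helix k 1 = ob k .P₁ 0 := hP₁ _ 0 (by ring)
  have h0 : helix k 0 = ob k .S₂ 0 := hS₂ _ 0 (by ring)
  cases r with
  | S₁S₂_le n =>
    simp only [phaseRange, base, htype]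
    rw [h0, hS₁ _ n (by ring), hS₁ _ (n + 1) (by ring)]
  | S₁S₂_gt n _ =>
    simp only [phaseRange, base, htype]
    rw [h0, hS₁ _ n (by ring), hS₁ _ (n + 1) (by ring)]
  | S₁S₂_std =>
    simp only [phaseRange, base, htype]
    rw [h0, hS₁ _ 0 (by simp), hS₁ _ 1 (by simp)]
  | P₁S₁_le n =>
    simp only [phaseRange, base, htype]
    rw [h2, hP₁ _ (n + 1) (by ring), hP₁ _ (n + 2) (by ring)]
  | P₁S₁_gt n _ =>
    simp only [phaseRange, base, htype]
    rw [h2, hP₁ _ (n + 1) (by ring), hP₁ _ (n + 2) (by ring)]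
  | P₁S₁_std =>
    simp only [phaseRange, base, htype]
    rw [h2, hP₁ _ 1 (by simp), hP₁ _ 2 (by simp)]
  | S₂P₁_le n =>
    simp only [phaseRange, base, htype]
    rw [h1, hS₂ _ (n + 1) (by ring), hS₂ _ (n + 2) (by ring)]
  | S₂P₁_gt n _ =>
    simp only [phaseRange, base, htype]
    rw [h1, hS₂ _ (n + 1) (by ring), hS₂ _ (n + 2) (by ring)]
  | S₂P₁_std =>
    simp only [phaseRange, base, htype]
    rw [h1, hS₂ _ 1 (by simp), hS₂ _ 2 (by simp)]
  | all_S₂P₁S₁ => simp only [phaseRange, htype]; rw [h0, h1, h2, h3]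
  | all_S₁S₂P₁ => simp only [phaseRange, htype]; rw [h0, h1, h2, h3]
  | all_P₁S₁S₂ => simp only [phaseRange, htype]; rw [h0, h1, h2, h3]

variable (k) in
lemma heart_eq (r : Row) : r.heart k = addHull (helix k '' r.htype.gens r.base) ∨
    (r.heart k = (stalk k).essImage ∧ r.htype.gens r.base = {0, 1, 2}) := by
  have hS₁ : ∀ i j, i = 2 + 3 * j → helix k i = ob k .S₁ j := helix_eq .S₁
  have hS₂ : ∀ i j, i = 0 + 3 * j → helix k i = ob k .S₂ j := helix_eq .S₂
  have hP₁ : ∀ i j, i = 1 + 3 * j → helix k i = ob k .P₁ j := helix_eq .P₁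
  cases r with
  | S₁S₂_le n =>
    left
    simp only [heart, base, htype, HeartType.gens, Set.image_pair]
    rw [hS₂ _ 0 (by ring), hS₁ _ (n + 1) (by ring)]
  | S₁S₂_gt n hn =>
    left
    obtain ⟨n, rfl⟩ := Nat.exists_eq_add_of_le' hn
    simp only [heart, base, htype, HeartType.gens, Set.image_pair]
    rw [hS₂ _ 0 (by ring), hS₁ _ (n + 1) (by ring)]
    push_cast
    rfl
  | S₁S₂_std => exact .inr ⟨rfl, rfl⟩
  | P₁S₁_le n =>
    left
    simp only [heart, base, htype, HeartType.gens, Set.image_pair]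
    rw [hS₁ _ 0 (by ring), hP₁ _ (n + 2) (by ring)]
  | P₁S₁_gt n hn =>
    left
    obtain ⟨n, rfl⟩ := Nat.exists_eq_add_of_le' hn
    simp only [heart, base, htype, HeartType.gens, Set.image_pair]
    rw [hS₁ _ 0 (by ring), hP₁ _ (n + 1 + 1) (by ring)]
    push_cast
    rfl
  | P₁S₁_std =>
    left
    simp only [heart, base, htype, HeartType.gens, Set.image_insert_eq, Set.image_singleton]
    rw [hS₁ _ 0 (by ring), hS₂ _ 1 (by ring), hP₁ _ 1 (by ring)]
  | S₂P₁_le n =>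
    left
    simp only [heart, base, htype, HeartType.gens, Set.image_pair]
    rw [hP₁ _ 0 (by ring), hS₂ _ (n + 2) (by ring)]
  | S₂P₁_gt n hn =>
    left
    obtain ⟨n, rfl⟩ := Nat.exists_eq_add_of_le' hn
    simp only [heart, base, htype, HeartType.gens, Set.image_pair]
    rw [hP₁ _ 0 (by ring), hS₂ _ (n + 1 + 1) (by ring)]
    push_cast
    rfl
  | S₂P₁_std =>
    left
    simp only [heart, base, htype, HeartType.gens, Set.image_insert_eq, Set.image_singleton]
    rw [hP₁ _ 0 (by ring), hS₁ _ 0 (by ring), hS₂ _ 1 (by ring)]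
  | all_S₂P₁S₁ => exact .inr ⟨rfl, rfl⟩
  | all_S₁S₂P₁ =>
    left
    simp only [heart, base, htype, HeartType.gens, Set.image_insert_eq, Set.image_singleton]
    rw [hS₁ _ 0 (by ring), hS₂ _ 1 (by ring), hP₁ _ 1 (by ring)]
  | all_P₁S₁S₂ =>
    left
    simp only [heart, base, htype, HeartType.gens, Set.image_insert_eq, Set.image_singleton]
    rw [hP₁ _ 0 (by ring), hS₁ _ 0 (by ring), hS₂ _ 1 (by ring)]

end Row

/-! ### Hearts as additive hulls -/

/-- Closure of `Q` under retracts already accounts for the passage to direct summands in the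
additive hull. -/
lemma addHull_eq_sumOf {S : Set (DbA2 k)} {Q : ObjectProperty (DbA2 k)} (hQ : Q = SumOf (· ∈ S))
    (hr : ∀ (X M : DbA2 k) (i : X ⟶ M) (r : M ⟶ X), i ≫ r = 𝟙 X → Q M → Q X) : addHull S = Q := by
  funext M
  refine propext ⟨?_, fun h => ?_⟩
  · rintro ⟨N, n, f, hf, ⟨e⟩⟩
    refine hr M (⨁ f) (biprod.inl ≫ e.hom) (e.inv ≫ biprod.fst) (by simp) ?_
    rw [hQ]
    exact sumOf_iff.2 ⟨n, f, hf, ⟨Iso.refl _⟩⟩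
  · rw [hQ] at h
    obtain ⟨n, f, hf, ⟨e⟩⟩ := sumOf_iff.1 h
    obtain ⟨O, hO⟩ := HasZeroObject.zero (C := DbA2 k)
    exact ⟨O, n, f, hf, ⟨(isoBiprodZero hO).symm ≪≫ e⟩⟩

end A2


section A2

variable {k : Type u} [Field k] [HasDerivedCategory.{w} (RepA2 k)]

lemma of_retract_of_heart {σ : StabilityCondition (DbA2 k)} {X M : DbA2 k} (i : X ⟶ M) (r : M ⟶ X)
    (h : i ≫ r = 𝟙 X) (hM : σ.heart M) : σ.heart X := by
  rw [σ.heart_iff] at hM ⊢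
  exact hM.of_retract i r h

lemma heart_eq_addHull {σ : StabilityCondition (DbA2 k)} {I : Set ℤ}
    (h : ∀ i, σ.heart (helix k i) ↔ i ∈ I) : σ.heart = addHull (helix k '' I) := by
  refine (addHull_eq_sumOf ?_ fun X M i r => of_retract_of_heart i r).symm
  rw [(isA2Helix_helix k).heart_eq_sumOf]
  refine congrArg SumOf (funext fun X => propext ⟨?_, ?_⟩)
  · rintro ⟨i, hi, rfl⟩
    exact ⟨i, (h i).1 hi, rfl⟩
  · rintro ⟨i, hi, rfl⟩
    exact ⟨i, (h i).2 hi, rfl⟩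

lemma helix_idx (X : Ind) : helix k X.idx = ob k X 0 := helix_eq X _ 0 (by ring)

lemma stalk_rep_iso (X : Ind) : Nonempty ((stalk k).obj (X.rep k) ≅ helix k X.idx) := by
  rw [helix_idx]
  exact ⟨((shiftFunctorZero (DbA2 k) ℤ).app _).symm⟩

lemma heart_eq_essImage {σ : StabilityCondition (DbA2 k)}
    (h : ∀ i, σ.heart (helix k i) ↔ i ∈ ({0, 1, 2} : Set ℤ)) :
    σ.heart = (stalk k).essImage := by
  have hX : ∀ X : Ind, σ.heart (helix k X.idx) := fun X => (h _).2 (by cases X <;> simp [Ind.idx])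
  funext M
  refine propext ⟨fun hM => ?_, ?_⟩
  · rw [(isA2Helix_helix k).heart_eq_sumOf] at hM
    refine hM.ind ?_ ?_ ?_ ?_
    · intro Z hZ
      obtain ⟨O, hO⟩ := HasZeroObject.zero (C := RepA2 k)
      exact ⟨O, ⟨((stalk k).map_isZero hO).iso hZ⟩⟩
    · rintro _ ⟨i, hi, rfl⟩
      obtain ⟨X, rfl⟩ : ∃ X : Ind, i = X.idx := by
        rcases (h i).1 hi with rfl | rfl | rfl
        exacts [⟨.S₂, rfl⟩, ⟨.P₁, rfl⟩, ⟨.S₁, rfl⟩]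
      exact ⟨_, stalk_rep_iso X⟩
    · rintro X Y e ⟨R, ⟨e'⟩⟩
      exact ⟨R, ⟨e' ≪≫ e.symm⟩⟩
    · rintro X Y ⟨R, ⟨e⟩⟩ ⟨R', ⟨e'⟩⟩
      have := preservesBinaryBiproducts_of_preservesBiproducts (stalk k)
      exact ⟨R ⊞ R', ⟨(stalk k).mapBiprod R R' ≪≫ biprod.mapIso e e'⟩⟩
  · rintro ⟨R, ⟨e⟩⟩
    have h1 := (Ind.sumOf_rep R).map (stalk k)
      (Q' := fun X => ∃ i, σ.heart (helix k i) ∧ Nonempty (X ≅ helix k i)) (by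
        rintro _ ⟨X, rfl⟩
        exact ⟨_, hX X, stalk_rep_iso X⟩)
    rw [σ.heart_iff]
    refine (Orth.sumOf ?_ h1).of_iso e.symm
    rintro X ⟨i, hi, ⟨e'⟩⟩
    rw [σ.heart_iff] at hi
    exact hi.of_iso e'

/-! ### Rows in terms of phase data -/

namespace Row

lemma heart_eq_of_iff {σ : StabilityCondition (DbA2 k)} (r : Row)
    (h : ∀ i, σ.heart (helix k i) ↔ i ∈ r.htype.gens r.base) : σ.heart = r.heart k := by
  rcases r.heart_eq k with h' | ⟨h', h''⟩
  · rw [h', heart_eq_addHull h]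
  · rw [h', heart_eq_essImage (h'' ▸ h)]

lemma heart_of_mem_gens (r : Row) {i : ℤ} (hi : i ∈ r.htype.gens r.base) :
    r.heart k (helix k i) := by
  rcases r.heart_eq k with h' | ⟨h', h''⟩
  · rw [h']
    obtain ⟨O, hO⟩ := HasZeroObject.zero (C := DbA2 k)
    obtain ⟨n, f, hf, ⟨e⟩⟩ := sumOf_iff.1
      (SumOf.single (Q := (· ∈ helix k '' r.htype.gens r.base)) ⟨i, hi, rfl⟩)
    exact ⟨O, n, f, hf, ⟨(isoBiprodZero hO).symm ≪≫ e⟩⟩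
  · rw [h']
    obtain ⟨X, rfl⟩ : ∃ X : Ind, i = X.idx := by
      rcases h'' ▸ hi with rfl | rfl | rfl
      exacts [⟨.S₂, rfl⟩, ⟨.P₁, rfl⟩, ⟨.S₁, rfl⟩]
    exact ⟨_, stalk_rep_iso X⟩

variable {σ : StabilityCondition (DbA2 k)} {ss : Set ℤ} {ph : ℤ → ℝ} (d : PhaseData ss ph)
  (hσ : ∀ i φ, σ.P φ (helix k i) ↔ i ∈ ss ∧ ph i = φ)
include d hσ

lemma isSemistable_iff (X : Ind) : IsSemistable k σ X ↔ X.idx ∈ ss := by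
  rw [IsSemistable, ← helix_idx]
  exact ⟨fun ⟨_, φ, h⟩ => ((hσ _ _).1 h).1,
    fun h => ⟨(isA2Helix_helix k).not_isZero _, _, (hσ _ _).2 ⟨h, rfl⟩⟩⟩

/-- From a row to phases, the listed semistable objects determine `ss` modulo 3, membership of the
generators in the heart confines their phases to (0, 1], and the listed inequality supplies the
comparison. The converse is `heart_iff_mem_gens` together with the constraints in `PhaseData`. -/
lemma holds_iff (r : Row) : r.Holds σ ↔ r.htype.Holds ss ph r.base := by
  have hE := isA2Helix_helix k
  have hph : ∀ (i : ℤ) (n : ℤ), ph (i + 3 * n) = ph i + n := d.ph_add_mul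
  constructor
  · rintro ⟨h1, h2, h3⟩
    have hmem : ∀ i, i ∈ ss ↔ r.htype = .all ∨ (i - (r.base + 1)) % 3 ≠ 0 := fun i => by
      obtain ⟨X, j, rfl⟩ := exists_idx i
      rw [d.mem_add_mul, ← isSemistable_iff d hσ, h1, mem_semistable_iff]
      refine or_congr_right (not_congr ?_)
      omega
    have hb : r.base ∈ ss := (hmem _).2 (.inr (by omega))
    have hb2 : r.base + 2 ∈ ss := (hmem _).2 (.inr (by omega))
    have hg : ∀ i ∈ r.htype.gens r.base, i ∈ ss → 0 < ph i ∧ ph i ≤ 1 := fun i hi hs => by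
      rw [← hE.heart_of_mem d hσ hs, h2]
      exact r.heart_of_mem_gens hi
    rw [phases_iff] at h3
    have hg' : ∀ (n : ℤ), r.base + 2 + 3 * n ∈ r.htype.gens r.base →
        0 < ph (r.base + 2) + n ∧ ph (r.base + 2) + n ≤ 1 := fun n hn => by
      rw [← hph]
      exact hg _ hn ((d.mem_add_mul _ _).2 hb2)
    generalize ht : r.htype = t at *
    cases t with
    | le n =>
      simp only [StabilityCondition.phaseLE_iff hσ] at h3
      have h4 := hg r.base (.inl rfl) hb
      have h5 := hg' (n + 1) (.inr rfl)
      have h6 := h3.2.2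
      rw [hph] at h6
      push_cast at h5 h6
      exact ⟨fun h => by simpa using (hmem _).1 h, h4.1, by linarith, by linarith⟩
    | gt n =>
      simp only [StabilityCondition.phaseLT_iff hσ] at h3
      have h4 := hg r.base (by cases n <;> exact .inl rfl) hb
      have h5 := hg' n (by
        cases n with
        | zero => exact .inr (.inr (by simp))
        | succ n => exact .inr (by push_cast; rfl))
      have h6 := h3.2.2
      rw [hph] at h6
      push_cast at h5 h6
      exact ⟨fun h => by simpa using (hmem _).1 h, by linarith, by linarith, h4.2⟩
    | all =>
      have h4 := hg r.base (.inl rfl) hb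
      have h5 := hg (r.base + 2) (.inr (.inr rfl)) hb2
      exact ⟨fun i => (hmem i).2 (.inl rfl), h4.1, h5.2⟩
  · intro h
    obtain ⟨hb, hb2⟩ := d.mem_of_holds h
    refine ⟨fun X => ?_, r.heart_eq_of_iff (hE.heart_iff_mem_gens d hσ h), ?_⟩
    · rw [isSemistable_iff d hσ, mem_semistable_iff]
      generalize r.htype = t at h
      have key : r.base + 1 ∉ ss → (X.idx ∈ ss ↔ (X.idx - (r.base + 1)) % 3 ≠ 0) := by
        intro hb1
        refine ⟨fun hX h0 => hb1 ?_, fun h0 => ?_⟩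
        · rw [← d.mem_add_mul _ ((X.idx - (r.base + 1)) / 3)]
          convert hX using 1
          omega
        · by_contra hX
          obtain ⟨m, hm⟩ := d.sub_eq_mul_of_not_mem hb1 hX
          omega
      cases t with
      | le n => simpa using key h.1
      | gt n => simpa using key h.1
      | all => simpa using h.1 _
    · rw [phases_iff]
      generalize r.htype = t at h
      cases t with
      | le n =>
        simp only [StabilityCondition.phaseLE_iff hσ, hph, d.mem_add_mul]
        obtain ⟨_, _, h3, _⟩ := h
        exact ⟨hb, hb2, by push_cast; linarith⟩
      | gt n =>
        simp only [StabilityCondition.phaseLT_iff hσ, hph, d.mem_add_mul]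
        obtain ⟨_, _, h3, _⟩ := h
        exact ⟨hb2, hb, by push_cast; linarith⟩
      | all =>
        simp only [StabilityCondition.phaseLE_iff hσ]
        have h1 := d.le r.base (h.1 _) (h.1 _)
        have h2 := d.le (r.base + 1) (h.1 _) (h.1 _)
        rw [add_assoc, one_add_one_eq_two] at h2
        exact ⟨hb, hb2, h1.trans h2⟩

lemma holds_shift_iff (r : Row) (m : ℤ) :
    r.Holds (σ.shift m) ↔ r.htype.Holds ss ph (r.base - 3 * m) := by
  rw [r.holds_iff (σ := σ.shift m) (d.shift m) fun i φ => ?_, d.holds_shift_iff]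
  refine (hσ i (φ + m)).trans (and_congr_right fun _ => ?_)
  exact sub_eq_iff_eq_add.symm

lemma existsUnique_holds : ∃! p : ℤ × Row, p.2.Holds (σ.shift p.1) := by
  obtain ⟨b, t, h⟩ := d.exists_holds
  obtain ⟨r, m, rfl, rfl⟩ := exists_row b t
  -- Passing to `σ.shift m` lowers phases by `m`, which amounts to moving the base by `-3 * m`; a
  -- base `r.base + 3 * m` therefore calls for the shift by `-m`.
  refine ⟨(-m, r), ?_, ?_⟩
  · change r.Holds _
    rw [r.holds_shift_iff d hσ]
    convert h using 1
    ring
  · rintro ⟨m', r'⟩ h'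
    change r'.Holds _ at h'
    rw [r'.holds_shift_iff d hσ] at h'
    obtain ⟨h1, h2⟩ := d.holds_unique h' h
    obtain rfl : r' = r := eq_of_base_of_htype (by omega) h2
    exact Prod.ext (by change m' = -m; omega) rfl

/-- Writing `p` and `q` for the phases at `b` and `b + 2` after the shift, type `le n` gives `q + n
≤ 0 < p`, and type `gt n` gives `p ≤ 1 < q + n + 1`. The other half of each range is part of the
type, and differences of phases do not change under the shift. -/
lemma phaseRange_of_holds (r : Row) (m : ℤ) (h : r.Holds (σ.shift m)) : r.phaseRange σ := by
  have hE := isA2Helix_helix k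
  rw [r.holds_shift_iff d hσ] at h
  obtain ⟨hb, hb2⟩ := d.mem_of_holds h
  have h0 : ∀ i, ph (i - 3 * m) = ph i - m := fun i => by
    have := d.ph_add_mul (i - 3 * m) m
    rw [sub_add_cancel] at this
    linarith
  have hmem : ∀ i, i - 3 * m ∈ ss ↔ i ∈ ss := fun i => by
    rw [← d.mem_add_mul _ m, sub_add_cancel]
  rw [sub_add_eq_add_sub, hmem] at hb2
  rw [hmem] at hb
  rw [phaseRange_iff]
  generalize r.htype = t at h
  cases t with
  | le n =>
    simp only [StabilityCondition.phaseLE_iff hσ, StabilityCondition.phaseLT_iff hσ, d.ph_add_mul, d.mem_add_mul]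
    obtain ⟨_, h1, h2, h3⟩ := h
    rw [sub_add_eq_add_sub, h0] at h2 h3
    rw [h0] at h1 h2
    exact ⟨⟨hb2, hb, by push_cast; linarith⟩, hb, hb2, by push_cast; linarith⟩
  | gt n =>
    simp only [StabilityCondition.phaseLE_iff hσ, StabilityCondition.phaseLT_iff hσ, d.ph_add_mul, d.mem_add_mul]
    obtain ⟨_, h1, h2, h3⟩ := h
    rw [sub_add_eq_add_sub, h0] at h1 h2
    rw [h0] at h2 h3
    exact ⟨⟨hb2, hb, by push_cast; linarith⟩, hb, hb2, by push_cast; linarith⟩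
  | all =>
    simp only [StabilityCondition.phaseLE_iff hσ]
    have := h.1
    exact ⟨⟨this _, this _, d.le 0 (this _) (this _)⟩, ⟨this _, this _, d.le 1 (this _) (this _)⟩,
      this _, this _, d.le 2 (this _) (this _)⟩

lemma exists_two_semistable : ∃ X Y : Ind, X ≠ Y ∧ IsSemistable k σ X ∧ IsSemistable k σ Y := by
  simp only [isSemistable_iff d hσ]
  by_cases h1 : (1 : ℤ) ∈ ss
  · by_cases h2 : (2 : ℤ) ∈ ss
    · exact ⟨.P₁, .S₁, by decide, h1, h2⟩
    · exact ⟨.P₁, .S₂, by decide, h1, (d.mem_shift 0).1 (d.mem_succ 2 h2)⟩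
  · exact ⟨.S₂, .S₁, by decide, d.mem_pred 1 h1, d.mem_succ 1 h1⟩

end Row

/-! ### The explicit wall-crossing formulas -/

lemma lex_lt_iff {n : ℕ} (a b : ℤᵒᵈ ×ₗ Fin n) : a < b ↔
    OrderDual.ofDual (ofLex b).1 < OrderDual.ofDual (ofLex a).1 ∨
      OrderDual.ofDual (ofLex b).1 = OrderDual.ofDual (ofLex a).1 ∧ (ofLex a).2 < (ofLex b).2 := by
  rw [Prod.Lex.lt_iff]
  exact or_congr Iff.rfl (and_congr_left fun _ => ⟨Eq.symm, Eq.symm⟩)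

variable (k) in
-- The family is periodic, so the conditions of `hasOrderedProd_phi` depend only on two positions in
-- the block and on the difference of shifts. A later factor has a smaller shift, or the same shift
-- and a later position.
lemma wallCrossing_of_block [Finite k] (l : List (Ind × ℤ)) (b : Fin l.length → ℤ)
    (hb : ∀ i, b i = (l.get i).1.idx + 3 * (l.get i).2)
    (hlt : ∀ i j m, (m < 0 ∨ m = 0 ∧ i < j) → b j + 3 * m ≠ b i ∧ b j + 3 * m ≠ b i + 1)
    (hex : ∀ c, (∃ i m, c = b i + 3 * m) ∨ ∃ i j m m', (m' < m ∨ m' = m ∧ i < j) ∧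
      c - 1 = b i + 3 * m ∧ c + 1 = b j + 3 * m') :
    HasOrderedProd
      (fun t : ℤᵒᵈ ×ₗ Fin l.length =>
        Phi (ob k (l.get (ofLex t).2).1
          ((l.get (ofLex t).2).2 + OrderDual.ofDual (ofLex t).1)))
      (fun _ : IsoClass (DbA2 k) => (1 : ℚ)) := by
  have h := (isA2Helix_helix k).hasOrderedProd_phi
    (fun t : ℤᵒᵈ ×ₗ Fin l.length => b (ofLex t).2 + 3 * OrderDual.ofDual (ofLex t).1) ?_ ?_
  · refine (congrArg (fun f => HasOrderedProd f _) (funext fun t => congrArg Phi ?_)).mp h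
    refine helix_eq _ _ _ ?_
    rw [hb]
    ring
  · intro s t hst m hm
    rw [lex_lt_iff] at hst
    have := hlt (ofLex s).2 (ofLex t).2
      (OrderDual.ofDual (ofLex t).1 - OrderDual.ofDual (ofLex s).1 + m)
    rcases hst with h | ⟨h, h'⟩
    · have := this (.inl (by omega))
      constructor <;> [have := this.1; have := this.2] <;> omega
    · rcases hm.lt_or_eq with hm' | hm'
      · have := this (.inl (by omega))
        constructor <;> [have := this.1; have := this.2] <;> omega
      · have := this (.inr ⟨by omega, h'⟩)
        constructor <;> [have := this.1; have := this.2] <;> omega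
  · intro c
    rcases hex c with ⟨i, m, h⟩ | ⟨i, j, m, m', h, h1, h2⟩
    · exact .inl ⟨toLex (OrderDual.toDual m, i), h.symm⟩
    · refine .inr ⟨toLex (OrderDual.toDual m, i), toLex (OrderDual.toDual m', j), ?_, h1.symm,
        h2.symm⟩
      rw [lex_lt_iff]
      exact h

variable (k) in
lemma wallCrossing_two [Finite k] (x y : Ind × ℤ) (n : ℕ)
    (h : y.1.idx + 3 * y.2 = x.1.idx + 3 * x.2 + 2 + 3 * n) :
    HasOrderedProd
      (fun t : ℤᵒᵈ ×ₗ Fin [x, y].length =>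
        Phi (ob k ([x, y].get (ofLex t).2).1
          (([x, y].get (ofLex t).2).2 + OrderDual.ofDual (ofLex t).1)))
      (fun _ : IsoClass (DbA2 k) => (1 : ℚ)) := by
  obtain ⟨b, hb⟩ : ∃ b, b = x.1.idx + 3 * x.2 := ⟨_, rfl⟩
  rw [← hb] at h
  refine wallCrossing_of_block k [x, y] ![b, b + 2 + 3 * n] ?_ ?_ ?_
  · exact Fin.forall_fin_two.2 ⟨hb, h.symm⟩
  · refine Fin.forall_fin_two.2 ⟨Fin.forall_fin_two.2 ⟨?_, ?_⟩, Fin.forall_fin_two.2 ⟨?_, ?_⟩⟩ <;>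
    · intro m hm
      simp at hm ⊢
      omega
  · intro c
    obtain ⟨r, m, hr, rfl⟩ : ∃ r m, (r = 0 ∨ r = 1 ∨ r = 2) ∧ c = b + r + 3 * m :=
      ⟨(c - b) % 3, (c - b) / 3, by omega, by omega⟩
    rcases hr with rfl | rfl | rfl
    · exact .inl ⟨0, m, by simp⟩
    · refine .inr ⟨0, 1, m, m - n, ?_, by simp; ring, by simp; ring⟩
      rw [or_iff_not_imp_left]
      intro h
      exact ⟨by omega, Fin.zero_lt_one⟩
    · exact .inl ⟨1, m - n, by simp; ring⟩

variable (k) in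
lemma wallCrossing_three [Finite k] :
    HasOrderedProd
      (fun t : ℤᵒᵈ ×ₗ Fin [(Ind.S₁, (0 : ℤ)), (.P₁, 0), (.S₂, 0)].length =>
        Phi (ob k ([(Ind.S₁, (0 : ℤ)), (.P₁, 0), (.S₂, 0)].get (ofLex t).2).1
          (([(Ind.S₁, (0 : ℤ)), (.P₁, 0), (.S₂, 0)].get (ofLex t).2).2 +
            OrderDual.ofDual (ofLex t).1)))
      (fun _ : IsoClass (DbA2 k) => (1 : ℚ)) := by
  refine wallCrossing_of_block k _ ![2, 1, 0] ?_ ?_ ?_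
  · intro i
    fin_cases i <;> rfl
  · intro i j m hm
    fin_cases i <;> fin_cases j <;> simp at hm ⊢ <;> omega
  · intro c
    left
    obtain ⟨r, m, hr, rfl⟩ : ∃ r m, (r = 0 ∨ r = 1 ∨ r = 2) ∧ c = r + 3 * m :=
      ⟨c % 3, c / 3, by omega, by omega⟩
    rcases hr with rfl | rfl | rfl
    exacts [⟨2, m, rfl⟩, ⟨1, m, rfl⟩, ⟨0, m, rfl⟩]

variable (k) in
lemma Row.wallCrossing [Finite k] (r : Row) : r.WallCrossing k := by
  cases r with
  | S₁S₂_le n => exact wallCrossing_two k _ _ n (by simp [Ind.idx])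
  | S₁S₂_gt n _ => exact wallCrossing_two k _ _ n (by simp [Ind.idx])
  | S₁S₂_std => exact wallCrossing_two k _ _ 0 (by simp [Ind.idx])
  | P₁S₁_le n => exact wallCrossing_two k _ _ n (by simp [Ind.idx]; ring)
  | P₁S₁_gt n _ => exact wallCrossing_two k _ _ n (by simp [Ind.idx]; ring)
  | P₁S₁_std => exact wallCrossing_two k _ _ 0 (by simp [Ind.idx])
  | S₂P₁_le n => exact wallCrossing_two k _ _ n (by simp [Ind.idx]; ring)
  | S₂P₁_gt n _ => exact wallCrossing_two k _ _ n (by simp [Ind.idx]; ring)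
  | S₂P₁_std => exact wallCrossing_two k _ _ 0 (by simp [Ind.idx])
  | all_S₂P₁S₁ => exact wallCrossing_three k
  | all_S₁S₂P₁ => exact wallCrossing_three k
  | all_P₁S₁S₂ => exact wallCrossing_three k

end A2


/-! ### The Grothendieck group and Euler forms -/

section Triangulated

variable {D : Type u} [Category.{v} D] [Preadditive D] [HasZeroObject D] [HasShift D ℤ]
  [∀ n : ℤ, (shiftFunctor D n).Additive] [Pretriangulated D]

namespace K₀

lemma cl_of_triangle {T : Triangle D} (hT : T ∈ distTriang D) : cl T.obj₂ = cl T.obj₁ + cl T.obj₃ := by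
  have h : QuotientAddGroup.mk' (triangleRelations D)
      (FreeAbelianGroup.of T.obj₁ - FreeAbelianGroup.of T.obj₂ + FreeAbelianGroup.of T.obj₃) = 0 :=
    (QuotientAddGroup.eq_zero_iff _).2 (AddSubgroup.subset_closure ⟨T, hT, rfl⟩)
  rw [map_add, map_sub] at h
  change cl T.obj₁ - cl T.obj₂ + cl T.obj₃ = 0 at h
  rw [sub_add_eq_add_sub, sub_eq_zero] at h
  exact h.symm

lemma cl_biprod (X Y : D) : cl (X ⊞ Y) = cl X + cl Y :=
  cl_of_triangle (binaryBiproductTriangle_distinguished X Y)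

lemma cl_zero {O : D} (hO : IsZero O) : cl O = 0 := by
  have h := cl_of_triangle (IterExtn.triangle_id_left O hO)
  change cl O = cl O + cl O at h
  exact left_eq_add.1 h

lemma cl_of_iso {X Y : D} (e : X ≅ Y) : cl X = cl Y := by
  obtain ⟨O, hO⟩ := HasZeroObject.zero (C := D)
  have : Triangle.mk e.hom (0 : Y ⟶ O) 0 ∈ distTriang D :=
    (Triangle.distinguished_iff_of_isZero₃ _ hO).2 (inferInstanceAs (IsIso e.hom))
  have h := cl_of_triangle this
  change cl Y = cl X + cl O at h
  rw [h, cl_zero hO, add_zero]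

lemma cl_shift_one (X : D) : cl (X⟦(1 : ℤ)⟧) = -cl X := by
  obtain ⟨O, hO⟩ := HasZeroObject.zero (C := D)
  have h := cl_of_triangle (rotate_distinguished (IterExtn.triangle_id_left X hO))
  change cl O = cl X + cl (X⟦(1 : ℤ)⟧) at h
  rw [cl_zero hO] at h
  exact (neg_eq_of_add_eq_zero_right h.symm).symm

end K₀

variable {k : Type*} [Field k] [Linear k D]

variable (k) in
/-- The rank of the map induced by `u` on morphisms from `A`. -/
noncomputable def homRank (A : D) {X Y : D} (u : X ⟶ Y) : ℕ :=
  Module.finrank k (LinearMap.range (Linear.rightComp k A u))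

lemma homRank_neg (A : D) {X Y : D} (u : X ⟶ Y) : homRank k A (-u) = homRank k A u := by
  have : Linear.rightComp k A (-u) = -Linear.rightComp k A u :=
    LinearMap.ext fun x => by simp
  rw [homRank, this, LinearMap.range_neg, homRank]

lemma homRank_of_iso (A : D) {X Y X' Y' : D} {u : X ⟶ Y} {u' : X' ⟶ Y'} (e : X ≅ X') (e' : Y ≅ Y')
    (h : u ≫ e'.hom = e.hom ≫ u') : homRank k A u = homRank k A u' := by
  let L : (A ⟶ Y) ≃ₗ[k] (A ⟶ Y') := LinearEquiv.ofLinearMap (Linear.rightComp k A e'.hom)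
    (Linear.rightComp k A e'.inv) (LinearMap.ext fun x => by simp) (LinearMap.ext fun x => by simp)
  refine LinearEquiv.finrank_eq (L.submoduleMap _ ≪≫ₗ LinearEquiv.ofEq _ _ ?_)
  ext y
  constructor
  · rintro ⟨_, ⟨x, rfl⟩, rfl⟩
    refine ⟨x ≫ e.hom, ?_⟩
    change (x ≫ e.hom) ≫ u' = (x ≫ u) ≫ e'.hom
    rw [Category.assoc, ← h, Category.assoc]
  · rintro ⟨x, rfl⟩
    refine ⟨_, ⟨x ≫ e.inv, rfl⟩, ?_⟩
    change ((x ≫ e.inv) ≫ u) ≫ e'.hom = x ≫ u'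
    rw [Category.assoc, h, Category.assoc, e.inv_hom_id_assoc]

lemma finrank_hom_of_iso (A : D) {X Y : D} (e : X ≅ Y) :
    Module.finrank k (A ⟶ X) = Module.finrank k (A ⟶ Y) :=
  LinearEquiv.finrank_eq (LinearEquiv.ofLinearMap (Linear.rightComp k A e.hom)
    (Linear.rightComp k A e.inv) (LinearMap.ext fun x => by simp) (LinearMap.ext fun x => by simp))

/-- Rank-nullity and exactness at the middle term of the shifted triangle; the signs of its
morphisms do not affect ranks. -/
lemma finrank_hom_eq (A : D) (hfin : ∀ M : D, Module.Finite k (A ⟶ M)) {T : Triangle D}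
    (hT : T ∈ distTriang D) (n : ℤ) : Module.finrank k (A ⟶ T.obj₂⟦n⟧) =
      homRank k A (T.mor₁⟦n⟧') + homRank k A (T.mor₂⟦n⟧') := by
  have := hfin (T.obj₂⟦n⟧)
  rw [← LinearMap.finrank_range_add_finrank_ker (Linear.rightComp k A (T.mor₂⟦n⟧')), add_comm,
    homRank, homRank]
  congr 1
  refine LinearEquiv.finrank_eq (LinearEquiv.ofEq _ _ ?_)
  ext y
  constructor
  · intro hy
    have hy' : y ≫ T.mor₂⟦n⟧' = 0 := hy
    obtain ⟨x, hx⟩ : ∃ x : A ⟶ T.obj₁⟦n⟧, y = x ≫ (n.negOnePow • T.mor₁⟦n⟧') :=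
      Triangle.coyoneda_exact₂ _ (Triangle.shift_distinguished T hT n) y
        (by
          change y ≫ (n.negOnePow • T.mor₂⟦n⟧') = 0
          rw [Linear.comp_units_smul, hy', smul_zero])
    refine ⟨n.negOnePow • x, ?_⟩
    rw [hx]
    change (n.negOnePow • x) ≫ _ = _
    rw [Linear.units_smul_comp, Linear.comp_units_smul]
  · rintro ⟨x, rfl⟩
    change (x ≫ T.mor₁⟦n⟧') ≫ T.mor₂⟦n⟧' = 0
    rw [Category.assoc, ← Functor.map_comp, comp_distTriang_mor_zero₁₂ _ hT, Functor.map_zero,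
      comp_zero]

variable (k) in
/-- The Euler form `∑ (-1)^n dim Hom(A, M⟦n⟧)`. -/
noncomputable def euler (A M : D) : ℤ :=
  ∑ᶠ n : ℤ, (n.negOnePow : ℤ) * (Module.finrank k (A ⟶ M⟦n⟧) : ℤ)

/-- With `a`, `b`, `c` the ranks of the three families of maps in a long exact sequence, the
alternating sum of `c` enters `x` and `z` with opposite signs because of the degree shift, and
cancels. -/
lemma finsum_telescope {x y z a b c : ℤ → ℕ} (hx : x.support.Finite) (hy : y.support.Finite)
    (hz : z.support.Finite) (h1 : ∀ n, x (n + 1) = c n + a (n + 1)) (h2 : ∀ n, y n = a n + b n)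
    (h3 : ∀ n, z n = b n + c n) :
    ∑ᶠ n : ℤ, (n.negOnePow : ℤ) * (y n : ℤ) =
      ∑ᶠ n : ℤ, (n.negOnePow : ℤ) * (x n : ℤ) + ∑ᶠ n : ℤ, (n.negOnePow : ℤ) * (z n : ℤ) := by
  have hsub : ∀ {s t : ℤ → ℕ}, t.support.Finite → (∀ n, s n ≤ t n) →
      (Function.support fun n : ℤ => (n.negOnePow : ℤ) * (s n : ℤ)).Finite := fun {s t} ht h =>
    ht.subset fun n hn hn' => hn (by
      have : s n = 0 := Nat.le_zero.1 (hn' ▸ h n)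
      simp [this])
  have ha := hsub hy fun n => (h2 n).symm ▸ Nat.le_add_right (a n) (b n)
  have hb := hsub hy fun n => (h2 n).symm ▸ Nat.le_add_left (b n) (a n)
  have hc := hsub hz fun n => (h3 n).symm ▸ Nat.le_add_left (c n) (b n)
  have ex : ∑ᶠ n : ℤ, (n.negOnePow : ℤ) * (x n : ℤ) =
      -∑ᶠ n : ℤ, (n.negOnePow : ℤ) * (c n : ℤ) + ∑ᶠ n : ℤ, (n.negOnePow : ℤ) * (a n : ℤ) := by
    have hc' : ∑ᶠ n : ℤ, (n.negOnePow : ℤ) * (c (n - 1) : ℤ) =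
        -∑ᶠ n : ℤ, (n.negOnePow : ℤ) * (c n : ℤ) := by
      rw [← finsum_neg_distrib, ← finsum_comp_equiv (Equiv.subRight (1 : ℤ))
        (f := fun n : ℤ => -((n.negOnePow : ℤ) * (c n : ℤ)))]
      refine finsum_congr fun n => ?_
      rw [Equiv.subRight_apply, Int.negOnePow_sub, Int.negOnePow_one]
      simp
    have hc'' : (Function.support fun n : ℤ => (n.negOnePow : ℤ) * (c (n - 1) : ℤ)).Finite := by
      refine hsub (t := x) hx fun n => ?_
      have := h1 (n - 1)
      rw [sub_add_cancel] at this
      omega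
    rw [← hc', ← finsum_add_distrib hc'' ha]
    refine finsum_congr fun n => ?_
    have := h1 (n - 1)
    rw [sub_add_cancel] at this
    rw [this]
    push_cast
    ring
  have ey : ∑ᶠ n : ℤ, (n.negOnePow : ℤ) * (y n : ℤ) =
      ∑ᶠ n : ℤ, (n.negOnePow : ℤ) * (a n : ℤ) + ∑ᶠ n : ℤ, (n.negOnePow : ℤ) * (b n : ℤ) := by
    rw [← finsum_add_distrib ha hb]
    refine finsum_congr fun n => ?_
    rw [h2]
    push_cast
    ring
  have ez : ∑ᶠ n : ℤ, (n.negOnePow : ℤ) * (z n : ℤ) =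
      ∑ᶠ n : ℤ, (n.negOnePow : ℤ) * (b n : ℤ) + ∑ᶠ n : ℤ, (n.negOnePow : ℤ) * (c n : ℤ) := by
    rw [← finsum_add_distrib hb hc]
    refine finsum_congr fun n => ?_
    rw [h3]
    push_cast
    ring
  rw [ex, ey, ez]
  ring

lemma euler_of_triangle (A : D) (hfin : ∀ M : D, Module.Finite k (A ⟶ M))
    (hsupp : ∀ M : D, (Function.support fun n : ℤ => Module.finrank k (A ⟶ M⟦n⟧)).Finite)
    {T : Triangle D} (hT : T ∈ distTriang D) :
    euler k A T.obj₂ = euler k A T.obj₁ + euler k A T.obj₃ := by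
  refine finsum_telescope (a := fun n => homRank k A (T.mor₁⟦n⟧'))
    (b := fun n => homRank k A (T.mor₂⟦n⟧')) (c := fun n => homRank k A (T.mor₃⟦n⟧'))
    (hsupp _) (hsupp _) (hsupp _) (fun n => ?_) (fun n => finrank_hom_eq A hfin hT n)
    (fun n => finrank_hom_eq A hfin (rot_of_distTriang _ hT) n)
  have e : ∀ M : D, M⟦n + 1⟧ ≅ (M⟦(1 : ℤ)⟧)⟦n⟧ := fun M =>
    (shiftFunctorAdd' D 1 n (n + 1) (add_comm _ _)).app M
  have h := finrank_hom_eq (k := k) A hfin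
    (rot_of_distTriang _ (rot_of_distTriang _ hT)) n
  refine (finrank_hom_of_iso A ((shiftFunctorAdd' D 1 n (n + 1) (add_comm _ _)).app T.obj₁)).trans
    (h.trans (congrArg _ ?_))
  change homRank k A ((shiftFunctor D n).map (-T.mor₁⟦(1 : ℤ)⟧')) = _
  rw [Functor.map_neg, homRank_neg]
  exact (homRank_of_iso A ((shiftFunctorAdd' D 1 n (n + 1) (add_comm _ _)).app T.obj₁)
    ((shiftFunctorAdd' D 1 n (n + 1) (add_comm _ _)).app T.obj₂)
    ((shiftFunctorAdd' D 1 n (n + 1) (add_comm _ _)).hom.naturality T.mor₁)).symm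

variable (k) in
/-- The Euler form as a homomorphism on the Grothendieck group. -/
noncomputable def eulerHom (A : D) (hfin : ∀ M : D, Module.Finite k (A ⟶ M))
    (hsupp : ∀ M : D, (Function.support fun n : ℤ => Module.finrank k (A ⟶ M⟦n⟧)).Finite) :
    K₀ D →+ ℤ :=
  QuotientAddGroup.lift (triangleRelations D) (FreeAbelianGroup.lift (euler k A)) (by
    rw [triangleRelations, AddSubgroup.closure_le]
    rintro _ ⟨T, hT, rfl⟩
    change FreeAbelianGroup.lift (euler k A) _ = 0
    rw [map_add, map_sub, FreeAbelianGroup.lift_apply_of, FreeAbelianGroup.lift_apply_of,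
      FreeAbelianGroup.lift_apply_of, euler_of_triangle A hfin hsupp hT]
    ring)

lemma eulerHom_cl (A : D) (hfin : ∀ M : D, Module.Finite k (A ⟶ M))
    (hsupp : ∀ M : D, (Function.support fun n : ℤ => Module.finrank k (A ⟶ M⟦n⟧)).Finite) (M : D) :
    eulerHom k A hfin hsupp (K₀.cl M) = euler k A M :=
  FreeAbelianGroup.lift_apply_of _ _

end Triangulated

/-! ### Euler forms and central charges of a helix -/

namespace IsA2Helix

variable {k : Type*} [Field k] {D : Type u} [Category.{v} D] [Preadditive D]
  [HasZeroObject D] [HasShift D ℤ] [∀ n : ℤ, (shiftFunctor D n).Additive] [Pretriangulated D]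
  [Linear k D] {E : ℤ → D} (hE : IsA2Helix k E)

include hE

lemma moduleFinite_hom (i : ℤ) (M : D) : Module.Finite k (E i ⟶ M) := by
  refine (hE.sumOf M).ind (R := fun M => Module.Finite k (E i ⟶ M)) ?_ ?_ ?_ ?_
  · intro Z hZ
    have : Subsingleton (E i ⟶ Z) := ⟨fun _ _ => hZ.eq_of_tgt _ _⟩
    infer_instance
  · rintro _ ⟨j, rfl⟩
    by_cases hi : j = i
    · subst hi
      exact Module.Finite.of_surjective (LinearMap.toSpanSingleton k (E j ⟶ E j) (𝟙 _)) fun f =>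
        (hE.end_scalar j f).imp fun _ h => h.symm
    by_cases hi' : j = i + 1
    · subst hi'
      obtain ⟨f, g, h, T⟩ := hE.triangle i
      exact Module.Finite.of_surjective (LinearMap.toSpanSingleton k (E i ⟶ E (i + 1)) f) fun x =>
        (hE.exists_comp_eq T x).imp fun _ h => h.symm
    · have : Subsingleton (E i ⟶ E j) := ⟨fun f g =>
        (hE.hom_eq_zero i j hi hi' f).trans (hE.hom_eq_zero i j hi hi' g).symm⟩
      infer_instance
  · intro X Y e _
    exact Module.Finite.of_injective (Linear.rightComp k (E i) e.hom)
      fun _ _ => (cancel_mono e.hom).1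
  · intro X Y _ _
    exact Module.Finite.of_injective
      ((Linear.rightComp k (E i) (biprod.fst : X ⊞ Y ⟶ X)).prod
        (Linear.rightComp k (E i) (biprod.snd : X ⊞ Y ⟶ Y)))
      fun f g hfg => biprod.hom_ext _ _ (congrArg Prod.fst hfg) (congrArg Prod.snd hfg)

lemma finite_support_hom (i : ℤ) (M : D) :
    (Function.support fun n : ℤ => Module.finrank k (E i ⟶ M⟦n⟧)).Finite := by
  have key : ∀ M : D, {n : ℤ | ∃ f : E i ⟶ M⟦n⟧, f ≠ 0}.Finite := by
    intro M
    refine (hE.sumOf M).ind (R := fun M => {n : ℤ | ∃ f : E i ⟶ M⟦n⟧, f ≠ 0}.Finite) ?_ ?_ ?_ ?_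
    · intro Z hZ
      refine Set.finite_empty.subset ?_
      rintro n ⟨f, hf⟩
      exact hf (((shiftFunctor D n).map_isZero hZ).eq_of_tgt _ _)
    · rintro _ ⟨j, rfl⟩
      refine (Set.finite_Icc (-|i - j|) (|i - j| + 1)).subset ?_
      rintro n ⟨f, hf⟩
      obtain ⟨e⟩ := hE.nonempty_shift_iso j n
      by_contra hn
      rw [Set.mem_Icc] at hn
      refine hf ?_
      rw [← cancel_mono e.hom, zero_comp]
      have := abs_le.1 (le_refl |i - j|)
      exact hE.hom_eq_zero _ _ (by omega) (by omega) _
    · intro X Y e hY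
      refine hY.subset ?_
      rintro n ⟨f, hf⟩
      refine ⟨f ≫ e.hom⟦n⟧', fun h => hf ?_⟩
      rwa [← cancel_mono (e.hom⟦n⟧'), zero_comp]
    · intro X Y hX hY
      refine (hX.union hY).subset ?_
      rintro n ⟨f, hf⟩
      by_contra hc
      simp only [Set.mem_union, Set.mem_ofPred_eq, not_or, not_exists, not_not] at hc
      refine hf ?_
      rw [← Category.comp_id f, ← CategoryTheory.Functor.map_id, ← biprod.total, Functor.map_add,
        Functor.map_comp, Functor.map_comp, Preadditive.comp_add, ← Category.assoc,
        ← Category.assoc, hc.1 (f ≫ biprod.fst⟦n⟧'), hc.2 (f ≫ biprod.snd⟦n⟧'), zero_comp,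
        zero_comp, add_zero]
  refine (key M).subset fun n hn => ?_
  by_contra hc
  simp only [Set.mem_ofPred_eq, not_exists, not_not] at hc
  have : Subsingleton (E i ⟶ M⟦n⟧) := ⟨fun f g => (hc f).trans (hc g).symm⟩
  exact hn Module.finrank_zero_of_subsingleton

/-- No shift of `E j` has index `i` or `i + 1`, so every term of the sum vanishes. -/
lemma euler_eq_zero (i j : ℤ) (h : (j - i) % 3 = 2) : euler k (E i) (E j) = 0 := by
  refine finsum_eq_zero_of_forall_eq_zero fun n => ?_
  obtain ⟨e⟩ := hE.nonempty_shift_iso j n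
  rw [finrank_hom_of_iso (E i) e]
  have : Subsingleton (E i ⟶ E (j + 3 * n)) := ⟨fun f g =>
    (hE.hom_eq_zero _ _ (by omega) (by omega) f).trans
      (hE.hom_eq_zero _ _ (by omega) (by omega) g).symm⟩
  rw [Module.finrank_zero_of_subsingleton, Nat.cast_zero, mul_zero]

lemma euler_self (i : ℤ) : euler k (E i) (E i) = 1 := by
  rw [euler, finsum_eq_single _ 0]
  · rw [finrank_hom_of_iso (E i) ((shiftFunctorZero D ℤ).app (E i))]
    have : Module.finrank k (E i ⟶ E i) = 1 := by
      refine (finrank_eq_one_iff_of_nonzero' (𝟙 (E i)) fun h => hE.not_isZero i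
        ((IsZero.iff_id_eq_zero _).2 h)).2 fun f => ?_
      exact (hE.end_scalar i f).imp fun _ h => h.symm
    change _ * ((Module.finrank k (E i ⟶ E i) : ℕ) : ℤ) = 1
    rw [this]
    simp
  · intro n hn
    obtain ⟨e⟩ := hE.nonempty_shift_iso i n
    rw [finrank_hom_of_iso (E i) e]
    have : Subsingleton (E i ⟶ E (i + 3 * n)) := ⟨fun f g =>
      (hE.hom_eq_zero _ _ (by omega) (by omega) f).trans
        (hE.hom_eq_zero _ _ (by omega) (by omega) g).symm⟩
    rw [Module.finrank_zero_of_subsingleton, Nat.cast_zero, mul_zero]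

lemma cl_succ (i : ℤ) : K₀.cl (E (i + 1)) = K₀.cl (E i) + K₀.cl (E (i + 2)) := by
  obtain ⟨f, g, h, T⟩ := hE.triangle i
  exact K₀.cl_of_triangle T

lemma cl_add_three (i : ℤ) : K₀.cl (E (i + 3)) = -K₀.cl (E i) := by
  obtain ⟨e⟩ := hE.shift i
  rw [← K₀.cl_of_iso e, K₀.cl_shift_one]

/-- There is a central charge with prescribed values at `E b` and `E (b + 2)`. -/
lemma exists_charge (b : ℤ) (z w : ℂ) :
    ∃ Z : K₀ D →+ ℂ, Z (K₀.cl (E b)) = z ∧ Z (K₀.cl (E (b + 2))) = w := by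
  -- The forms `χ b` and `χ (b + 1)` are dual to the classes of `E b` and `E (b + 2)`, which makes
  -- prescribing two values possible. The value 1 at `E (b + 2)` comes from the class relation of
  -- the triangle.
  let χ : ℤ → K₀ D →+ ℤ := fun i =>
    eulerHom k (E i) (hE.moduleFinite_hom i) (hE.finite_support_hom i)
  have hχ : ∀ i M, χ i (K₀.cl M) = euler k (E i) M := fun i => eulerHom_cl _ _ _
  have h1 : χ b (K₀.cl (E b)) = 1 := by rw [hχ, hE.euler_self]
  have h2 : χ b (K₀.cl (E (b + 2))) = 0 := by rw [hχ, hE.euler_eq_zero _ _ (by omega)]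
  have h3 : χ (b + 1) (K₀.cl (E b)) = 0 := by rw [hχ, hE.euler_eq_zero _ _ (by omega)]
  have h4 : χ (b + 1) (K₀.cl (E (b + 2))) = 1 := by
    have := congrArg (χ (b + 1)) (hE.cl_succ b)
    rw [map_add, h3, zero_add, hχ, hE.euler_self] at this
    exact this.symm
  refine ⟨(AddMonoidHom.mulLeft z).comp ((Int.castAddHom ℂ).comp (χ b)) +
    (AddMonoidHom.mulLeft w).comp ((Int.castAddHom ℂ).comp (χ (b + 1))), ?_, ?_⟩
  · simp [h1, h3]
  · simp [h2, h4]

end IsA2Helix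


/-! ### Harder-Narasimhan filtrations from iterated extensions -/

section Triangulated

variable {D : Type u} [Category.{v} D] [Preadditive D] [HasZeroObject D] [HasShift D ℤ]
  [∀ n : ℤ, (shiftFunctor D n).Additive] [Pretriangulated D]

/-- Hall products nest extensions to the right, filtrations nest them to the left. With `K` the
fibre of `L ⟶ N ⟶ C`, the octahedral axiom gives a triangle A[1] → K[1] → B[1], which is shifted
back. -/
lemma Extn.assoc [IsTriangulated D] {Q₁ Q₂ Q₃ : ObjectProperty D} (h₁ : IsoClosed Q₁)
    (h₂ : IsoClosed Q₂) {L : D} (h : Extn Q₁ (Extn Q₂ Q₃) L) : Extn (Extn Q₁ Q₂) Q₃ L := by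
  obtain ⟨A, N, a, f, g, hA, ⟨B, C, b, f', g', hB, hC, T'⟩, T⟩ := h
  obtain ⟨K, c, d, T''⟩ := distinguished_cocone_triangle₁ (f ≫ f')
  refine ⟨K, C, c, f ≫ f', d, ?_, hC, T''⟩
  obtain ⟨o⟩ := IsTriangulated.octahedron_axiom (rfl : f ≫ f' = f ≫ f') (rotate_distinguished T)
    (rotate_distinguished T') (rotate_distinguished T'')
  have S := Triangle.shift_distinguished _ o.mem (-1)
  have e : ∀ X : D, (X⟦(1 : ℤ)⟧)⟦(-1 : ℤ)⟧ ≅ X := fun X =>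
    (shiftFunctorCompIsoId D 1 (-1) (by norm_num)).app X
  exact Extn.isoClosed _ _ _ _ (e K)
    ⟨_, _, _, _, _, h₁ _ _ (e A).symm hA, h₂ _ _ (e B).symm hB, S⟩

lemma IterExtn.extn_of_append [IsTriangulated D] {Q : ObjectProperty D} (hQ : IsoClosed Q) :
    ∀ {l : List (ObjectProperty D)}, (∀ Q' ∈ l, IsoClosed Q') → ∀ {L : D},
      IterExtn (l ++ [Q]) L → Extn (IterExtn l) Q L
  | [], _, L, ⟨M, N, a, f, g, hM, hN, T⟩ => by
    have : IsIso a := (Triangle.isZero₃_iff_isIso₁ _ T).1 hN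
    exact ⟨N, L, _, _, _, hN, hQ _ _ (asIso a) hM, triangle_id_right L hN⟩
  | Q' :: l, h, L, ⟨M, N, a, f, g, hM, hN, T⟩ =>
    Extn.assoc (h Q' List.mem_cons_self) (isoClosed l) ⟨M, N, a, f, g, hM,
      extn_of_append hQ (fun Q'' hQ'' => h Q'' (List.mem_cons_of_mem _ hQ'')) hN, T⟩

/-- A tower of triangles with factors in given slices. -/
def HasTower (P : ℝ → ObjectProperty D) (M : D) (n : ℕ) (φ : ℕ → ℝ) : Prop :=
  ∃ X A : ℕ → D, IsZero (X 0) ∧ Nonempty (X n ≅ M) ∧ ∀ i < n, P (φ i) (A i) ∧ ¬ IsZero (A i) ∧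
    ∃ (f : X i ⟶ X (i + 1)) (g : X (i + 1) ⟶ A i) (h : A i ⟶ (X i)⟦(1 : ℤ)⟧),
      Triangle.mk f g h ∈ distTriang D

namespace HasTower

variable {P : ℝ → ObjectProperty D}

lemma nonempty_HNFiltration {M : D} {n : ℕ} {φ : ℕ → ℝ} (h : HasTower P M n φ)
    (hφ : ∀ i j, i < j → j < n → φ j < φ i) : Nonempty (HNFiltration P M) := by
  obtain ⟨X, A, h0, ⟨e⟩, hT⟩ := h
  choose hP hA f g h T using hT
  exact ⟨{
    n := n
    X := fun i => X i
    A := fun i => A i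
    φ := fun i => φ i
    isZero_zero := h0
    lastIso := e
    inc := fun i => f i i.2
    proj := fun i => g i i.2
    conn := fun i => h i i.2
    triangle := fun i => T i i.2
    factor_mem := fun i => hP i i.2
    factor_ne_zero := fun i => hA i i.2
    phase_anti := fun i j hij => hφ i j hij j.2 }⟩

lemma of_iso {M N : D} (e : M ≅ N) {n : ℕ} {φ : ℕ → ℝ} (h : HasTower P M n φ) :
    HasTower P N n φ := by
  obtain ⟨X, A, h0, ⟨e'⟩, hT⟩ := h
  exact ⟨X, A, h0, ⟨e' ≪≫ e⟩, hT⟩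

lemma snoc {N M A : D} {f : N ⟶ M} {g : M ⟶ A} {h : A ⟶ N⟦(1 : ℤ)⟧}
    (T : Triangle.mk f g h ∈ distTriang D) {n : ℕ} {φ : ℕ → ℝ} (hN : HasTower P N n φ) {ψ : ℝ}
    (hA : P ψ A) (hA0 : ¬ IsZero A) : HasTower P M (n + 1) fun i => if i < n then φ i else ψ := by
  obtain ⟨X, B, h0, ⟨e⟩, hT⟩ := hN
  refine ⟨fun i => if i ≤ n then X i else M, fun i => if i < n then B i else A, ?_, ?_, ?_⟩
  · beta_reduce
    rwa [if_pos (Nat.zero_le n)]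
  · beta_reduce
    rw [if_neg (by omega)]
    exact ⟨Iso.refl _⟩
  · intro i hi
    beta_reduce
    rcases (Nat.lt_succ_iff_lt_or_eq.1 hi) with hi' | rfl
    · rw [if_pos hi', if_pos hi', if_pos hi'.le, if_pos (Nat.succ_le_of_lt hi')]
      exact hT i hi'
    · rw [if_neg (lt_irrefl i), if_neg (lt_irrefl i), if_pos le_rfl, if_neg (by omega)]
      exact ⟨hA, hA0, e.hom ≫ f, g, h ≫ e.inv⟦(1 : ℤ)⟧', distinguished_of_iso T e.symm
        (Iso.refl _) (Iso.refl _) (by simp) (by simp) (by simp)⟩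

/-- The last class is split off as the last factor of the tower. A zero factor is dropped, since
Harder-Narasimhan factors must be nonzero; hence the phases are only claimed to belong to `l`. -/
lemma of_iterExtn [IsTriangulated D] (hP : ∀ φ, IsoClosed (P φ)) (l : List ℝ) :
    l.Pairwise (· > ·) → ∀ M, IterExtn (l.map P) M → ∃ n φ, HasTower P M n φ ∧
      (∀ i j, i < j → j < n → φ j < φ i) ∧ ∀ i < n, φ i ∈ l := by
  induction l using List.reverseRecOn with
  | nil =>
    intro _ M hM
    exact ⟨0, fun _ => 0, ⟨fun _ => M, fun _ => M, hM, ⟨Iso.refl _⟩, fun i hi => absurd hi (by omega)⟩,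
      fun i j _ hj => absurd hj (by omega), fun i hi => absurd hi (by omega)⟩
  | append_singleton l ψ ih =>
    intro hl M hM
    rw [List.pairwise_append] at hl
    rw [List.map_append, List.map_singleton] at hM
    obtain ⟨N, A, f, g, h, hN, hA, T⟩ := IterExtn.extn_of_append (hP ψ) (fun Q hQ => by
      obtain ⟨φ, -, rfl⟩ := List.mem_map.1 hQ
      exact hP φ) hM
    obtain ⟨n, φ, ht, hanti, hmem⟩ := ih hl.1 N hN
    by_cases hA0 : IsZero A
    · have : IsIso f := (Triangle.isZero₃_iff_isIso₁ _ T).1 hA0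
      exact ⟨n, φ, ht.of_iso (asIso f), hanti, fun i hi => List.mem_append_left _ (hmem i hi)⟩
    · refine ⟨n + 1, _, ht.snoc T hA hA0, fun i j hij hj => ?_, fun i hi => ?_⟩
      · have hi : i < n := by omega
        rw [if_pos hi]
        split_ifs with hj'
        · exact hanti i j hij hj'
        · exact hl.2.2 _ (hmem i hi) ψ (List.mem_singleton_self ψ)
      · split_ifs with hi'
        · exact List.mem_append_left _ (hmem i hi')
        · exact List.mem_append_right _ (List.mem_singleton_self ψ)

end HasTower

end Triangulated

/-! ### Construction of stability conditions -/

namespace PhaseData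

variable {k : Type*} [Field k] {D : Type u} [Category.{v} D] [Preadditive D]
  [HasZeroObject D] [HasShift D ℤ] [∀ n : ℤ, (shiftFunctor D n).Additive] [Pretriangulated D]
  [Linear k D] {E : ℤ → D}

/-- The slice of phase `φ` determined by the phases of the semistable objects of a helix. -/
def slice (E : ℤ → D) (ss : Set ℤ) (ph : ℤ → ℝ) (φ : ℝ) : ObjectProperty D := fun M =>
  (∀ i ∈ ss, φ < ph i → ∀ f : E i ⟶ M, f = 0) ∧ (∀ i ∈ ss, ph i < φ → ∀ f : M ⟶ E i, f = 0)

variable {ss : Set ℤ} {ph : ℤ → ℝ}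

lemma slice_zero (φ : ℝ) {X : D} (hX : IsZero X) : slice E ss ph φ X :=
  ⟨fun _ _ _ _ => hX.eq_of_tgt _ _, fun _ _ _ _ => hX.eq_of_src _ _⟩

lemma slice_ext (φ : ℝ) {T : Triangle D} (hT : T ∈ distTriang D) (h₁ : slice E ss ph φ T.obj₁)
    (h₃ : slice E ss ph φ T.obj₃) : slice E ss ph φ T.obj₂ := by
  refine ⟨fun i hi hlt f => ?_, fun i hi hlt f => ?_⟩
  · obtain ⟨g, rfl⟩ := Triangle.coyoneda_exact₂ _ hT f (h₃.1 i hi hlt _)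
    rw [h₁.1 i hi hlt g, zero_comp]
  · obtain ⟨g, rfl⟩ := Triangle.yoneda_exact₂ _ hT f (h₁.2 i hi hlt _)
    rw [h₃.2 i hi hlt g, comp_zero]

lemma slice_of_retract {φ : ℝ} {X M : D} (i : X ⟶ M) (r : M ⟶ X) (hir : i ≫ r = 𝟙 X)
    (h : slice E ss ph φ M) : slice E ss ph φ X := by
  refine ⟨fun j hj hlt f => ?_, fun j hj hlt f => ?_⟩
  · rw [← Category.comp_id f, ← hir, ← Category.assoc, h.1 j hj hlt (f ≫ i), zero_comp]
  · rw [← Category.id_comp f, ← hir, Category.assoc, h.2 j hj hlt (r ≫ f), comp_zero]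

lemma slice_isoClosed (φ : ℝ) : IsoClosed (slice E ss ph φ) := fun _ _ e h =>
  slice_of_retract e.inv e.hom e.inv_hom_id h

variable (hE : IsA2Helix k E) (d : PhaseData ss ph)
include hE d

/-- For a missing index the nonzero maps from and to its neighbours would force `ph (i - 1) ≤ φ ≤ ph
(i + 1)`, against the strict inequality in `PhaseData`. For a present index, monotonicity between
neighbours gives the orthogonality. -/
lemma slice_helix_iff (i : ℤ) (φ : ℝ) : slice E ss ph φ (E i) ↔ i ∈ ss ∧ ph i = φ := by
  constructor
  · intro h
    by_cases hi : i ∈ ss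
    · refine ⟨hi, ?_⟩
      by_contra hne
      refine hE.not_isZero i ((IsZero.iff_id_eq_zero _).2 ?_)
      rcases lt_or_gt_of_ne hne with hlt | hlt
      · exact h.2 i hi hlt _
      · exact h.1 i hi hlt _
    · obtain ⟨j, rfl⟩ : ∃ j, i = j + 1 := ⟨i - 1, by ring⟩
      have h1 := d.mem_pred _ hi
      have h2 := d.mem_succ _ hi
      have h3 := d.gt _ hi
      rw [add_sub_cancel_right] at h1 h3
      obtain ⟨f, hf⟩ := hE.exists_hom_ne_zero j
      obtain ⟨g, hg⟩ := hE.exists_hom_ne_zero (j + 1)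
      have h4 : ph j ≤ φ := not_lt.1 fun hlt => hf (h.1 j h1 hlt f)
      have h5 : φ ≤ ph (j + 1 + 1) := not_lt.1 fun hlt => hg (h.2 _ h2 hlt g)
      linarith
  · rintro ⟨hi, rfl⟩
    refine ⟨fun j hj hlt f => ?_, fun j hj hlt f => ?_⟩
    · refine hE.hom_eq_zero _ _ ?_ ?_ f
      · rintro rfl
        exact lt_irrefl _ hlt
      · rintro rfl
        exact absurd (d.le j hj hi) (not_le.2 hlt)
    · refine hE.hom_eq_zero _ _ ?_ ?_ f
      · rintro rfl
        exact lt_irrefl _ hlt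
      · rintro rfl
        exact absurd (d.le i hi hj) (not_le.2 hlt)

lemma sumOf_of_slice {φ : ℝ} {M : D} (h : slice E ss ph φ M) :
    SumOf (fun X => ∃ i ∈ ss, ph i = φ ∧ X = E i) M := by
  refine (hE.sumOf M).retracts ?_
  rintro _ s r hsr ⟨i, rfl⟩
  obtain ⟨hi, hφ⟩ := (d.slice_helix_iff hE i φ).1 (slice_of_retract s r hsr h)
  exact ⟨i, hi, hφ, rfl⟩

lemma slice_hom_eq_zero {φ ψ : ℝ} {A B : D} (hA : slice E ss ph φ A) (hB : slice E ss ph ψ B)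
    (h : ψ < φ) (f : A ⟶ B) : f = 0 := by
  refine SumOf.hom_eq_zero ?_ (d.sumOf_of_slice hE hA) (d.sumOf_of_slice hE hB) f
  rintro _ _ ⟨i, hi, rfl, rfl⟩ ⟨j, hj, rfl, rfl⟩
  exact ((d.slice_helix_iff hE j (ph j)).2 ⟨hj, rfl⟩).1 i hi h

lemma slice_shift_iff (φ : ℝ) (M : D) :
    slice E ss ph (φ + 1) (M⟦(1 : ℤ)⟧) ↔ slice E ss ph φ M := by
  have hsurj : ∀ i : ℤ, ∃ j, i = j + 3 := fun i => ⟨i - 3, by ring⟩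
  have h1 : ∀ i, (∀ f : E (i + 3) ⟶ M⟦(1 : ℤ)⟧, f = 0) ↔ ∀ f : E i ⟶ M, f = 0 := by
    intro i
    obtain ⟨e⟩ := hE.shift i
    refine ⟨fun h f => (shiftFunctor D (1 : ℤ)).map_injective ?_, fun h f => ?_⟩
    · rw [Functor.map_zero, ← cancel_epi e.inv, comp_zero]
      exact h _
    · obtain ⟨g, hg⟩ := (shiftFunctor D (1 : ℤ)).map_surjective (e.hom ≫ f)
      rw [← cancel_epi e.hom, comp_zero, ← hg, h g, Functor.map_zero]
  have h2 : ∀ i, (∀ f : M⟦(1 : ℤ)⟧ ⟶ E (i + 3), f = 0) ↔ ∀ f : M ⟶ E i, f = 0 := by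
    intro i
    obtain ⟨e⟩ := hE.shift i
    refine ⟨fun h f => (shiftFunctor D (1 : ℤ)).map_injective ?_, fun h f => ?_⟩
    · rw [Functor.map_zero, ← cancel_mono e.hom, zero_comp]
      exact h _
    · obtain ⟨g, hg⟩ := (shiftFunctor D (1 : ℤ)).map_surjective (f ≫ e.inv)
      rw [← cancel_mono e.inv, zero_comp, ← hg, h g, Functor.map_zero]
  refine and_congr ⟨fun h i hi hlt => ?_, fun h i hi hlt => ?_⟩
    ⟨fun h i hi hlt => ?_, fun h i hi hlt => ?_⟩
  · exact (h1 i).1 (h _ ((d.mem_shift i).2 hi) (by rw [d.ph_shift]; linarith))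
  · obtain ⟨j, rfl⟩ := hsurj i
    rw [d.ph_shift] at hlt
    exact (h1 j).2 (h _ ((d.mem_shift j).1 hi) (by linarith))
  · exact (h2 i).1 (h _ ((d.mem_shift i).2 hi) (by rw [d.ph_shift]; linarith))
  · obtain ⟨j, rfl⟩ := hsurj i
    rw [d.ph_shift] at hlt
    exact (h2 j).2 (h _ ((d.mem_shift j).1 hi) (by linarith))

lemma slice_exists_HN [IsTriangulated D] (M : D) :
    Nonempty (HNFiltration (slice E ss ph) M) := by
  obtain ⟨s, hs⟩ := exists_iterExtn (Q := fun φ : ℝᵒᵈ => slice E ss ph (OrderDual.ofDual φ))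
    (fun φ X hX => slice_zero _ hX)
    (fun φ X Y hX hY => slice_ext _ (binaryBiproductTriangle_distinguished X Y) hX hY)
    (R := fun X => ∃ i, X = E i) (by
      rintro _ ⟨i, rfl⟩
      by_cases hi : i ∈ ss
      · exact iterExtn_single (a := OrderDual.toDual (ph i)) ((d.slice_helix_iff hE _ _).2 ⟨hi, rfl⟩)
      · have h1 := d.mem_pred _ hi
        have h2 := d.mem_succ _ hi
        have h3 := d.gt _ hi
        obtain ⟨j, rfl⟩ : ∃ j, i = j + 1 := ⟨i - 1, by ring⟩
        obtain ⟨f, g, h, T⟩ := hE.triangle j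
        rw [add_sub_cancel_right] at h1 h3
        rw [add_assoc] at h2 h3
        exact iterExtn_pair (a := OrderDual.toDual (ph j)) (b := OrderDual.toDual (ph (j + 2))) h3
          ((d.slice_helix_iff hE _ _).2 ⟨h1, rfl⟩) ((d.slice_helix_iff hE _ _).2 ⟨h2, rfl⟩) T)
    (hE.sumOf M)
  obtain ⟨n, φ, ht, hanti, -⟩ := HasTower.of_iterExtn (P := slice E ss ph) slice_isoClosed
    ((s.sort (· ≤ ·)).map OrderDual.ofDual)
    (List.pairwise_map.2 (s.sortedLT_sort.pairwise.imp fun h => h)) M (by rwa [List.map_map])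
  exact ht.nonempty_HNFiltration hanti

omit hE d in
lemma exp_add_one (φ : ℝ) : Complex.exp (Complex.I * Real.pi * ((φ + 1 : ℝ) : ℂ)) =
    -Complex.exp (Complex.I * Real.pi * φ) := by
  rw [show Complex.I * Real.pi * ((φ + 1 : ℝ) : ℂ) =
    Complex.I * Real.pi * φ + Real.pi * Complex.I by push_cast; ring, Complex.exp_add,
    Complex.exp_pi_mul_I, mul_neg_one]

lemma slice_charge (Z : K₀ D →+ ℂ)
    (hZ : ∀ i ∈ ss, ∃ m : ℝ, 0 < m ∧ Z (K₀.cl (E i)) = m * Complex.exp (Complex.I * Real.pi * ph i))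
    {φ : ℝ} {M : D} (hM : slice E ss ph φ M) (h0 : ¬ IsZero M) :
    ∃ m : ℝ, 0 < m ∧ Z (K₀.cl M) = m * Complex.exp (Complex.I * Real.pi * φ) := by
  -- Zero summands may occur in the induction, so the mass is only required to be nonnegative, and
  -- positive for nonzero objects.
  obtain ⟨m, -, hm, h⟩ := (d.sumOf_of_slice hE hM).ind (R := fun M => ∃ m : ℝ, 0 ≤ m ∧
      (¬ IsZero M → 0 < m) ∧ Z (K₀.cl M) = m * Complex.exp (Complex.I * Real.pi * φ))
    (fun X hX => ⟨0, le_rfl, fun h => absurd hX h, by rw [K₀.cl_zero hX, map_zero]; simp⟩)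
    (by
      rintro _ ⟨i, hi, rfl, rfl⟩
      obtain ⟨m, hm, h⟩ := hZ i hi
      exact ⟨m, hm.le, fun _ => hm, h⟩)
    (by
      rintro X Y e ⟨m, hm, hm', h⟩
      exact ⟨m, hm, fun hX => hm' fun hY => hX (hY.of_iso e), by rw [K₀.cl_of_iso e, h]⟩)
    (by
      rintro X Y ⟨m, hm, hm', h⟩ ⟨n, hn, hn', h'⟩
      refine ⟨m + n, add_nonneg hm hn, fun hXY => ?_, ?_⟩
      · rw [biprod_isZero_iff, not_and_or] at hXY
        rcases hXY with hX | hY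
        · exact add_pos_of_pos_of_nonneg (hm' hX) hn
        · exact add_pos_of_nonneg_of_pos hm (hn' hY)
      · rw [K₀.cl_biprod, map_add, h, h']
        push_cast
        ring)
  exact ⟨m, hm h0, h⟩

/-- The stability condition determined by the phases and a compatible central charge. -/
noncomputable def stabilityCondition [IsTriangulated D] (Z : K₀ D →+ ℂ)
    (hZ : ∀ i ∈ ss, ∃ m : ℝ, 0 < m ∧
      Z (K₀.cl (E i)) = m * Complex.exp (Complex.I * Real.pi * ph i)) : StabilityCondition D where
  Z := Z
  P := slice E ss ph
  zero_mem _ _ := slice_zero _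
  ext_closed _ _ := slice_ext _
  charge _ _ := d.slice_charge hE Z hZ
  shift_iff := d.slice_shift_iff hE
  hom_eq_zero _ _ _ _ := d.slice_hom_eq_zero hE
  exists_HN M _ := d.slice_exists_HN hE M

/-- Three consecutive indices suffice: under `i ↦ i + 3` both the charge and the exponential change
sign. -/
lemma exists_stabilityCondition [IsTriangulated D] (b : ℤ) (Z : K₀ D →+ ℂ)
    (hZ : ∀ i, (i = b ∨ i = b + 1 ∨ i = b + 2) → i ∈ ss → ∃ m : ℝ, 0 < m ∧
      Z (K₀.cl (E i)) = m * Complex.exp (Complex.I * Real.pi * ph i)) :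
    ∃ σ : StabilityCondition D, ∀ i φ, σ.P φ (E i) ↔ i ∈ ss ∧ ph i = φ := by
  refine ⟨d.stabilityCondition hE Z ?_, d.slice_helix_iff hE⟩
  have key : ∀ i m : ℤ, (∃ r : ℝ, 0 < r ∧
      Z (K₀.cl (E i)) = r * Complex.exp (Complex.I * Real.pi * ph i)) → ∃ r : ℝ, 0 < r ∧
      Z (K₀.cl (E (i + 3 * m))) = r * Complex.exp (Complex.I * Real.pi * ph (i + 3 * m)) := by
    have step : ∀ (i : ℤ) (r : ℝ),
        Z (K₀.cl (E (i + 3))) = r * Complex.exp (Complex.I * Real.pi * ph (i + 3)) ↔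
        Z (K₀.cl (E i)) = r * Complex.exp (Complex.I * Real.pi * ph i) := fun i r => by
      rw [hE.cl_add_three, map_neg, d.ph_shift, exp_add_one, mul_neg, neg_inj]
    rintro i m ⟨r, hr, h⟩
    refine ⟨r, hr, ?_⟩
    induction m using Int.induction_on with
    | zero => rwa [mul_zero, add_zero]
    | succ m ih => rwa [show i + 3 * ((m : ℤ) + 1) = i + 3 * m + 3 by ring, step]
    | pred m ih =>
      rwa [← step, show i + 3 * (-(m : ℤ) - 1) + 3 = i + 3 * -(m : ℤ) by ring]
  intro i hi
  obtain ⟨r, m, hr, rfl⟩ : ∃ r m, (r = b ∨ r = b + 1 ∨ r = b + 2) ∧ i = r + 3 * m :=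
    ⟨b + (i - b) % 3, (i - b) / 3, by omega, by omega⟩
  exact key r m (hZ r hr ((d.mem_add_mul _ _).1 hi))

end PhaseData

/-! ### Phases for every heart type -/

/-- The phases that repeat with a shift by one and take the values `p`, `q`, `r` at `b`, `b + 1`,
`b + 2`. -/
noncomputable def periodicPhase (b : ℤ) (p q r : ℝ) (i : ℤ) : ℝ :=
  (if (i - b) % 3 = 0 then p else if (i - b) % 3 = 1 then q else r) + ((i - b) / 3 : ℤ)

lemma periodicPhase_eq (b : ℤ) (p q r : ℝ) (m : ℤ) :
    periodicPhase b p q r (b + 3 * m) = p + m ∧ periodicPhase b p q r (b + 1 + 3 * m) = q + m ∧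
      periodicPhase b p q r (b + 2 + 3 * m) = r + m := by
  have h0 : (b + 3 * m - b) % 3 = 0 ∧ (b + 3 * m - b) / 3 = m := by omega
  have h1 : (b + 1 + 3 * m - b) % 3 = 1 ∧ (b + 1 + 3 * m - b) / 3 = m := by omega
  have h2 : (b + 2 + 3 * m - b) % 3 = 2 ∧ (b + 2 + 3 * m - b) / 3 = m := by omega
  simp only [periodicPhase, h0, h1, h2]
  norm_num

lemma exists_eq_add_mul (b i : ℤ) : ∃ m, i = b + 3 * m ∨ i = b + 1 + 3 * m ∨ i = b + 2 + 3 * m :=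
  ⟨(i - b) / 3, by omega⟩

lemma periodicPhase_shift (b : ℤ) (p q r : ℝ) (i : ℤ) :
    periodicPhase b p q r (i + 3) = periodicPhase b p q r i + 1 := by
  obtain ⟨m, hm⟩ := exists_eq_add_mul b i
  obtain ⟨h0, h1, h2⟩ := periodicPhase_eq b p q r m
  obtain ⟨h0', h1', h2'⟩ := periodicPhase_eq b p q r (m + 1)
  push_cast at h0' h1' h2'
  rcases hm with rfl | rfl | rfl
  · rw [h0, show b + 3 * m + 3 = b + 3 * (m + 1) by ring, h0', add_assoc]
  · rw [h1, show b + 1 + 3 * m + 3 = b + 1 + 3 * (m + 1) by ring, h1', add_assoc]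
  · rw [h2, show b + 2 + 3 * m + 3 = b + 2 + 3 * (m + 1) by ring, h2', add_assoc]

/-- The value 0 at the missing index `b + 1` is a placeholder that no constraint on phases involves,
apart from periodicity. -/
lemma phaseData_two (b : ℤ) {p r : ℝ} (h : r < p) :
    PhaseData {i | (i - b) % 3 ≠ 1} (periodicPhase b p 0 r) where
  mem_shift i := by
    change (i + 3 - b) % 3 ≠ 1 ↔ (i - b) % 3 ≠ 1
    omega
  ph_shift := periodicPhase_shift b p 0 r
  le i hi hi' := by
    change (i - b) % 3 ≠ 1 at hi
    change (i + 1 - b) % 3 ≠ 1 at hi'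
    obtain ⟨m, hm⟩ := exists_eq_add_mul b i
    obtain rfl : i = b + 2 + 3 * m := by omega
    rw [show b + 2 + 3 * m + 1 = b + 3 * (m + 1) by ring, (periodicPhase_eq b p 0 r m).2.2,
      (periodicPhase_eq b p 0 r (m + 1)).1]
    push_cast
    linarith
  mem_pred i hi := by
    change ¬ (i - b) % 3 ≠ 1 at hi
    change (i - 1 - b) % 3 ≠ 1
    omega
  mem_succ i hi := by
    change ¬ (i - b) % 3 ≠ 1 at hi
    change (i + 1 - b) % 3 ≠ 1
    omega
  gt i hi := by
    change ¬ (i - b) % 3 ≠ 1 at hi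
    obtain ⟨m, hm⟩ := exists_eq_add_mul b i
    obtain rfl : i = b + 1 + 3 * m := by omega
    rw [show b + 1 + 3 * m + 1 = b + 2 + 3 * m by ring,
      show b + 1 + 3 * m - 1 = b + 3 * m by ring, (periodicPhase_eq b p 0 r m).2.2,
      (periodicPhase_eq b p 0 r m).1]
    linarith

lemma phaseData_all (b : ℤ) {p q r : ℝ} (h : p ≤ q) (h' : q ≤ r) (h'' : r ≤ p + 1) :
    PhaseData Set.univ (periodicPhase b p q r) where
  mem_shift i := Iff.rfl
  ph_shift := periodicPhase_shift b p q r
  le i _ _ := by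
    obtain ⟨m, rfl | rfl | rfl⟩ := exists_eq_add_mul b i
    · rw [show b + 3 * m + 1 = b + 1 + 3 * m by ring, (periodicPhase_eq b p q r m).1,
        (periodicPhase_eq b p q r m).2.1]
      linarith
    · rw [show b + 1 + 3 * m + 1 = b + 2 + 3 * m by ring, (periodicPhase_eq b p q r m).2.1,
        (periodicPhase_eq b p q r m).2.2]
      linarith
    · rw [show b + 2 + 3 * m + 1 = b + 3 * (m + 1) by ring, (periodicPhase_eq b p q r m).2.2,
        (periodicPhase_eq b p q r (m + 1)).1]
      push_cast
      linarith
  mem_pred i hi := absurd (Set.mem_univ i) hi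
  mem_succ i hi := absurd (Set.mem_univ i) hi
  gt i hi := absurd (Set.mem_univ i) hi

lemma periodicPhase_base (b : ℤ) (p q r : ℝ) : periodicPhase b p q r b = p ∧
    periodicPhase b p q r (b + 1) = q ∧ periodicPhase b p q r (b + 2) = r := by
  simpa using periodicPhase_eq b p q r 0

/-! ### Stability conditions realising every heart type -/

namespace IsA2Helix

variable {k : Type*} [Field k] {D : Type u} [Category.{v} D] [Preadditive D]
  [HasZeroObject D] [HasShift D ℤ] [∀ n : ℤ, (shiftFunctor D n).Additive] [Pretriangulated D]
  [Linear k D] [IsTriangulated D] {E : ℤ → D} (hE : IsA2Helix k E)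
include hE

lemma exists_stabilityCondition_two (b : ℤ) {p r : ℝ} (h : r < p) (t : HeartType)
    (ht : b + 1 ∉ {i : ℤ | (i - b) % 3 ≠ 1} →
      t.Holds {i | (i - b) % 3 ≠ 1} (periodicPhase b p 0 r) b) :
    ∃ (σ : StabilityCondition D) (ss : Set ℤ) (ph : ℤ → ℝ), PhaseData ss ph ∧
      (∀ i φ, σ.P φ (E i) ↔ i ∈ ss ∧ ph i = φ) ∧ t.Holds ss ph b := by
  obtain ⟨Z, hZ, hZ'⟩ := hE.exists_charge b (Complex.exp (Complex.I * Real.pi * p))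
    (Complex.exp (Complex.I * Real.pi * r))
  obtain ⟨e0, -, e2⟩ := periodicPhase_base b p 0 r
  have hb : b + 1 ∉ {i : ℤ | (i - b) % 3 ≠ 1} := fun h => h (by omega)
  obtain ⟨σ, hσ⟩ := (phaseData_two b h).exists_stabilityCondition hE b Z (by
    rintro i (rfl | rfl | rfl) hi
    · exact ⟨1, one_pos, by rw [hZ, e0, Complex.ofReal_one, one_mul]⟩
    · exact absurd hi hb
    · exact ⟨1, one_pos, by rw [hZ', e2, Complex.ofReal_one, one_mul]⟩)
  exact ⟨σ, _, _, phaseData_two b h, hσ, ht hb⟩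

lemma exists_stabilityCondition (b : ℤ) (t : HeartType) :
    ∃ (σ : StabilityCondition D) (ss : Set ℤ) (ph : ℤ → ℝ), PhaseData ss ph ∧
      (∀ i φ, σ.P φ (E i) ↔ i ∈ ss ∧ ph i = φ) ∧ t.Holds ss ph b := by
  cases t with
  | le n =>
    have hn : (0 : ℝ) ≤ n := n.cast_nonneg
    -- Here `r + n + 1 = 1 / 2 = p`, so both generators of the heart have phase 1/2.
    refine hE.exists_stabilityCondition_two b (p := 1 / 2) (r := -1 / 2 - n) (by linarith) _
      fun hb => ?_
    obtain ⟨e0, -, e2⟩ := periodicPhase_base b (1 / 2) 0 (-1 / 2 - n)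
    refine ⟨hb, ?_, ?_, ?_⟩ <;> simp only [e0, e2] <;> linarith
  | gt n =>
    have hn : (0 : ℝ) ≤ n := n.cast_nonneg
    -- Here `r + n = 1 / 2 < 1 = p`.
    refine hE.exists_stabilityCondition_two b (p := 1) (r := 1 / 2 - n) (by linarith) _
      fun hb => ?_
    obtain ⟨e0, -, e2⟩ := periodicPhase_base b 1 0 (1 / 2 - n)
    refine ⟨hb, ?_, ?_, ?_⟩ <;> simp only [e0, e2] <;> linarith
  | all =>
    obtain ⟨Z, hZ, hZ'⟩ := hE.exists_charge b (Complex.exp (Complex.I * Real.pi * (1 / 2 : ℝ)))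
      (Complex.exp (Complex.I * Real.pi * (1 / 2 : ℝ)))
    obtain ⟨e0, e1, e2⟩ := periodicPhase_base b (1 / 2) (1 / 2) (1 / 2)
    have d : PhaseData Set.univ (periodicPhase b (1 / 2) (1 / 2) (1 / 2)) :=
      phaseData_all b le_rfl le_rfl (by norm_num)
    obtain ⟨σ, hσ⟩ := d.exists_stabilityCondition hE b Z (by
      rintro i (rfl | rfl | rfl) hi
      · exact ⟨1, one_pos, by rw [hZ, e0, Complex.ofReal_one, one_mul]⟩
      -- All three phases are 1/2, and the class of `E (b + 1)` is the sum of the other two, so its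
      -- mass is 2.
      · refine ⟨2, two_pos, ?_⟩
        rw [hE.cl_succ, map_add, hZ, hZ', e1, ← two_mul, Complex.ofReal_ofNat]
      · exact ⟨1, one_pos, by rw [hZ', e2, Complex.ofReal_one, one_mul]⟩)
    refine ⟨σ, _, _, d, hσ, fun i => Set.mem_univ i, ?_, ?_⟩
    · rw [e0]
      norm_num
    · rw [e2]
      norm_num

end IsA2Helix

lemma Row.exists_holds (k : Type u) [Field k] [HasDerivedCategory.{w} (RepA2 k)] (r : Row) :
    ∃ σ : StabilityCondition (DbA2 k), r.Holds σ := by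
  obtain ⟨σ, ss, ph, d, hσ, h⟩ := (isA2Helix_helix k).exists_stabilityCondition r.base r.htype
  exact ⟨σ, (r.holds_iff d hσ).2 h⟩

end Stab

/-! ### The classification theorem -/

theorem mainTheorem5 (k : Type u) [Field k] [HasDerivedCategory.{w} (Stab.RepA2 k)] :
    -- statements about an arbitrary stability condition
    (∀ σ : Stab.StabilityCondition (Stab.DbA2 k),
      -- at least two of the three objects are semistable
      (∃ X Y : Stab.Ind, X ≠ Y ∧ Stab.IsSemistable k σ X ∧ Stab.IsSemistable k σ Y) ∧
      -- exactly one shift of it is in exactly one of the twelve rows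
      (∃! p : ℤ × Stab.Row, p.2.Holds (σ.shift p.1)) ∧
      -- the phases lie in the range of the row, and the explicit wall-crossing formula holds
      (∀ (m : ℤ) (r : Stab.Row), r.Holds (σ.shift m) →
        r.phaseRange σ ∧ (Finite k → r.WallCrossing k)) ∧
      -- the wall-crossing formula in terms of the slices, phases decreasing from left to right
      (Finite k → Stab.HasOrderedProd (fun φ : ℝᵒᵈ => σ.SS (OrderDual.ofDual φ))
        (fun _ : Stab.IsoClass (Stab.DbA2 k) => (1 : ℚ)))) ∧
    -- every row occurs, for every value of its parameter
    (∀ r : Stab.Row, ∃ σ : Stab.StabilityCondition (Stab.DbA2 k), r.Holds σ) := by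
  refine ⟨fun σ => ?_, Stab.Row.exists_holds k⟩
  obtain ⟨ss, ph, d, hσ⟩ := (Stab.isA2Helix_helix k).exists_phaseData σ
  exact ⟨Stab.Row.exists_two_semistable d hσ, Stab.Row.existsUnique_holds d hσ,
    fun m r h => ⟨r.phaseRange_of_holds d hσ m h, fun _ => r.wallCrossing k⟩,
    fun _ => (Stab.isA2Helix_helix k).hasOrderedProd_SS d hσ⟩
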